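/- Let $k$ be a field of characteristic different from $2$ (for instance $k=\mathbb R$) and let $R=k[x,y,z]$, graded with $x,y,z$ in degree $2$. Let $S_3$ be generated by $s$ and $r$; on $R$, $s$ exchanges $x,y$ and $r$ exchanges $y,z$. Write $R^s$, $R^r$, $R^{s,r}$ for the rings of invariants. All bimodules are $\mathbb Z$-graded $R$-bimodules on which the left and right actions of $k$ agree; isomorphisms are homogeneous of degree $0$; $M(n)_i=M_{n+i}$; $MN:=M\otimes_R N$. Put $$B_e=R,\quad B_s=R\otimes_{R^s}R(1),\quad B_r=R\otimes_{R^r}R(1),\quad B_{sr}=B_sB_r,\quad B_{rs}=B_rB_s,\quad B_{srs}=R\otimes_{R^{s,r}}R(3).$$ A Soergel bimodule (for $S_3$) is a graded bimodule isomorphic to a finite direct sum of shifts $B_w(m)$, $w\in S_3$, $m\in\mathbb Z$. Let $\mathcal H$ be the Hecke algebra of $S_3$: the $\mathbb Z[v,v^{-1}]$-algebra with generators $h_s,h_r$ and relations $h_s^2=(v^{-1}-v)h_s+1$, $h_r^2=(v^{-1}-v)h_r+1$, $h_sh_rh_s=h_rh_sh_r$. Let $h_w$ be the product of the generators along a reduced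 word of $w$, and let $d$ be the ring endomorphism of $\mathcal H$ with $d(v)=v^{-1}$, $d(h_s)=h_s^{-1}$, $d(h_r)=h_r^{-1}$. Then for every $w\in S_3$ there is a unique $b_w\in h_w+\sum_{y}v\mathbb Z[v]h_y$ with $d(b_w)=b_w$ (the Kazhdan–Lusztig element); explicitly $b_e=1$, $b_s=h_s+v$, $b_r=h_r+v$, $b_{sr}=b_sb_r$, $b_{rs}=b_rb_s$, $b_{srs}=b_sb_rb_s-b_s$; and $(b_w)_{w\in S_3}$ is a $\mathbb Z[v,v^{-1}]$-basis of $\mathcal H$. Moreover: 1. The six bimodules $R,B_s,B_r,B_{sr},B_{rs},B_{srs}$ are indecomposable as graded bimodules. 2. The map $(w,m)\mapsto B_w(m)$ is a bijection from $S_3\times\mathbb Z$ onto the set of isomorphism classes of indecomposable Soergel bimodules. 3. Finite direct sums, shifts and products $MN$ of Soergel bimodules are Soergel bimodules. The set $\mathbb N\mathcal B(S_3)$ of isomorphism classes $\langle M\rangle$ of Soergel bimodules is a semiring and an algebra over $\mathbb N[v,v^{-1}]$ with $\langle M\rangle+\langle N\rangle=\langle M\oplus N\rangle$, $\langle M\rangle\langle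 N\rangle=\langle MN\rangle$, $v\langle M\rangle=\langle M(1)\rangle$. The positive part $\bigoplus_{w\in S_3}\mathbb N[v,v^{-1}]b_w\subset\mathcal H$ is an $\mathbb N[v,v^{-1}]$-subalgebra, and there is exactly one isomorphism of $\mathbb N[v,v^{-1}]$-algebras from $\mathbb N\mathcal B(S_3)$ onto it with $\langle B_w\rangle\mapsto b_w$ for all $w\in S_3$. 4. The split Grothendieck group $\langle\mathcal B(S_3)\rangle$ (the free abelian group on the Soergel bimodules modulo the relations $\langle M\rangle=\langle N\rangle+\langle P\rangle$ whenever $M\cong N\oplus P$) is a $\mathbb Z[v,v^{-1}]$-algebra with its given addition and with $\langle M\rangle\langle N\rangle=\langle MN\rangle$, $v\langle M\rangle=\langle M(1)\rangle$. There is exactly one isomorphism of $\mathbb Z[v,v^{-1}]$-algebras $\langle\mathcal B(S_3)\rangle\to\mathcal H$ with $\langle B_w\rangle\mapsto b_w$ for all $w\in S_3$ and $\langle R(1)\rangle\mapsto v$. -/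

import Mathlib

open scoped TensorProduct LaurentPolynomial

universe u

namespace SoergelS3

/-! ## The Hecke algebra of `S_3` -/

/-- The symmetric group `S_3`. -/
abbrev S3 : Type := Equiv.Perm (Fin 3)

/-- The two simple reflections: `simpleRefl 0 = s` swaps the first two letters and
`simpleRefl 1 = r` swaps the last two. -/
def simpleRefl (i : Fin 2) : S3 := Equiv.swap i.castSucc i.succ

/-- A reduced word for every element of `S_3`; the last case is the longest element `srs`. -/
def redWord (w : S3) : List (Fin 2) :=
  if w = 1 then []
  else if w = simpleRefl 0 then [0]
  else if w = simpleRefl 1 then [1]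
  else if w = simpleRefl 0 * simpleRefl 1 then [0, 1]
  else if w = simpleRefl 1 * simpleRefl 0 then [1, 0]
  else [0, 1, 0]

lemma redWord_prod (w : S3) : ((redWord w).map simpleRefl).prod = w := by
  revert w; decide

/-- The longest element `srs = rsr`. -/
def longest : S3 := simpleRefl 0 * simpleRefl 1 * simpleRefl 0

/-- The defining relations of the Hecke algebra: the quadratic relations
`h_i ^ 2 = (v⁻¹ - v) h_i + 1` and the braid relation `h_s h_r h_s = h_r h_s h_r`. -/
inductive HeckeRel : FreeAlgebra ℤ[T;T⁻¹] (Fin 2) → FreeAlgebra ℤ[T;T⁻¹] (Fin 2) → Prop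
  | quad (i : Fin 2) :
      HeckeRel (FreeAlgebra.ι _ i * FreeAlgebra.ι _ i)
        ((LaurentPolynomial.T (-1) - LaurentPolynomial.T 1 : ℤ[T;T⁻¹]) • FreeAlgebra.ι _ i + 1)
  | braid :
      HeckeRel (FreeAlgebra.ι _ 0 * FreeAlgebra.ι _ 1 * FreeAlgebra.ι _ 0)
        (FreeAlgebra.ι _ 1 * FreeAlgebra.ι _ 0 * FreeAlgebra.ι _ 1)

/-- The Hecke algebra of `S_3` over `ℤ[v, v⁻¹]`, where `v = T 1`. -/
def Hecke : Type := RingQuot HeckeRel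

noncomputable instance : Ring Hecke := inferInstanceAs (Ring (RingQuot HeckeRel))

noncomputable instance : Algebra ℤ[T;T⁻¹] Hecke :=
  inferInstanceAs (Algebra ℤ[T;T⁻¹] (RingQuot HeckeRel))

/-- The quotient map from the free algebra. -/
noncomputable def heckeMk : FreeAlgebra ℤ[T;T⁻¹] (Fin 2) →ₐ[ℤ[T;T⁻¹]] Hecke :=
  RingQuot.mkAlgHom ℤ[T;T⁻¹] HeckeRel

/-- The element `v` of the Hecke algebra. -/
noncomputable def vH : Hecke := algebraMap ℤ[T;T⁻¹] Hecke (LaurentPolynomial.T 1)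

/-- The generators `h_s = hGen 0` and `h_r = hGen 1`. -/
noncomputable def hGen (i : Fin 2) : Hecke :=
  heckeMk (FreeAlgebra.ι _ i)

/-- The standard basis element `h_w`. -/
noncomputable def hStd (w : S3) : Hecke := ((redWord w).map hGen).prod

lemma hGen_sq (i : Fin 2) : hGen i * hGen i =
    (LaurentPolynomial.T (-1) - LaurentPolynomial.T 1 : ℤ[T;T⁻¹]) • hGen i + 1 := by
  have h : heckeMk _ = heckeMk _ := RingQuot.mkAlgHom_rel ℤ[T;T⁻¹] (HeckeRel.quad i)
  rwa [map_mul, map_add, map_smul, map_one] at h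

lemma hGen_braid : hGen 0 * hGen 1 * hGen 0 = hGen 1 * hGen 0 * hGen 1 := by
  have h : heckeMk _ = heckeMk _ := RingQuot.mkAlgHom_rel ℤ[T;T⁻¹] HeckeRel.braid
  rwa [map_mul, map_mul, map_mul, map_mul] at h

/-- The Hecke algebra with `v` acting as `v⁻¹`; only used to construct the duality. -/
def HeckeTw : Type := Hecke

noncomputable instance : Ring HeckeTw := inferInstanceAs (Ring Hecke)

noncomputable instance : Algebra ℤ[T;T⁻¹] HeckeTw :=
  RingHom.toAlgebra' ((algebraMap ℤ[T;T⁻¹] Hecke).comp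
    (LaurentPolynomial.invert (R := ℤ)).toRingEquiv.toRingHom)
    (fun c x => Algebra.commutes (A := Hecke) (LaurentPolynomial.invert c) x)

/-- `h_i⁻¹ = h_i + v - v⁻¹`. -/
noncomputable def hInv (i : Fin 2) : Hecke :=
  hGen i + algebraMap ℤ[T;T⁻¹] Hecke (LaurentPolynomial.T 1 - LaurentPolynomial.T (-1))

lemma aux_sq {A : Type*} [Ring A] (a x : A) (c : a * x = x * a)
    (h : x * x = -(a * x) + 1) : (x + a) * (x + a) = a * (x + a) + 1 := by
  rw [mul_add, add_mul, add_mul, mul_add, h, ← c]; abel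

lemma aux_braid {A : Type*} [Ring A] (a x y : A) (c0 : a * x = x * a) (c1 : a * y = y * a)
    (h0 : x * x = -(a * x) + 1) (h1 : y * y = -(a * y) + 1) (hb : x * y * x = y * x * y) :
    (x + a) * (y + a) * (x + a) = (y + a) * (x + a) * (y + a) := by
  have f1 : x * a * x = -(a * a * x) + a := by
    rw [← c0, mul_assoc, h0, mul_add, mul_neg, mul_one, mul_assoc]
  have f2 : y * a * y = -(a * a * y) + a := by
    rw [← c1, mul_assoc, h1, mul_add, mul_neg, mul_one, mul_assoc]
  have f3 : x * y * a = a * x * y := by rw [mul_assoc, ← c1, ← mul_assoc, ← c0]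
  have f4 : y * x * a = a * y * x := by rw [mul_assoc, ← c0, ← mul_assoc, ← c1]
  have f5 : x * a * a = a * a * x := by rw [← c0, mul_assoc, ← c0, mul_assoc]
  have f6 : y * a * a = a * a * y := by rw [← c1, mul_assoc, ← c1, mul_assoc]
  have f7 : a * y * a = a * a * y := by rw [mul_assoc, ← c1, mul_assoc]
  have f8 : a * x * a = a * a * x := by rw [mul_assoc, ← c0, mul_assoc]
  simp only [mul_add, add_mul]
  rw [hb, f1, f2, f3, f4, f5, f6, f7, f8]
  abel

lemma aux_sq' (i : Fin 2) : hGen i * hGen i = -(algebraMap ℤ[T;T⁻¹] Hecke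
    (LaurentPolynomial.T 1 - LaurentPolynomial.T (-1)) * hGen i) + 1 := by
  rw [hGen_sq, Algebra.smul_def, ← neg_mul, map_sub, map_sub, neg_sub]

lemma hInv_sq (i : Fin 2) : hInv i * hInv i =
    algebraMap ℤ[T;T⁻¹] Hecke (LaurentPolynomial.T 1 - LaurentPolynomial.T (-1)) * hInv i + 1 :=
  aux_sq _ _ (Algebra.commutes _ _) (aux_sq' i)

lemma hInv_braid : hInv 0 * hInv 1 * hInv 0 = hInv 1 * hInv 0 * hInv 1 :=
  aux_braid _ _ _ (Algebra.commutes _ _) (Algebra.commutes _ _) (aux_sq' 0) (aux_sq' 1) hGen_braid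

lemma hInv_mul (i : Fin 2) : hInv i * hGen i = 1 := by
  rw [hInv, add_mul, aux_sq']; abel

lemma mul_hInv (i : Fin 2) : hGen i * hInv i = 1 := by
  rw [hInv, mul_add, aux_sq', Algebra.commutes]; abel

/-- `h_i⁻¹` as an element of the twisted copy. -/
noncomputable def hInvTw (i : Fin 2) : HeckeTw := hInv i

/-- The duality of the Hecke algebra, as an algebra homomorphism to the twisted copy. -/
noncomputable def dualityTw : Hecke →ₐ[ℤ[T;T⁻¹]] HeckeTw :=
  RingQuot.liftAlgHom ℤ[T;T⁻¹] ⟨FreeAlgebra.lift ℤ[T;T⁻¹] hInvTw, by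
    rintro _ _ (i | _)
    · simp only [map_mul, map_add, map_smul, map_one, FreeAlgebra.lift_ι_apply]
      rw [Algebra.smul_def]
      have e : algebraMap ℤ[T;T⁻¹] HeckeTw (LaurentPolynomial.T (-1) - LaurentPolynomial.T 1)
        = algebraMap ℤ[T;T⁻¹] Hecke (LaurentPolynomial.T 1 - LaurentPolynomial.T (-1)) := by
        change algebraMap ℤ[T;T⁻¹] Hecke (LaurentPolynomial.invert _) = _
        rw [map_sub, LaurentPolynomial.invert_T, LaurentPolynomial.invert_T, neg_neg]
      rw [e]
      exact hInv_sq i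
    · simp only [map_mul, FreeAlgebra.lift_ι_apply]
      exact hInv_braid⟩

/-- The duality `d` of the Hecke algebra: the ring endomorphism with `d(v) = v⁻¹` and
`d(h_i) = h_i⁻¹`. -/
noncomputable def duality : Hecke →+* Hecke := (dualityTw : Hecke →+* HeckeTw)

lemma duality_algebraMap (p : ℤ[T;T⁻¹]) : duality (algebraMap ℤ[T;T⁻¹] Hecke p) =
    algebraMap ℤ[T;T⁻¹] Hecke (LaurentPolynomial.invert p) :=
  dualityTw.commutes p

lemma duality_hGen (i : Fin 2) : duality (hGen i) = hInv i := by
  change dualityTw (hGen i) = hInvTw i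
  exact (RingQuot.liftAlgHom_mkAlgHom_apply ℤ[T;T⁻¹] _ _ _).trans (FreeAlgebra.lift_ι_apply _ _)

/-- `b` is the Kazhdan–Lusztig element of `w`: it is self-dual and lies in
`h_w + ∑_y v ℤ[v] h_y`. -/
def IsKazhdanLusztig (w : S3) (b : Hecke) : Prop :=
  duality b = b ∧ ∃ c : S3 → Polynomial ℤ,
    b = hStd w + ∑ y : S3, Polynomial.toLaurent (Polynomial.X * c y) • hStd y

/-- `b_i = h_i + v` for a simple reflection. -/
noncomputable def bGen (i : Fin 2) : Hecke := hGen i + vH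

/-- The elements `b_1 = 1`, `b_s`, `b_r`, `b_{sr} = b_s b_r`, `b_{rs} = b_r b_s`,
`b_{srs} = b_s b_r b_s - b_s` of the Hecke algebra. -/
noncomputable def bKL (w : S3) : Hecke :=
  if w = longest then bGen 0 * bGen 1 * bGen 0 - bGen 0 else ((redWord w).map bGen).prod

/-- The Hecke algebra as an algebra over the semiring `ℕ[v, v⁻¹] ⊂ ℤ[v, v⁻¹]`. -/
noncomputable instance : Algebra (LaurentPolynomial ℕ) Hecke :=
  RingHom.toAlgebra' ((algebraMap ℤ[T;T⁻¹] Hecke).comp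
    (AddMonoidAlgebra.mapRingHom ℤ (Nat.castRingHom ℤ)))
    (fun _ x => Algebra.commutes (R := ℤ[T;T⁻¹]) _ x)

/-! ## Graded bimodules -/

section Bimodules

variable (k : Type u) [Field k]

/-- The polynomial ring `R = k[x, y, z]`. -/
abbrev Poly : Type u := MvPolynomial (Fin 3) k

/-- The degree `d` part of `R`, where the variables have degree `2`. -/
noncomputable def polyGr (d : ℤ) : Submodule k (Poly k) :=
  MvPolynomial.weightedHomogeneousSubmodule k (fun _ => (2 : ℤ)) d

/-- A `ℤ`-graded `R`-bimodule (on which the left and right actions of `k` agree), that is, a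
graded module over `R ⊗_k R`. As `R` is commutative, both the left and the right action are algebra
homomorphisms `R → End_k(M)`; `left p m` is `p m` and `right p m` is `m p`. -/
structure GrBimod where
  /-- the underlying vector space -/
  carrier : Type u
  [addCommGroup : AddCommGroup carrier]
  [module : Module k carrier]
  /-- the left action of `R` -/
  left : Poly k →ₐ[k] Module.End k carrier
  /-- the right action of `R` -/
  right : Poly k →ₐ[k] Module.End k carrier
  comm : ∀ p q m, left p (right q m) = right q (left p m)
  /-- the graded pieces -/
  gr : ℤ → Submodule k carrier
  internal : DirectSum.IsInternal gr
  left_mem : ∀ {i j : ℤ} {p : Poly k} {m : carrier}, p ∈ polyGr k i → m ∈ gr j →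
    left p m ∈ gr (i + j)
  right_mem : ∀ {i j : ℤ} {p : Poly k} {m : carrier}, p ∈ polyGr k i → m ∈ gr j →
    right p m ∈ gr (i + j)

variable {k}

namespace GrBimod

instance : CoeSort (GrBimod k) (Type u) := ⟨carrier⟩

instance (M : GrBimod k) : AddCommGroup M := M.addCommGroup

instance (M : GrBimod k) : Module k M := M.module

/-- An isomorphism of graded bimodules: a bijective bimodule map, homogeneous of degree `0`. -/
structure Iso (M N : GrBimod k) where
  /-- the underlying linear isomorphism -/
  toEquiv : M ≃ₗ[k] N
  map_left : ∀ (p : Poly k) (m : M), toEquiv (M.left p m) = N.left p (toEquiv m)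
  map_right : ∀ (p : Poly k) (m : M), toEquiv (M.right p m) = N.right p (toEquiv m)
  map_gr : ∀ (i : ℤ) (m : M), toEquiv m ∈ N.gr i ↔ m ∈ M.gr i

/-- `M ≅ N` as graded bimodules. -/
def IsIso (M N : GrBimod k) : Prop := Nonempty (Iso M N)

lemma IsIso.refl (M : GrBimod k) : IsIso M M :=
  ⟨⟨LinearEquiv.refl k M, fun _ _ => rfl, fun _ _ => rfl, fun _ _ => Iff.rfl⟩⟩

lemma IsIso.symm {M N : GrBimod k} : IsIso M N → IsIso N M := by
  rintro ⟨e⟩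
  refine ⟨⟨e.toEquiv.symm, fun p m => ?_, fun p m => ?_, fun i m => ?_⟩⟩
  · rw [LinearEquiv.symm_apply_eq, e.map_left, LinearEquiv.apply_symm_apply]
  · rw [LinearEquiv.symm_apply_eq, e.map_right, LinearEquiv.apply_symm_apply]
  · rw [← e.map_gr, LinearEquiv.apply_symm_apply]

lemma IsIso.trans {M N P : GrBimod k} : IsIso M N → IsIso N P → IsIso M P := by
  rintro ⟨e⟩ ⟨f⟩
  refine ⟨⟨e.toEquiv.trans f.toEquiv, fun p m => ?_, fun p m => ?_, fun i m => ?_⟩⟩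
  · rw [LinearEquiv.trans_apply, e.map_left, f.map_left]; rfl
  · rw [LinearEquiv.trans_apply, e.map_right, f.map_right]; rfl
  · rw [LinearEquiv.trans_apply, f.map_gr, e.map_gr]

section Projections

lemma iSup_gr (M : GrBimod k) : ⨆ i, M.gr i = ⊤ := M.internal.submodule_iSup_eq_top

/-- The projection of `M` onto its degree `i` part. -/
noncomputable def proj (M : GrBimod k) (i : ℤ) : M →ₗ[k] M :=
  (M.gr i).subtype ∘ₗ DirectSum.component k ℤ (fun i => M.gr i) i ∘ₗ
    (LinearEquiv.ofBijective (DirectSum.coeLinearMap M.gr) M.internal).symm.toLinearMap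

lemma proj_apply (M : GrBimod k) {i : ℤ} {m : M} (hm : m ∈ M.gr i) (j : ℤ) :
    M.proj j m = if i = j then m else 0 := by
  have e : (LinearEquiv.ofBijective (DirectSum.coeLinearMap M.gr) M.internal).symm m
      = DirectSum.lof k ℤ (fun i => M.gr i) i ⟨m, hm⟩ := by
    exact (LinearEquiv.symm_apply_eq _).2 (DirectSum.coeLinearMap_lof M.gr i ⟨m, hm⟩).symm
  simp only [proj, LinearMap.comp_apply, LinearEquiv.coe_coe, e]
  split_ifs with h
  · subst h
    simp [DirectSum.component.lof_self]
  · rw [DirectSum.component.of, dif_neg h, map_zero]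

lemma proj_same (M : GrBimod k) {i : ℤ} {m : M} (hm : m ∈ M.gr i) : M.proj i m = m := by
  rw [M.proj_apply hm, if_pos rfl]

lemma proj_ne (M : GrBimod k) {i j : ℤ} {m : M} (hm : m ∈ M.gr i) (h : i ≠ j) :
    M.proj j m = 0 := by
  rw [M.proj_apply hm, if_neg h]

lemma hom_ext {M : GrBimod k} {Q : Type*} [AddCommGroup Q] [Module k Q] {f g : M →ₗ[k] Q}
    (h : ∀ i, ∀ m ∈ M.gr i, f m = g m) : f = g := by
  ext m
  have hm : m ∈ ⨆ i, M.gr i := by rw [M.iSup_gr]; trivial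
  exact Submodule.iSup_induction M.gr (motive := fun m => f m = g m) hm (fun i m hm => h i m hm)
    (by simp) (fun x y hx hy => by simp [hx, hy])

lemma proj_left (M : GrBimod k) {i : ℤ} {p : Poly k} (hp : p ∈ polyGr k i) (j : ℤ) (m : M) :
    M.proj j (M.left p m) = M.left p (M.proj (j - i) m) := by
  suffices h : M.proj j ∘ₗ M.left p = M.left p ∘ₗ M.proj (j - i) from LinearMap.congr_fun h m
  refine hom_ext fun a m hm => ?_
  simp only [LinearMap.comp_apply]
  rw [M.proj_apply (M.left_mem hp hm), M.proj_apply hm]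
  by_cases h : i + a = j
  · rw [if_pos h, if_pos (by omega)]
  · rw [if_neg h, if_neg (by omega), map_zero]

lemma isInternal_of_proj {Q : Type*} [AddCommGroup Q] [Module k Q] (gr : ℤ → Submodule k Q)
    (π : ℤ → Q →ₗ[k] Q) (hπ : ∀ i, ∀ m ∈ gr i, ∀ j, π j m = if i = j then m else 0)
    (htop : ⨆ i, gr i = ⊤) : DirectSum.IsInternal gr := by
  refine DirectSum.isInternal_submodule_of_iSupIndep_of_iSup_eq_top ?_ htop
  intro i
  rw [Submodule.disjoint_def]
  intro x hx hx'
  have h1 : π i x = x := by rw [hπ i x hx, if_pos rfl]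
  have h2 : (⨆ j, ⨆ (_ : j ≠ i), gr j) ≤ LinearMap.ker (π i) := by
    refine iSup_le fun j => iSup_le fun hj m hm => ?_
    rw [LinearMap.mem_ker, hπ j m hm, if_neg hj]
  rw [← h1]
  exact h2 hx'

end Projections

/-- The shifted bimodule `M(n)`, with `M(n)_i = M_{n+i}`. -/
def shift (M : GrBimod k) (n : ℤ) : GrBimod k where
  carrier := M
  left := M.left
  right := M.right
  comm := M.comm
  gr i := M.gr (n + i)
  internal := isInternal_of_proj _ (fun i => M.proj (n + i))
    (fun i m hm j => by
      rw [M.proj_apply hm]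
      by_cases h : i = j
      · rw [if_pos (by omega), if_pos h]
      · rw [if_neg (by omega), if_neg h])
    (by
      rw [← M.iSup_gr]
      exact (Equiv.addLeft n).iSup_congr (fun _ => rfl))
  left_mem hp hm := by
    have := M.left_mem hp hm
    rwa [add_left_comm] at this
  right_mem hp hm := by
    have := M.right_mem hp hm
    rwa [add_left_comm] at this

/-- The zero bimodule. -/
noncomputable def zero : GrBimod k where
  carrier := PUnit
  left := AlgHom.ofLinearMap 0 (Subsingleton.elim _ _) (fun _ _ => Subsingleton.elim _ _)
  right := AlgHom.ofLinearMap 0 (Subsingleton.elim _ _) (fun _ _ => Subsingleton.elim _ _)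
  comm _ _ _ := rfl
  gr _ := ⊤
  internal := isInternal_of_proj _ (fun _ => 0) (fun _ _ _ _ => Subsingleton.elim _ _) (by simp)
  left_mem _ _ := trivial
  right_mem _ _ := trivial

/-- The direct sum `M ⊕ N` of two graded bimodules. -/
noncomputable def sum (M N : GrBimod k) : GrBimod k where
  carrier := M × N
  left := AlgHom.ofLinearMap
    { toFun := fun p => (M.left p).prodMap (N.left p)
      map_add' := fun p q => by ext <;> simp
      map_smul' := fun c p => by ext <;> simp }
    (by ext <;> simp) (fun p q => by ext <;> simp)
  right := AlgHom.ofLinearMap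
    { toFun := fun p => (M.right p).prodMap (N.right p)
      map_add' := fun p q => by ext <;> simp
      map_smul' := fun c p => by ext <;> simp }
    (by ext <;> simp) (fun p q => by ext <;> simp)
  comm p q m := Prod.ext (M.comm p q m.1) (N.comm p q m.2)
  gr i := (M.gr i).prod (N.gr i)
  internal := isInternal_of_proj _ (fun i => (M.proj i).prodMap (N.proj i))
    (fun i m hm j => by
      have h1 := M.proj_apply hm.1 j
      have h2 := N.proj_apply hm.2 j
      rw [LinearMap.prodMap_apply, h1, h2]
      split_ifs <;> rfl)
    (by
      have h1 : ∀ i, (M.gr i).map (LinearMap.inl k M N) ≤ ⨆ i, (M.gr i).prod (N.gr i) := fun i =>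
        le_trans (by rintro _ ⟨m, hm, rfl⟩; exact ⟨hm, (N.gr i).zero_mem⟩)
          (le_iSup (fun i => (M.gr i).prod (N.gr i)) i)
      have h2 : ∀ i, (N.gr i).map (LinearMap.inr k M N) ≤ ⨆ i, (M.gr i).prod (N.gr i) := fun i =>
        le_trans (by rintro _ ⟨m, hm, rfl⟩; exact ⟨(M.gr i).zero_mem, hm⟩)
          (le_iSup (fun i => (M.gr i).prod (N.gr i)) i)
      rw [eq_top_iff, ← LinearMap.sup_range_inl_inr, LinearMap.range_eq_map, LinearMap.range_eq_map,
        ← M.iSup_gr, ← N.iSup_gr, Submodule.map_iSup, Submodule.map_iSup]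
      exact sup_le (iSup_le h1) (iSup_le h2))
  left_mem hp hm := ⟨M.left_mem hp hm.1, N.left_mem hp hm.2⟩
  right_mem hp hm := ⟨M.right_mem hp hm.1, N.right_mem hp hm.2⟩

section Tensor

/-- The subalgebra `A ⊆ R` is graded. -/
def IsGradedSubalg (A : Subalgebra k (Poly k)) : Prop :=
  ∀ a ∈ A, ∀ d : ℤ, MvPolynomial.weightedHomogeneousComponent (fun _ => (2 : ℤ)) d a ∈ A

lemma mem_span_homogeneous {A : Subalgebra k (Poly k)} (hA : IsGradedSubalg A) {a : Poly k}
    (ha : a ∈ A) : a ∈ Submodule.span k {b : Poly k | b ∈ A ∧ ∃ d, b ∈ polyGr k d} := by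
  rw [← MvPolynomial.finsum_weightedHomogeneousComponent (fun _ => (2 : ℤ)) a]
  refine finsum_induction (· ∈ Submodule.span k {b : Poly k | b ∈ A ∧ ∃ d, b ∈ polyGr k d})
    (Submodule.zero_mem _) (fun _ _ => Submodule.add_mem _) (fun d => ?_)
  exact Submodule.subset_span
    ⟨hA a ha d, d, MvPolynomial.weightedHomogeneousComponent_mem _ _ _⟩

/-- The relations `m a ⊗ n = m ⊗ a n` for `a ∈ A`, inside `M ⊗_k N`. -/
noncomputable def tensorRel (A : Subalgebra k (Poly k)) (M N : GrBimod k) :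
    Submodule k (M ⊗[k] N) :=
  Submodule.span k {t | ∃ a ∈ A, ∃ (m : M) (n : N),
    t = M.right a m ⊗ₜ[k] n - m ⊗ₜ[k] N.left a n}

/-- The vector space `M ⊗_A N`. -/
abbrev TensorCarrier (A : Subalgebra k (Poly k)) (M N : GrBimod k) : Type u :=
  (M ⊗[k] N) ⧸ tensorRel A M N

/-- The element `m ⊗ n` of `M ⊗_A N`. -/
noncomputable def tmk (A : Subalgebra k (Poly k)) {M N : GrBimod k} (m : M) (n : N) :
    TensorCarrier A M N :=
  (tensorRel A M N).mkQ (m ⊗ₜ[k] n)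

/-- The degree `d` part of `M ⊗_A N`: it is spanned by the `m ⊗ n` with `m` and `n` homogeneous and
`deg m + deg n = d`. -/
noncomputable def tensorGr (A : Subalgebra k (Poly k)) (M N : GrBimod k) (d : ℤ) :
    Submodule k (TensorCarrier A M N) :=
  Submodule.span k {t | ∃ i j : ℤ, i + j = d ∧ ∃ m ∈ M.gr i, ∃ n ∈ N.gr j, t = tmk A m n}

variable {A : Subalgebra k (Poly k)} {M N : GrBimod k}

lemma tensor_ext {Q : Type*} [AddCommGroup Q] [Module k Q] {f g : TensorCarrier A M N →ₗ[k] Q}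
    (h : ∀ m n, f (tmk A m n) = g (tmk A m n)) : f = g := by
  refine Submodule.linearMap_qext _ (TensorProduct.ext' fun m n => ?_)
  exact h m n

lemma tmk_balanced {a : Poly k} (ha : a ∈ A) (m : M) (n : N) :
    tmk A (M.right a m) n = tmk A m (N.left a n) := by
  rw [← sub_eq_zero, tmk, tmk, ← map_sub, ← LinearMap.mem_ker, Submodule.ker_mkQ]
  exact Submodule.subset_span ⟨a, ha, m, n, rfl⟩

/-- The linear map out of `M ⊗_A N` given by a balanced bilinear map. -/
noncomputable def tensorLift {Q : Type*} [AddCommGroup Q] [Module k Q] (f : M →ₗ[k] N →ₗ[k] Q)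
    (hf : ∀ a ∈ A, ∀ m n, f (M.right a m) n = f m (N.left a n)) : TensorCarrier A M N →ₗ[k] Q :=
  (tensorRel A M N).liftQ (TensorProduct.lift f) (by
    rw [tensorRel, Submodule.span_le]
    rintro _ ⟨a, ha, m, n, rfl⟩
    rw [SetLike.mem_coe, LinearMap.mem_ker, map_sub, TensorProduct.lift.tmul,
      TensorProduct.lift.tmul, hf a ha, sub_self])

@[simp]
lemma tensorLift_tmk {Q : Type*} [AddCommGroup Q] [Module k Q] (f : M →ₗ[k] N →ₗ[k] Q)
    (hf : ∀ a ∈ A, ∀ m n, f (M.right a m) n = f m (N.left a n)) (m : M) (n : N) :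
    tensorLift f hf (tmk A m n) = f m n := by
  exact (Submodule.liftQ_apply _ _ _).trans (TensorProduct.lift.tmul _ _)

/-- The bilinear map `(m, n) ↦ m ⊗ n`. -/
noncomputable def tmkBilin (A : Subalgebra k (Poly k)) (M N : GrBimod k) :
    M →ₗ[k] N →ₗ[k] TensorCarrier A M N :=
  (TensorProduct.mk k M N).compr₂ (tensorRel A M N).mkQ

/-- The map `f ⊗ g` on `M ⊗_A N`. -/
noncomputable def tensorMap (f : Module.End k M) (g : Module.End k N)
    (h : ∀ a ∈ A, ∀ m n, tmk A (f (M.right a m)) (g n) = tmk A (f m) (g (N.left a n))) :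
    Module.End k (TensorCarrier A M N) :=
  tensorLift ((tmkBilin A M N).compl₁₂ f g) h

lemma tensorMap_tmk (f : Module.End k M) (g : Module.End k N)
    (h : ∀ a ∈ A, ∀ m n, tmk A (f (M.right a m)) (g n) = tmk A (f m) (g (N.left a n)))
    (m : M) (n : N) : tensorMap f g h (tmk A m n) = tmk A (f m) (g n) :=
  tensorLift_tmk _ _ m n

lemma tmk_add_left (m m' : M) (n : N) : tmk A (m + m') n = tmk A m n + tmk A m' n :=
  (tmkBilin A M N).map_add₂ m m' n

lemma tmk_add_right (m : M) (n n' : N) : tmk A m (n + n') = tmk A m n + tmk A m n' :=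
  (tmkBilin A M N m).map_add n n'

lemma tmk_smul_left (c : k) (m : M) (n : N) : tmk A (c • m) n = c • tmk A m n :=
  (tmkBilin A M N).map_smul₂ c m n

lemma tmk_smul_right (c : k) (m : M) (n : N) : tmk A m (c • n) = c • tmk A m n :=
  (tmkBilin A M N m).map_smul c n

/-- The left action `p (m ⊗ n) = p m ⊗ n`. -/
noncomputable def tensorLeft (A : Subalgebra k (Poly k)) (M N : GrBimod k) :
    Poly k →ₐ[k] Module.End k (TensorCarrier A M N) :=
  AlgHom.ofLinearMap
    { toFun := fun p => tensorMap (M.left p) LinearMap.id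
        (fun a ha m n => by rw [M.comm]; exact tmk_balanced ha _ _)
      map_add' := fun p q => tensor_ext fun m n => by
        simp only [LinearMap.add_apply, tensorMap_tmk, map_add, tmk_add_left]
      map_smul' := fun c p => tensor_ext fun m n => by
        simp only [LinearMap.smul_apply, tensorMap_tmk, map_smul, tmk_smul_left, RingHom.id_apply] }
    (tensor_ext fun m n => by
      simp only [LinearMap.coe_mk, AddHom.coe_mk, tensorMap_tmk, map_one, Module.End.one_apply,
        LinearMap.id_apply])
    (fun p q => tensor_ext fun m n => by
      simp only [LinearMap.coe_mk, AddHom.coe_mk, tensorMap_tmk, map_mul, Module.End.mul_apply,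
        LinearMap.id_apply])

/-- The right action `(m ⊗ n) p = m ⊗ n p`. -/
noncomputable def tensorRight (A : Subalgebra k (Poly k)) (M N : GrBimod k) :
    Poly k →ₐ[k] Module.End k (TensorCarrier A M N) :=
  AlgHom.ofLinearMap
    { toFun := fun p => tensorMap LinearMap.id (N.right p)
        (fun a ha m n => by rw [← N.comm]; exact tmk_balanced ha _ _)
      map_add' := fun p q => tensor_ext fun m n => by
        simp only [LinearMap.add_apply, tensorMap_tmk, map_add, tmk_add_right]
      map_smul' := fun c p => tensor_ext fun m n => by
        simp only [LinearMap.smul_apply, tensorMap_tmk, map_smul, tmk_smul_right,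
          RingHom.id_apply] }
    (tensor_ext fun m n => by
      simp only [LinearMap.coe_mk, AddHom.coe_mk, tensorMap_tmk, map_one, Module.End.one_apply,
        LinearMap.id_apply])
    (fun p q => tensor_ext fun m n => by
      simp only [LinearMap.coe_mk, AddHom.coe_mk, tensorMap_tmk, map_mul, Module.End.mul_apply,
        LinearMap.id_apply])

lemma tensorLeft_tmk (p : Poly k) (m : M) (n : N) :
    tensorLeft A M N p (tmk A m n) = tmk A (M.left p m) n :=
  tensorMap_tmk (M.left p) LinearMap.id
    (fun a ha m n => by rw [M.comm]; exact tmk_balanced ha _ _) m n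

lemma tensorRight_tmk (p : Poly k) (m : M) (n : N) :
    tensorRight A M N p (tmk A m n) = tmk A m (N.right p n) :=
  tensorMap_tmk LinearMap.id (N.right p)
    (fun a ha m n => by rw [← N.comm]; exact tmk_balanced ha _ _) m n

/-- The bilinear map sending a homogeneous `m` of degree `i` and `n` to `m ⊗ n_{d-i}`. -/
noncomputable def tensorProjBilin (A : Subalgebra k (Poly k)) (M N : GrBimod k) (d : ℤ) :
    M →ₗ[k] N →ₗ[k] TensorCarrier A M N :=
  DirectSum.toModule k ℤ (N →ₗ[k] TensorCarrier A M N)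
    (fun i => (tmkBilin A M N).compl₁₂ (M.gr i).subtype (N.proj (d - i))) ∘ₗ
    (LinearEquiv.ofBijective (DirectSum.coeLinearMap M.gr) M.internal).symm.toLinearMap

lemma tensorProjBilin_apply (d i : ℤ) {m : M} (hm : m ∈ M.gr i) (n : N) :
    tensorProjBilin A M N d m n = tmk A m (N.proj (d - i) n) := by
  have e : (LinearEquiv.ofBijective (DirectSum.coeLinearMap M.gr) M.internal).symm m
      = DirectSum.lof k ℤ (fun i => M.gr i) i ⟨m, hm⟩ :=
    (LinearEquiv.symm_apply_eq _).2 (DirectSum.coeLinearMap_lof M.gr i ⟨m, hm⟩).symm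
  simp only [tensorProjBilin, LinearMap.comp_apply, LinearEquiv.coe_coe, e, DirectSum.toModule_lof]
  rfl

lemma tensorProjBilin_balanced (hA : IsGradedSubalg A) (d : ℤ) (a : Poly k) (ha : a ∈ A)
    (m : M) (n : N) :
    tensorProjBilin A M N d (M.right a m) n = tensorProjBilin A M N d m (N.left a n) := by
  suffices h : (tensorProjBilin A M N d).comp (M.right a)
      = (tensorProjBilin A M N d).compl₂ (N.left a) from
    LinearMap.congr_fun (LinearMap.congr_fun h m) n
  refine hom_ext fun i m hm => LinearMap.ext fun n => ?_
  rw [LinearMap.comp_apply, LinearMap.compl₂_apply]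
  have := mem_span_homogeneous hA ha
  clear ha
  induction this using Submodule.span_induction with
  | mem b hb =>
    obtain ⟨hb, e, he⟩ := hb
    rw [tensorProjBilin_apply d _ (M.right_mem he hm), tensorProjBilin_apply d _ hm,
      tmk_balanced hb, N.proj_left he, sub_sub, add_comm e i]
  | zero => simp
  | add x y _ _ hx hy => simp only [map_add, LinearMap.add_apply, hx, hy]
  | smul c x _ hx => simp only [map_smul, LinearMap.smul_apply, hx]

/-- The projection of `M ⊗_A N` onto its degree `d` part. -/
noncomputable def tensorProj (hA : IsGradedSubalg A) (M N : GrBimod k) (d : ℤ) :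
    TensorCarrier A M N →ₗ[k] TensorCarrier A M N :=
  tensorLift (tensorProjBilin A M N d) (tensorProjBilin_balanced hA d)

lemma tensorProj_apply (hA : IsGradedSubalg A) (d : ℤ) (t : TensorCarrier A M N)
    (ht : t ∈ tensorGr A M N d) (e : ℤ) : tensorProj hA M N e t = if d = e then t else 0 := by
  induction ht using Submodule.span_induction with
  | mem t ht =>
    obtain ⟨i, j, hij, m, hm, n, hn, rfl⟩ := ht
    rw [tensorProj, tensorLift_tmk, tensorProjBilin_apply e i hm, N.proj_apply hn]
    by_cases h : d = e
    · rw [if_pos (by omega), if_pos h]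
    · rw [if_neg (by omega), if_neg h]
      exact (tmkBilin A M N m).map_zero
  | zero => simp
  | add x y _ _ hx hy => rw [map_add, hx, hy]; split_ifs <;> simp
  | smul c x _ hx => rw [map_smul, hx]; split_ifs <;> simp

lemma iSup_tensorGr (A : Subalgebra k (Poly k)) (M N : GrBimod k) :
    ⨆ d, tensorGr A M N d = ⊤ := by
  rw [← Submodule.ker_mkQ (⨆ d, tensorGr A M N d), LinearMap.ker_eq_top]
  refine tensor_ext fun m n => ?_
  suffices h : (tmkBilin A M N).compr₂ (⨆ d, tensorGr A M N d).mkQ = 0 from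
    LinearMap.congr_fun (LinearMap.congr_fun h m) n
  refine hom_ext fun i m hm => hom_ext fun j n hn => ?_
  change (⨆ d, tensorGr A M N d).mkQ (tmk A m n) = 0
  rw [← LinearMap.mem_ker, Submodule.ker_mkQ]
  exact Submodule.mem_iSup_of_mem (i + j)
    (Submodule.subset_span ⟨i, j, rfl, m, hm, n, hn, rfl⟩)

/-- The graded bimodule `M ⊗_A N`, for a graded subalgebra `A ⊆ R`: the quotient of `M ⊗_k N` by the
relations `m a ⊗ n = m ⊗ a n` for `a ∈ A`, with `R` acting on the left through `M` and on the right
through `N`. -/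
noncomputable def tensorOver (A : Subalgebra k (Poly k)) (hA : IsGradedSubalg A)
    (M N : GrBimod k) : GrBimod k where
  carrier := TensorCarrier A M N
  left := tensorLeft A M N
  right := tensorRight A M N
  comm p q t := by
    suffices h : (tensorLeft A M N p).comp (tensorRight A M N q)
        = (tensorRight A M N q).comp (tensorLeft A M N p) from LinearMap.congr_fun h t
    refine tensor_ext fun m n => ?_
    simp only [LinearMap.comp_apply, tensorLeft_tmk, tensorRight_tmk]
  gr := tensorGr A M N
  internal := isInternal_of_proj _ (tensorProj hA M N) (tensorProj_apply hA)
    (iSup_tensorGr A M N)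
  left_mem {i d p t} hp ht := by
    induction ht using Submodule.span_induction with
    | mem t ht =>
      obtain ⟨a, b, hab, m, hm, n, hn, rfl⟩ := ht
      rw [tensorLeft_tmk]
      exact Submodule.subset_span ⟨i + a, b, by omega, _, M.left_mem hp hm, n, hn, rfl⟩
    | zero => simp
    | add x y _ _ hx hy => rw [map_add]; exact Submodule.add_mem _ hx hy
    | smul c x _ hx => rw [map_smul]; exact Submodule.smul_mem _ c hx
  right_mem {i d p t} hp ht := by
    induction ht using Submodule.span_induction with
    | mem t ht =>
      obtain ⟨a, b, hab, m, hm, n, hn, rfl⟩ := ht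
      rw [tensorRight_tmk]
      exact Submodule.subset_span ⟨a, i + b, by omega, m, hm, _, N.right_mem hp hn, rfl⟩
    | zero => simp
    | add x y _ _ hx hy => rw [map_add]; exact Submodule.add_mem _ hx hy
    | smul c x _ hx => rw [map_smul]; exact Submodule.smul_mem _ c hx

lemma isGradedSubalg_top : IsGradedSubalg (⊤ : Subalgebra k (Poly k)) := fun _ _ _ => trivial

/-- The product `M N = M ⊗_R N` of two graded bimodules. -/
noncomputable def tensor (M N : GrBimod k) : GrBimod k := tensorOver ⊤ isGradedSubalg_top M N

end Tensor

variable (k) in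
/-- The bimodule `R`. -/
noncomputable def regular : GrBimod k where
  carrier := Poly k
  left := Algebra.lmul k (Poly k)
  right := Algebra.lmul k (Poly k)
  comm p q m := mul_left_comm p q m
  gr := polyGr k
  internal := letI := MvPolynomial.weightedDecomposition k (fun _ : Fin 3 => (2 : ℤ))
    DirectSum.Decomposition.isInternal
      (MvPolynomial.weightedHomogeneousSubmodule k (fun _ : Fin 3 => (2 : ℤ)))
  left_mem hp hm := MvPolynomial.IsWeightedHomogeneous.mul hp hm
  right_mem hp hm := MvPolynomial.IsWeightedHomogeneous.mul hp hm

/-- `M` is indecomposable: it is nonzero, and whenever `M ≅ N ⊕ P` as graded bimodules, `N` or `P`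
is zero. -/
def Indecomposable (M : GrBimod k) : Prop :=
  Nontrivial M ∧ ∀ N P : GrBimod k, IsIso M (N.sum P) → Subsingleton N ∨ Subsingleton P

end GrBimod

/-! ## Soergel bimodules for `S_3` -/

open GrBimod

/-- The polynomials fixed by the simple reflections in `I`, where the reflection `s` swaps `x` and
`y` and the reflection `r` swaps `y` and `z`. -/
noncomputable def invariants (k : Type u) [Field k] (I : Set (Fin 2)) : Subalgebra k (Poly k) where
  carrier := {p | ∀ i ∈ I, MvPolynomial.rename (simpleRefl i) p = p}
  mul_mem' hp hq i hi := by rw [map_mul, hp i hi, hq i hi]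
  add_mem' hp hq i hi := by rw [map_add, hp i hi, hq i hi]
  algebraMap_mem' c i _ := AlgHom.commutes _ c

lemma isGradedSubalg_invariants (I : Set (Fin 2)) : IsGradedSubalg (invariants k I) := by
  intro p hp d i hi
  have h : ∀ q : Poly k, MvPolynomial.rename (simpleRefl i)
      (MvPolynomial.weightedHomogeneousComponent (fun _ => (2 : ℤ)) d q) =
      MvPolynomial.weightedHomogeneousComponent (fun _ => (2 : ℤ)) d
        (MvPolynomial.rename (simpleRefl i) q) := by
    intro q
    induction q using MvPolynomial.induction_on' with
    | monomial u c =>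
      have hu : Finsupp.weight (fun _ : Fin 3 => (2 : ℤ)) (u.mapDomain (simpleRefl i))
          = Finsupp.weight (fun _ : Fin 3 => (2 : ℤ)) u := by
        rw [Finsupp.weight_apply, Finsupp.weight_apply,
          Finsupp.sum_mapDomain_index (by simp) (by intros; simp [add_mul])]
      rw [MvPolynomial.rename_monomial]
      have h1 := MvPolynomial.isWeightedHomogeneous_monomial (fun _ : Fin 3 => (2 : ℤ)) u c rfl
      have h2 := MvPolynomial.isWeightedHomogeneous_monomial (fun _ : Fin 3 => (2 : ℤ)) _ c hu
      by_cases hd : Finsupp.weight (fun _ : Fin 3 => (2 : ℤ)) u = d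
      · subst hd
        rw [h1.weightedHomogeneousComponent_same, h2.weightedHomogeneousComponent_same,
          MvPolynomial.rename_monomial]
      · rw [h1.weightedHomogeneousComponent_ne _ (Ne.symm hd), h2.weightedHomogeneousComponent_ne _ (Ne.symm hd),
          map_zero]
    | add p q hp hq => simp only [map_add, hp, hq]
  rw [h, hp i hi]

variable (k) in
/-- The bimodule `R ⊗_{R^I} R(n)`. -/
noncomputable def inducedBimod (I : Set (Fin 2)) (n : ℤ) : GrBimod k :=
  ((regular k).tensorOver (invariants k I) (isGradedSubalg_invariants I) (regular k)).shift n

variable (k) in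
/-- The bimodules `B_s = R ⊗_{R^s} R(1)` and `B_r = R ⊗_{R^r} R(1)`. -/
noncomputable def Bgen (i : Fin 2) : GrBimod k := inducedBimod k {i} 1

variable (k) in
/-- The bimodules `B_1 = R`, `B_s`, `B_r`, `B_{sr} = B_s B_r`, `B_{rs} = B_r B_s` and
`B_{srs} = R ⊗_{R^{s,r}} R(3)`. -/
noncomputable def BW (w : S3) : GrBimod k :=
  if w = 1 then regular k
  else if w = simpleRefl 0 then Bgen k 0
  else if w = simpleRefl 1 then Bgen k 1
  else if w = simpleRefl 0 * simpleRefl 1 then (Bgen k 0).tensor (Bgen k 1)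
  else if w = simpleRefl 1 * simpleRefl 0 then (Bgen k 1).tensor (Bgen k 0)
  else inducedBimod k Set.univ 3

/-- The direct sum of a list of graded bimodules. -/
noncomputable def listSum (L : List (GrBimod k)) : GrBimod k := L.foldr GrBimod.sum GrBimod.zero

/-- `M` is a Soergel bimodule for `S_3`: it is isomorphic, as a graded bimodule, to a finite direct
sum of shifts `B_w(m)`. -/
def IsSoergel (M : GrBimod k) : Prop :=
  ∃ L : List (S3 × ℤ), IsIso M (listSum (L.map fun p => (BW k p.1).shift p.2))

variable (k) in
/-- The Soergel bimodules for `S_3`. -/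
def SBim : Type (u + 1) := {M : GrBimod k // IsSoergel M}

lemma isIso_sum_zero (M : GrBimod k) : IsIso M (M.sum GrBimod.zero) :=
  ⟨{ toEquiv :=
      { toFun := fun m => (m, PUnit.unit)
        invFun := fun x => x.1
        map_add' := fun _ _ => rfl
        map_smul' := fun _ _ => rfl
        left_inv := fun _ => rfl
        right_inv := fun _ => rfl }
     map_left := fun _ _ => rfl
     map_right := fun _ _ => rfl
     map_gr := fun _ _ => ⟨fun h => h.1, fun h => ⟨h, trivial⟩⟩ }⟩

lemma isIso_shift_zero (M : GrBimod k) : IsIso M (M.shift 0) :=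
  ⟨⟨LinearEquiv.refl k M, fun _ _ => rfl, fun _ _ => rfl, fun i m => by
    change m ∈ M.gr (0 + i) ↔ m ∈ M.gr i
    rw [zero_add]⟩⟩

lemma isSoergel_BW_shift (w : S3) (m : ℤ) : IsSoergel ((BW k w).shift m) :=
  ⟨[(w, m)], isIso_sum_zero _⟩

lemma isSoergel_BW (w : S3) : IsSoergel (BW k w) :=
  ⟨[(w, 0)], (isIso_shift_zero _).trans (isIso_sum_zero _)⟩

variable (k) in
/-- The Soergel bimodule `B_w`. -/
noncomputable def SBim.ofW (w : S3) : SBim k := ⟨BW k w, isSoergel_BW w⟩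

variable (k) in
/-- The Soergel bimodule `B_w(m)`. -/
noncomputable def SBim.ofWShift (w : S3) (m : ℤ) : SBim k := ⟨(BW k w).shift m, isSoergel_BW_shift w m⟩

/-! ## The two Grothendieck objects -/

variable (k) in
/-- Isomorphism of Soergel bimodules. -/
def soergelSetoid : Setoid (SBim k) where
  r M N := IsIso M.1 N.1
  iseqv := ⟨fun _ => IsIso.refl _, IsIso.symm, IsIso.trans⟩

variable (k) in
/-- The set of isomorphism classes of Soergel bimodules. -/
def IsoClasses : Type (u + 1) := Quotient (soergelSetoid k)

/-- The isomorphism class `⟨M⟩`. -/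
def isoClass (M : SBim k) : IsoClasses k := Quotient.mk (soergelSetoid k) M

variable (k) in
/-- The relations `M = N + P` of the split Grothendieck group, for `M ≅ N ⊕ P`. -/
def splitRel : AddSubgroup (FreeAbelianGroup (SBim k)) :=
  AddSubgroup.closure {x | ∃ M N P : SBim k, IsIso M.1 (N.1.sum P.1) ∧
    x = FreeAbelianGroup.of M - (FreeAbelianGroup.of N + FreeAbelianGroup.of P)}

variable (k) in
/-- The split Grothendieck group of the category of Soergel bimodules. -/
def SplitGroth : Type (u + 1) := FreeAbelianGroup (SBim k) ⧸ splitRel k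

instance SplitGroth.instAddCommGroup : AddCommGroup (SplitGroth k) :=
  inferInstanceAs (AddCommGroup (FreeAbelianGroup (SBim k) ⧸ splitRel k))

/-- The class `⟨M⟩` in the split Grothendieck group. -/
def grothClass (M : SBim k) : SplitGroth k := QuotientAddGroup.mk (FreeAbelianGroup.of M)

end Bimodules
end SoergelS3

open SoergelS3

namespace SoergelS3

open LaurentPolynomial

/-! ## The Kazhdan–Lusztig basis -/

/-! Every Soergel bimodule gets a character in the Hecke algebra: `HasChar M h` says that M is a
direct sum of shifts B_w(m) whose elements v^m b_w add up to h. The theorem follows once the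
character is well defined, determines M up to isomorphism, and turns sums, shifts and tensor
products into sums, multiples by powers of v, and products.

On the Hecke side, b_s and b_r satisfy b² = (v + v⁻¹) b and b_s b_r b_s − b_s = b_r b_s b_r − b_r.
These rules define a representation of rank 6 (`klRep`) that separates the b_w, and they make the
span of the b_w stable under left multiplication, so the b_w form a basis. A self-dual combination
of the b_w with coefficients in vℤ[v] vanishes (`eq_zero_of_duality_eq`); this characterises b_w.

On the bimodule side, each B_w is generated by one element of lowest degree (`isCyclic_BW`), so its
endomorphisms of degree 0 are scalars. Such bricks are indecomposable. The multiplicity of a brick X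
in M is the rank of Hom(X, M) modulo the maps killed by every map M → X; this gives Krull–Schmidt
(`perm_of_isIso_listSum`). The B_w(m) are pairwise non-isomorphic: w is detected by the permutations
σ for which B_w has a nonzero map to R that is linear on the left and σ-twisted on the right
(`below_of_sees`), and m by the degree of the generator.

Multiplicativity (`HasChar.tensor`) reduces to left multiplication by B_s, B_r and B_srs. R is free
over R^s and over R^r with basis 1, y, and over R^{s,r} with basis y^a z^b for a < 2, b < 3. Hence R
⊗_{R^I} R ⊗_{R^J} R splits into shifted copies of one induced bimodule whenever one ring of
invariants contains the other (`isIso_indT_ind_left`, `isIso_indT_ind_right`), and the shifts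
reproduce the scalars v + v⁻¹ and v³ + 2v + 2v⁻¹ + v⁻³. The remaining product is B_i B_j B_i ≅ B_srs
⊕ B_i (`isIso_tripleInd`). Its first summand is generated by 1 ⊗ 1 ⊗ 1 ⊗ 1, and the second is
embedded through y ⊗ 1 − 1 ⊗ y'. Injectivity on the first is tested by the six evaluations a ⊗ b ↦ a
σ(b), which are jointly injective by a Vandermonde argument.

The character then identifies the isomorphism classes with the positive part, and the split
Grothendieck group with the Hecke algebra. The algebra structures are transported along these
bijections, and multiplicativity shows that they are the ones given by tensor products. -/

lemma S3_induction {P : S3 → Prop} (h1 : P 1) (hs : P (simpleRefl 0)) (hr : P (simpleRefl 1))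
    (hsr : P (simpleRefl 0 * simpleRefl 1)) (hrs : P (simpleRefl 1 * simpleRefl 0))
    (hl : P longest) (w : S3) : P w := by
  have h : w = 1 ∨ w = simpleRefl 0 ∨ w = simpleRefl 1 ∨ w = simpleRefl 0 * simpleRefl 1 ∨
      w = simpleRefl 1 * simpleRefl 0 ∨ w = longest := by
    revert w; decide
  rcases h with rfl | rfl | rfl | rfl | rfl | rfl <;> assumption

lemma bKL_of_redWord {w : S3} {l : List (Fin 2)} (hw : w ≠ longest) (hl : redWord w = l) :
    bKL w = (l.map bGen).prod := by
  rw [bKL, if_neg hw, hl]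

lemma bKL_one : bKL 1 = 1 := bKL_of_redWord (l := []) (by decide) (by decide)

lemma bKL_simple (i : Fin 2) : bKL (simpleRefl i) = bGen i := by
  rw [bKL_of_redWord (l := [i]) (by revert i; decide) (by revert i; decide), List.map_singleton,
    List.prod_singleton]

lemma bKL_sr : bKL (simpleRefl 0 * simpleRefl 1) = bGen 0 * bGen 1 := by
  rw [bKL_of_redWord (l := [0, 1]) (by decide) (by decide)]; simp

lemma bKL_rs : bKL (simpleRefl 1 * simpleRefl 0) = bGen 1 * bGen 0 := by
  rw [bKL_of_redWord (l := [1, 0]) (by decide) (by decide)]; simp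

lemma bKL_longest : bKL longest = bGen 0 * bGen 1 * bGen 0 - bGen 0 := if_pos rfl

lemma hStd_of_redWord {w : S3} {l : List (Fin 2)} (hl : redWord w = l) :
    hStd w = (l.map hGen).prod := by rw [hStd, hl]

lemma vH_commutes (x : Hecke) : vH * x = x * vH := Algebra.commutes _ _

lemma hGen_eq (i : Fin 2) : hGen i = bGen i - vH := (add_sub_cancel_right _ _).symm

/-- The quantum integer `v + v⁻¹`. -/
noncomputable def quantumTwo : ℤ[T;T⁻¹] := T 1 + T (-1)

/-- The quadratic relation factors as (h_i − v⁻¹)(h_i + v) = 0, which says that b_i is killed by b_i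
− (v + v⁻¹). -/
lemma bGen_sq (i : Fin 2) : bGen i * bGen i = quantumTwo • bGen i := by
  have hv : (algebraMap ℤ[T;T⁻¹] Hecke (T (-1))) * vH = 1 := by
    rw [vH, ← map_mul, ← T_add]; simp
  have h := hGen_sq i
  rw [Algebra.smul_def, map_sub, sub_mul] at h
  rw [bGen, mul_add, add_mul, add_mul, h, Algebra.smul_def, quantumTwo, map_add, add_mul, mul_add,
    mul_add, hv, ← vH_commutes]
  change _ - vH * hGen i + 1 + _ + _ = vH * hGen i + vH * vH + _
  abel

/-- Substitute h = b − v in the braid relation. All terms of lower order are symmetric in the two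
generators except those from v b_i², and b_i v b_i = v² b_i + b_i leaves exactly one b_i on each
side. So b_srs has two equivalent expressions. -/
lemma bGen_braid : bGen 0 * bGen 1 * bGen 0 - bGen 0 = bGen 1 * bGen 0 * bGen 1 - bGen 1 := by
  have hv : (algebraMap ℤ[T;T⁻¹] Hecke (T (-1))) * vH = 1 := by
    rw [vH, ← map_mul, ← T_add]; simp
  have key (i : Fin 2) : bGen i * vH * bGen i = vH * vH * bGen i + bGen i := by
    rw [← vH_commutes, mul_assoc, bGen_sq, Algebra.smul_def, quantumTwo, map_add, add_mul, mul_add,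
      ← mul_assoc, ← mul_assoc, vH_commutes (algebraMap _ _ (T (-1))), hv, one_mul]; rfl
  have h := hGen_braid
  simp only [hGen_eq, mul_sub, sub_mul] at h
  rw [key 0, key 1] at h
  simp only [← vH_commutes, mul_assoc] at h ⊢
  have e (i j : Fin 2) : bGen i * (vH * bGen j) = vH * (bGen i * bGen j) := by
    rw [← mul_assoc, ← vH_commutes, mul_assoc]
  simp only [e] at h
  rw [← sub_eq_zero] at h ⊢
  rw [← h]
  abel

/-- Left multiplication by `b_s` and `b_r`, in coordinates with respect to the Kazhdan–Lusztig basis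
`b_e, b_s, b_r, b_sr, b_rs, b_srs`. -/
noncomputable def klAction (i : Fin 2) : Module.End ℤ[T;T⁻¹] (Fin 6 → ℤ[T;T⁻¹]) where
  toFun c := if i = 0 then
      ![0, c 0 + quantumTwo * c 1 + c 4, 0, c 2 + quantumTwo * c 3, 0, c 4 + quantumTwo * c 5]
    else ![0, 0, c 0 + quantumTwo * c 2 + c 3, 0, c 1 + quantumTwo * c 4, c 3 + quantumTwo * c 5]
  map_add' c d := by
    ext1 j
    split_ifs <;> fin_cases j <;> simp <;> ring
  map_smul' a c := by
    ext1 j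
    split_ifs <;> fin_cases j <;> simp <;> ring

lemma klAction_zero (c : Fin 6 → ℤ[T;T⁻¹]) : klAction 0 c =
    ![0, c 0 + quantumTwo * c 1 + c 4, 0, c 2 + quantumTwo * c 3, 0, c 4 + quantumTwo * c 5] := rfl

lemma klAction_one (c : Fin 6 → ℤ[T;T⁻¹]) : klAction 1 c =
    ![0, 0, c 0 + quantumTwo * c 2 + c 3, 0, c 1 + quantumTwo * c 4, c 3 + quantumTwo * c 5] := rfl

/-- Together with `klAction_braid` this gives the operators the relations of b_s and b_r, so that
the operators `klAction i` − v satisfy the defining relations of h_s and h_r. -/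
lemma klAction_sq (i : Fin 2) : klAction i * klAction i = quantumTwo • klAction i := by
  refine LinearMap.ext fun c => ?_
  rw [Module.End.mul_apply, LinearMap.smul_apply]
  ext1 j
  fin_cases i
  · simp only [Fin.zero_eta, klAction_zero]
    fin_cases j <;> simp
  · simp only [Fin.mk_one, klAction_one]
    fin_cases j <;> simp

lemma klAction_braid : klAction 0 * klAction 1 * klAction 0 - klAction 0 =
    klAction 1 * klAction 0 * klAction 1 - klAction 1 := by
  refine LinearMap.ext fun c => ?_
  simp only [Module.End.mul_apply, LinearMap.sub_apply, klAction_zero, klAction_one]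
  ext1 j
  fin_cases j <;> simp <;> ring

/-- The regular representation of the Hecke algebra in Kazhdan–Lusztig coordinates. -/
noncomputable def klRep : Hecke →ₐ[ℤ[T;T⁻¹]] Module.End ℤ[T;T⁻¹] (Fin 6 → ℤ[T;T⁻¹]) :=
  RingQuot.liftAlgHom ℤ[T;T⁻¹] ⟨FreeAlgebra.lift ℤ[T;T⁻¹] fun i => klAction i - (T 1 : ℤ[T;T⁻¹]) • 1, by
    have hv : (T 1 * T (-1) : ℤ[T;T⁻¹]) = 1 := by rw [← T_add]; simp
    rintro _ _ (i | _)
    · simp only [map_mul, map_add, map_smul, map_one, FreeAlgebra.lift_ι_apply]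
      simp only [mul_sub, sub_mul, klAction_sq, smul_mul_assoc, mul_smul_comm, one_mul, mul_one,
        smul_sub, smul_smul, sub_smul, hv, quantumTwo, add_smul, mul_comm (T (-1)) (T 1), one_smul]
      abel
    · simp only [map_mul, FreeAlgebra.lift_ι_apply]
      have h := klAction_braid
      simp only [mul_sub, sub_mul, klAction_sq, smul_mul_assoc, mul_smul_comm, one_mul, mul_one,
        smul_sub, smul_smul, smul_add, hv, quantumTwo, add_smul, one_smul]
      rw [← sub_eq_zero] at h ⊢
      rw [← h]
      abel⟩

lemma klRep_bGen (i : Fin 2) : klRep (bGen i) = klAction i := by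
  have h : klRep (hGen i) = klAction i - (T 1 : ℤ[T;T⁻¹]) • 1 :=
    (RingQuot.liftAlgHom_mkAlgHom_apply ℤ[T;T⁻¹] _ _ _).trans (FreeAlgebra.lift_ι_apply _ _)
  rw [bGen, map_add, h, vH, AlgHom.commutes, Algebra.algebraMap_eq_smul_one, sub_add_cancel]

/-- The position of `w` in the list `e, s, r, sr, rs, srs`. -/
def klIndex (w : S3) : Fin 6 :=
  if w = 1 then 0 else if w = simpleRefl 0 then 1 else if w = simpleRefl 1 then 2
  else if w = simpleRefl 0 * simpleRefl 1 then 3 else if w = simpleRefl 1 * simpleRefl 0 then 4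
  else 5

lemma klIndex_injective : Function.Injective klIndex := by
  unfold Function.Injective; decide

/-- The first basis vector stands for b_e = 1, so b_w applied to it has to return the coordinate
vector of b_w. -/
lemma klRep_bKL (w : S3) : klRep (bKL w) (Pi.single 0 1) = Pi.single (klIndex w) 1 := by
  induction w using S3_induction
  · rw [bKL_one, map_one]; rfl
  · rw [bKL_simple, klRep_bGen, show klIndex _ = 1 by decide, klAction_zero]
    ext1 j; fin_cases j <;> simp
  · rw [bKL_simple, klRep_bGen, show klIndex _ = 2 by decide, klAction_one]
    ext1 j; fin_cases j <;> simp
  · rw [bKL_sr, map_mul, klRep_bGen, klRep_bGen, show klIndex _ = 3 by decide,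
      Module.End.mul_apply, klAction_zero, klAction_one]
    ext1 j; fin_cases j <;> simp
  · rw [bKL_rs, map_mul, klRep_bGen, klRep_bGen, show klIndex _ = 4 by decide,
      Module.End.mul_apply, klAction_zero, klAction_one]
    ext1 j; fin_cases j <;> simp
  · rw [bKL_longest, map_sub, map_mul, map_mul, klRep_bGen, klRep_bGen,
      show klIndex _ = 5 by decide, LinearMap.sub_apply, Module.End.mul_apply,
      Module.End.mul_apply, klAction_zero, klAction_zero, klAction_one]
    ext1 j; fin_cases j <;> simp

lemma linearIndependent_bKL : LinearIndependent ℤ[T;T⁻¹] bKL := by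
  let f : Hecke →ₗ[ℤ[T;T⁻¹]] (Fin 6 → ℤ[T;T⁻¹]) :=
    (LinearMap.applyₗ (Pi.single 0 1)) ∘ₗ klRep.toLinearMap
  refine LinearIndependent.of_comp f ?_
  have h : f ∘ bKL = (Pi.basisFun ℤ[T;T⁻¹] (Fin 6)) ∘ klIndex := by
    ext1 w
    rw [Function.comp_apply, Function.comp_apply, Pi.basisFun_apply]
    exact klRep_bKL w
  rw [h]
  exact (Pi.basisFun ℤ[T;T⁻¹] (Fin 6)).linearIndependent.comp _ klIndex_injective

end SoergelS3

/-! ### Multiplication rules and spanning -/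

namespace SoergelS3

open LaurentPolynomial

lemma bGen_zero_mul_rs : bGen 0 * bKL (simpleRefl 1 * simpleRefl 0) = bKL longest + bGen 0 := by
  rw [bKL_rs, bKL_longest, sub_add_cancel, mul_assoc]

lemma bGen_one_mul_sr : bGen 1 * bKL (simpleRefl 0 * simpleRefl 1) = bKL longest + bGen 1 := by
  rw [bKL_sr, bKL_longest, bGen_braid, sub_add_cancel, mul_assoc]

/-- By `bGen_braid`, b_srs can be written with b_i as the leftmost factor of both of its terms;
`bGen_sq` then absorbs the new factor. -/
lemma bGen_mul_longest (i : Fin 2) : bGen i * bKL longest = quantumTwo • bKL longest := by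
  fin_cases i
  · simp only [Fin.zero_eta, bKL_longest, mul_sub, ← mul_assoc, bGen_sq, smul_mul_assoc, smul_sub]
  · simp only [Fin.mk_one, bKL_longest, bGen_braid, mul_sub, ← mul_assoc, bGen_sq, smul_mul_assoc,
      smul_sub]

lemma longest_mul_bGen (i : Fin 2) : bKL longest * bGen i = quantumTwo • bKL longest := by
  fin_cases i
  · simp only [Fin.zero_eta, bKL_longest, sub_mul, mul_assoc, bGen_sq, mul_smul_comm, smul_sub]
  · rw [Fin.mk_one, bKL_longest, bGen_braid]
    simp only [sub_mul, mul_assoc, bGen_sq, mul_smul_comm, smul_sub]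

/-- The span contains 1 and is stable under left multiplication by each b_i, hence by each h_i = b_i
− v and by the whole algebra. -/
lemma span_bKL : Submodule.span ℤ[T;T⁻¹] (Set.range bKL) = ⊤ := by
  set S := Submodule.span ℤ[T;T⁻¹] (Set.range bKL) with hS
  have hb (w : S3) : bKL w ∈ S := Submodule.subset_span ⟨w, rfl⟩
  have hg (i : Fin 2) : bGen i ∈ S := by rw [← bKL_simple]; exact hb _
  have key (i : Fin 2) : ∀ x ∈ S, bGen i * x ∈ S := by
    intro x hx
    induction hx using Submodule.span_induction with
    | mem x hx =>
      obtain ⟨w, rfl⟩ := hx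
      induction w using S3_induction
      · rw [bKL_one, mul_one]; exact hg i
      · rw [bKL_simple]
        fin_cases i
        · exact bGen_sq 0 ▸ S.smul_mem _ (hg 0)
        · exact bKL_rs ▸ hb _
      · rw [bKL_simple]
        fin_cases i
        · exact bKL_sr ▸ hb _
        · exact bGen_sq 1 ▸ S.smul_mem _ (hg 1)
      · fin_cases i
        · simp only [Fin.zero_eta, bKL_sr]
          rw [← mul_assoc, bGen_sq, smul_mul_assoc, ← bKL_sr]
          exact S.smul_mem _ (hb _)
        · exact bGen_one_mul_sr ▸ S.add_mem (hb _) (hg 1)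
      · fin_cases i
        · exact bGen_zero_mul_rs ▸ S.add_mem (hb _) (hg 0)
        · simp only [Fin.mk_one, bKL_rs]
          rw [← mul_assoc, bGen_sq, smul_mul_assoc, ← bKL_rs]
          exact S.smul_mem _ (hb _)
      · rw [bGen_mul_longest]
        exact S.smul_mem _ (hb _)
    | zero => simp
    | add x y _ _ hx hy => rw [mul_add]; exact S.add_mem hx hy
    | smul c x _ hx => rw [mul_smul_comm]; exact S.smul_mem _ hx
  have main (a : FreeAlgebra ℤ[T;T⁻¹] (Fin 2)) : ∀ x ∈ S, heckeMk a * x ∈ S := by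
    induction a using FreeAlgebra.induction with
    | grade0 r =>
      intro x hx
      rw [AlgHom.commutes, ← Algebra.smul_def]
      exact S.smul_mem _ hx
    | grade1 i =>
      intro x hx
      have e : heckeMk (FreeAlgebra.ι ℤ[T;T⁻¹] i) = bGen i - vH := hGen_eq i
      rw [e, sub_mul, vH, ← Algebra.smul_def]
      exact S.sub_mem (key i x hx) (S.smul_mem _ hx)
    | mul a b ha hb => intro x hx; rw [map_mul, mul_assoc]; exact ha _ (hb _ hx)
    | add a b ha hb => intro x hx; rw [map_add, add_mul]; exact S.add_mem (ha _ hx) (hb _ hx)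
  rw [eq_top_iff]
  rintro x -
  obtain ⟨a, rfl⟩ := RingQuot.mkAlgHom_surjective ℤ[T;T⁻¹] HeckeRel x
  have := main a 1 (bKL_one ▸ hb 1)
  rwa [mul_one] at this

/-! ### Duality and uniqueness of the Kazhdan–Lusztig elements -/

lemma duality_bGen (i : Fin 2) : duality (bGen i) = bGen i := by
  rw [bGen, map_add, duality_hGen, vH, duality_algebraMap, hInv, invert_T, map_sub, add_assoc,
    sub_add_cancel]

lemma duality_bKL (w : S3) : duality (bKL w) = bKL w := by
  induction w using S3_induction
  · rw [bKL_one, map_one]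
  · rw [bKL_simple, duality_bGen]
  · rw [bKL_simple, duality_bGen]
  · rw [bKL_sr, map_mul, duality_bGen, duality_bGen]
  · rw [bKL_rs, map_mul, duality_bGen, duality_bGen]
  · rw [bKL_longest, map_sub, map_mul, map_mul, duality_bGen, duality_bGen]

/-- The elements `∑_y p_y f_y` with `p_y ∈ v ℤ[v]`. -/
noncomputable def vLattice (f : S3 → Hecke) : AddSubgroup Hecke where
  carrier := {x | ∃ c : S3 → Polynomial ℤ,
    x = ∑ y : S3, Polynomial.toLaurent (Polynomial.X * c y) • f y}
  add_mem' := by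
    rintro _ _ ⟨c, rfl⟩ ⟨d, rfl⟩
    refine ⟨c + d, ?_⟩
    simp only [Pi.add_apply, mul_add, map_add, add_smul, Finset.sum_add_distrib]
  zero_mem' := ⟨0, by simp⟩
  neg_mem' := by
    rintro _ ⟨c, rfl⟩
    refine ⟨-c, ?_⟩
    simp only [Pi.neg_apply, mul_neg, map_neg, neg_smul, Finset.sum_neg_distrib]

section vLattice

variable {f g : S3 → Hecke}

lemma toLaurent_smul_mem_vLattice (p : Polynomial ℤ) {x : Hecke} (hx : x ∈ vLattice f) :
    Polynomial.toLaurent p • x ∈ vLattice f := by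
  obtain ⟨c, rfl⟩ := hx
  refine ⟨fun y => p * c y, ?_⟩
  rw [Finset.smul_sum]
  refine Finset.sum_congr rfl fun y _ => ?_
  rw [smul_smul, ← map_mul, mul_left_comm]

lemma vH_mul_mem_vLattice {x : Hecke} (hx : x ∈ vLattice f) : vH * x ∈ vLattice f := by
  have := toLaurent_smul_mem_vLattice Polynomial.X hx
  rwa [Polynomial.toLaurent_X, Algebra.smul_def] at this

lemma vH_mul_apply_mem_vLattice (y : S3) : vH * f y ∈ vLattice f := by
  refine ⟨Pi.single y 1, ?_⟩
  rw [Finset.sum_eq_single y]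
  · rw [Pi.single_eq_same, mul_one, Polynomial.toLaurent_X, Algebra.smul_def]; rfl
  · intro z _ hz
    rw [Pi.single_eq_of_ne hz, mul_zero, map_zero, zero_smul]
  · simp

/-- It is enough to place v f_y = v g_y + v (f_y − g_y). This is how the defining condition of b_w,
stated in the standard basis, is moved to the basis of the b_y. -/
lemma vLattice_le (h : ∀ y, f y - g y ∈ vLattice g) : vLattice f ≤ vLattice g := by
  rintro _ ⟨c, rfl⟩
  refine AddSubgroup.sum_mem _ fun y _ => ?_
  rw [mul_comm, map_mul, mul_smul]
  refine toLaurent_smul_mem_vLattice _ ?_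
  rw [Polynomial.toLaurent_X, Algebra.smul_def, ← sub_add_cancel (f y) (g y), mul_add]
  exact add_mem (vH_mul_mem_vLattice (h y)) (vH_mul_apply_mem_vLattice y)

end vLattice

lemma hStd_one : hStd 1 = 1 := hStd_of_redWord (l := []) (by decide)

lemma hStd_simple (i : Fin 2) : hStd (simpleRefl i) = hGen i := by
  rw [hStd_of_redWord (l := [i]) (by revert i; decide), List.map_singleton, List.prod_singleton]

lemma hStd_sr : hStd (simpleRefl 0 * simpleRefl 1) = hGen 0 * hGen 1 := by
  rw [hStd_of_redWord (l := [0, 1]) (by decide)]; simp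

lemma hStd_rs : hStd (simpleRefl 1 * simpleRefl 0) = hGen 1 * hGen 0 := by
  rw [hStd_of_redWord (l := [1, 0]) (by decide)]; simp

lemma hStd_longest : hStd longest = hGen 0 * (hGen 1 * hGen 0) := by
  rw [hStd_of_redWord (l := [0, 1, 0]) (by decide)]; simp

/-- Multiplying the quadratic relation by v clears v⁻¹, so the rewriting stays inside ℤ[v]. -/
lemma vH_mul_hGen_sq (i : Fin 2) : vH * (hGen i * hGen i) = hGen i - vH * (vH * hGen i) + vH := by
  have hv : vH * (algebraMap ℤ[T;T⁻¹] Hecke (T (-1))) = 1 := by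
    rw [vH, ← map_mul, ← T_add]; simp
  rw [hGen_sq, Algebra.smul_def, map_sub, sub_mul, mul_add, mul_sub, mul_one, ← mul_assoc, hv,
    one_mul]
  rfl

lemma mul_vH_mul (x y : Hecke) : x * (vH * y) = vH * (x * y) := by
  rw [← mul_assoc, ← vH_commutes, mul_assoc]

lemma bKL_sub_hStd_mem (w : S3) : bKL w - hStd w ∈ vLattice hStd := by
  have h1 : vH ∈ vLattice hStd := by
    have := vH_mul_apply_mem_vLattice (f := hStd) 1
    rwa [hStd_one, mul_one] at this
  have hg (i : Fin 2) : vH * hGen i ∈ vLattice hStd := by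
    rw [← hStd_simple]; exact vH_mul_apply_mem_vLattice _
  have h2 (x y : Hecke) (hxy : vH * (x * y) ∈ vLattice hStd) (hx : vH * x ∈ vLattice hStd)
      (hy : vH * y ∈ vLattice hStd) : (x + vH) * (y + vH) - x * y ∈ vLattice hStd := by
    have e : (x + vH) * (y + vH) - x * y = vH * x + vH * y + vH * vH := by
      rw [add_mul, mul_add, mul_add, ← vH_commutes]; abel
    rw [e]
    exact add_mem (add_mem hx hy) (vH_mul_mem_vLattice h1)
  have hsr : vH * (hGen 0 * hGen 1) ∈ vLattice hStd := by
    rw [← hStd_sr]; exact vH_mul_apply_mem_vLattice _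
  have hrs : vH * (hGen 1 * hGen 0) ∈ vLattice hStd := by
    rw [← hStd_rs]; exact vH_mul_apply_mem_vLattice _
  induction w using S3_induction
  · rw [bKL_one, hStd_one, sub_self]; exact zero_mem _
  · rw [bKL_simple, hStd_simple, bGen, add_sub_cancel_left]; exact h1
  · rw [bKL_simple, hStd_simple, bGen, add_sub_cancel_left]; exact h1
  · rw [bKL_sr, hStd_sr]
    exact h2 _ _ hsr (hg 0) (hg 1)
  · rw [bKL_rs, hStd_rs]
    exact h2 _ _ hrs (hg 1) (hg 0)
  -- The product b_s b_r b_s contains v h_s² = h_s − v² h_s + v. The summands h_s and v cancel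
  -- against −b_s, and every coefficient that is left lies in vℤ[v].
  · have e : bKL longest - hStd longest = vH * (hGen 0 * hGen 1) + vH * (hGen 1 * hGen 0) +
        vH * (vH * hGen 0) + vH * (vH * hGen 1) + vH * (vH * vH) := by
      rw [bKL_longest, hStd_longest, bGen, bGen]
      simp only [add_mul, mul_add, mul_assoc, ← vH_commutes, mul_vH_mul, vH_mul_hGen_sq]
      abel
    rw [e]
    exact add_mem (add_mem (add_mem (add_mem hsr hrs) (vH_mul_mem_vLattice (hg 0)))
      (vH_mul_mem_vLattice (hg 1))) (vH_mul_mem_vLattice (vH_mul_mem_vLattice h1))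


/-- The same expansion with h = b − v instead of b = h + v; it feeds `vLattice_le`. -/
lemma hStd_sub_bKL_mem (w : S3) : hStd w - bKL w ∈ vLattice bKL := by
  have h1 : vH ∈ vLattice bKL := by
    have := vH_mul_apply_mem_vLattice (f := bKL) 1
    rwa [bKL_one, mul_one] at this
  have hg (i : Fin 2) : vH * bGen i ∈ vLattice bKL := by
    rw [← bKL_simple]; exact vH_mul_apply_mem_vLattice _
  have h2 (x y : Hecke) (hx : vH * x ∈ vLattice bKL) (hy : vH * y ∈ vLattice bKL) :
      (x - vH) * (y - vH) - x * y ∈ vLattice bKL := by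
    have e : (x - vH) * (y - vH) - x * y = vH * vH - (vH * x + vH * y) := by
      rw [sub_mul, mul_sub, mul_sub, ← vH_commutes]; abel
    rw [e]
    exact sub_mem (vH_mul_mem_vLattice h1) (add_mem hx hy)
  have hsr : vH * (bGen 0 * bGen 1) ∈ vLattice bKL := by
    rw [← bKL_sr]; exact vH_mul_apply_mem_vLattice _
  have hrs : vH * (bGen 1 * bGen 0) ∈ vLattice bKL := by
    rw [← bKL_rs]; exact vH_mul_apply_mem_vLattice _
  induction w using S3_induction
  · rw [bKL_one, hStd_one, sub_self]; exact zero_mem _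
  · rw [bKL_simple, hStd_simple, bGen, sub_add_cancel_left]; exact neg_mem h1
  · rw [bKL_simple, hStd_simple, bGen, sub_add_cancel_left]; exact neg_mem h1
  · rw [bKL_sr, hStd_sr, hGen_eq, hGen_eq]
    exact h2 _ _ (hg 0) (hg 1)
  · rw [bKL_rs, hStd_rs, hGen_eq, hGen_eq]
    exact h2 _ _ (hg 1) (hg 0)
  · have hv : vH * (bGen 0 * bGen 0) = vH * (vH * bGen 0) + bGen 0 := by
      have hv : vH * (algebraMap ℤ[T;T⁻¹] Hecke (T (-1))) = 1 := by
        rw [vH, ← map_mul, ← T_add]; simp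
      rw [bGen_sq, quantumTwo, Algebra.smul_def, map_add, add_mul, mul_add, ← mul_assoc _ _ (bGen 0),
        ← mul_assoc _ _ (bGen 0), hv, one_mul, mul_assoc]
      rfl
    have e : hStd longest - bKL longest = vH * (vH * bGen 0) + vH * (vH * bGen 1) -
        vH * (bGen 0 * bGen 1) - vH * (bGen 1 * bGen 0) - vH * (vH * vH) := by
      rw [bKL_longest, hStd_longest, hGen_eq, hGen_eq]
      simp only [sub_mul, mul_sub, mul_assoc, ← vH_commutes, mul_vH_mul, hv]
      abel
    rw [e]
    exact sub_mem (sub_mem (sub_mem (add_mem (vH_mul_mem_vLattice (hg 0))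
      (vH_mul_mem_vLattice (hg 1))) hsr) hrs) (vH_mul_mem_vLattice (vH_mul_mem_vLattice h1))

/-- If p = Xc is nonzero of degree n, invariance turns the reversal of p into p X^n. That has degree
2n, whereas a reversal has degree at most n, and n ≥ 1 because of the factor X. -/
lemma eq_zero_of_invert_toLaurent (c : Polynomial ℤ)
    (h : invert (Polynomial.toLaurent (Polynomial.X * c)) = Polynomial.toLaurent (Polynomial.X * c)) :
    c = 0 := by
  by_contra hc
  set p := Polynomial.X * c with hp
  have hp0 : p ≠ 0 := mul_ne_zero Polynomial.X_ne_zero hc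
  have h1 : p.reverse = p * Polynomial.X ^ p.natDegree := by
    apply Polynomial.toLaurent_injective
    rw [toLaurent_reverse, h, map_mul Polynomial.toLaurent p, Polynomial.toLaurent_X_pow]
  have h2 := Polynomial.reverse_natDegree_le p
  rw [h1, Polynomial.natDegree_mul_X_pow _ hp0, hp, Polynomial.natDegree_X_mul hc] at h2
  omega

/-- Duality fixes every b_y and inverts v in the coefficients, so by independence each coefficient
is invariant under v ↦ v⁻¹. -/
lemma eq_zero_of_duality_eq {x : Hecke} (hx : x ∈ vLattice bKL) (hd : duality x = x) : x = 0 := by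
  obtain ⟨c, rfl⟩ := hx
  have h : ∑ y, (invert (Polynomial.toLaurent (Polynomial.X * c y)) -
      Polynomial.toLaurent (Polynomial.X * c y)) • bKL y = 0 := by
    rw [map_sum] at hd
    simp only [sub_smul, Finset.sum_sub_distrib, sub_eq_zero]
    refine Eq.trans (Finset.sum_congr rfl fun y _ => ?_) hd
    rw [Algebra.smul_def, Algebra.smul_def, map_mul duality, duality_algebraMap, duality_bKL]
  have h' := Fintype.linearIndependent_iff.1 linearIndependent_bKL _ h
  refine Finset.sum_eq_zero fun y _ => ?_
  rw [eq_zero_of_invert_toLaurent (c y) (sub_eq_zero.1 (h' y)), mul_zero, map_zero, zero_smul]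

lemma isKazhdanLusztig_iff (w : S3) (b : Hecke) : IsKazhdanLusztig w b ↔ b = bKL w := by
  have h : bKL w - hStd w ∈ vLattice hStd := bKL_sub_hStd_mem w
  constructor
  · rintro ⟨hd, c, hc⟩
    -- Both b and b_w are congruent to h_w modulo the lattice, so their difference is a self-dual
    -- lattice element.
    have hb : b - hStd w ∈ vLattice hStd := ⟨c, by rw [hc, add_sub_cancel_left]⟩
    rw [← sub_eq_zero]
    refine eq_zero_of_duality_eq (vLattice_le hStd_sub_bKL_mem ?_) (by rw [map_sub, hd, duality_bKL])
    rw [← sub_sub_sub_cancel_right b (bKL w) (hStd w)]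
    exact sub_mem hb h
  · rintro rfl
    obtain ⟨c, hc⟩ := h
    exact ⟨duality_bKL w, c, by rw [← hc, add_sub_cancel]⟩

/-- The inclusion `ℕ[v, v⁻¹] ⊂ ℤ[v, v⁻¹]`. -/
noncomputable def natLaurentInclusion : LaurentPolynomial ℕ →+* ℤ[T;T⁻¹] :=
  AddMonoidAlgebra.mapRingHom ℤ (Nat.castRingHom ℤ)

lemma natLaurentInclusion_injective : Function.Injective natLaurentInclusion := by
  intro a b h
  refine AddMonoidAlgebra.map_injective (Nat.castRingHom ℤ).toAddMonoidHom ?_ h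
  exact Nat.cast_injective

lemma natLaurentInclusion_T (n : ℤ) : natLaurentInclusion (T n) = T n := by
  exact (AddMonoidAlgebra.mapRingHom_single _ _ _).trans (by simp only [map_one]; rfl)

lemma natLaurent_smul (a : LaurentPolynomial ℕ) (x : Hecke) :
    a • x = natLaurentInclusion a • x := by
  rw [Algebra.smul_def, Algebra.smul_def]; rfl

/-- Over a semiring, independence means that equal combinations have equal coefficients; this
descends along the injection ℕ[v, v⁻¹] → ℤ[v, v⁻¹]. -/
lemma linearIndependent_nat_bKL : LinearIndependent (LaurentPolynomial ℕ) bKL := by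
  rw [Fintype.linearIndependent_iffₛ]
  intro a b h y
  refine natLaurentInclusion_injective ?_
  refine Fintype.linearIndependent_iffₛ.1 linearIndependent_bKL (natLaurentInclusion ∘ a)
    (natLaurentInclusion ∘ b) ?_ y
  simpa only [natLaurent_smul, Function.comp_apply] using h

end SoergelS3

namespace SoergelS3

/-! ## Homomorphisms of graded bimodules -/

namespace GrBimod

variable {k : Type u} [Field k]

/-- The homomorphisms of graded bimodules, homogeneous of degree `0`. -/
def hom (M N : GrBimod k) : Submodule k (M →ₗ[k] N) where
  carrier := {f | (∀ p m, f (M.left p m) = N.left p (f m)) ∧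
    (∀ p m, f (M.right p m) = N.right p (f m)) ∧ ∀ i, ∀ m ∈ M.gr i, f m ∈ N.gr i}
  add_mem' := by
    rintro f g ⟨hf1, hf2, hf3⟩ ⟨hg1, hg2, hg3⟩
    refine ⟨fun p m => ?_, fun p m => ?_, fun i m hm => (N.gr i).add_mem (hf3 i m hm) (hg3 i m hm)⟩
    · rw [LinearMap.add_apply, LinearMap.add_apply, hf1, hg1, map_add]
    · rw [LinearMap.add_apply, LinearMap.add_apply, hf2, hg2, map_add]
  zero_mem' := ⟨fun p m => (map_zero _).symm, fun p m => (map_zero _).symm,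
    fun i m _ => (N.gr i).zero_mem⟩
  smul_mem' := by
    rintro c f ⟨hf1, hf2, hf3⟩
    refine ⟨fun p m => ?_, fun p m => ?_, fun i m hm => (N.gr i).smul_mem c (hf3 i m hm)⟩
    · rw [LinearMap.smul_apply, LinearMap.smul_apply, hf1, map_smul]
    · rw [LinearMap.smul_apply, LinearMap.smul_apply, hf2, map_smul]

section hom

variable {M N P : GrBimod k}

lemma id_mem_hom : LinearMap.id ∈ hom M M := ⟨fun _ _ => rfl, fun _ _ => rfl, fun _ _ h => h⟩

lemma comp_mem_hom {g : N →ₗ[k] P} {f : M →ₗ[k] N} (hg : g ∈ hom N P) (hf : f ∈ hom M N) :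
    g ∘ₗ f ∈ hom M P :=
  ⟨fun p m => by rw [LinearMap.comp_apply, hf.1, hg.1]; rfl,
    fun p m => by rw [LinearMap.comp_apply, hf.2.1, hg.2.1]; rfl,
    fun i m hm => hg.2.2 i _ (hf.2.2 i m hm)⟩

lemma hom_proj {f : M →ₗ[k] N} (hf : f ∈ hom M N) (i : ℤ) (m : M) :
    N.proj i (f m) = f (M.proj i m) := by
  suffices h : N.proj i ∘ₗ f = f ∘ₗ M.proj i from LinearMap.congr_fun h m
  refine hom_ext fun j m hm => ?_
  rw [LinearMap.comp_apply, LinearMap.comp_apply, N.proj_apply (hf.2.2 j m hm), M.proj_apply hm]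
  split_ifs
  · rfl
  · rw [map_zero]

lemma proj_mem (i : ℤ) (m : M) : M.proj i m ∈ M.gr i := Subtype.prop _

/-- A bijective homomorphism automatically reflects degrees: if f(m) has degree i, then m and its
projection to degree i have the same image. -/
lemma isIso_of_bijective {f : M →ₗ[k] N} (hf : f ∈ hom M N) (hb : Function.Bijective f) :
    IsIso M N :=
  ⟨{ toEquiv := LinearEquiv.ofBijective f hb
     map_left := hf.1
     map_right := hf.2.1
     map_gr := fun i m => ⟨fun h => by
        have h1 : f (M.proj i m) = f m := by rw [← hom_proj hf]; exact N.proj_same h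
        rw [← hb.1 h1]
        exact proj_mem i m, hf.2.2 i m⟩ }⟩

lemma isIso_of_inverse {f : M →ₗ[k] N} {g : N →ₗ[k] M} (hf : f ∈ hom M N)
    (h1 : g ∘ₗ f = LinearMap.id) (h2 : f ∘ₗ g = LinearMap.id) : IsIso M N :=
  isIso_of_bijective hf ⟨Function.LeftInverse.injective (LinearMap.congr_fun h1),
    Function.RightInverse.surjective (LinearMap.congr_fun h2)⟩

lemma IsIso.exists_hom (h : IsIso M N) : ∃ f ∈ hom M N, ∃ g ∈ hom N M,
    g ∘ₗ f = LinearMap.id ∧ f ∘ₗ g = LinearMap.id := by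
  obtain ⟨e'⟩ := id h
  obtain ⟨e, h1, h2, h3⟩ := e'
  refine ⟨e, ⟨h1, h2, fun i m => (h3 i m).2⟩, e.symm, ⟨fun p m => ?_, fun p m => ?_, fun i m hm => ?_⟩,
    by ext; simp, by ext; simp⟩
  · exact e.injective (by simp [h1])
  · exact e.injective (by simp [h2])
  · rw [← h3]; simpa using hm

end hom

/-! ### Shifts and direct sums -/

section shift

variable {M N : GrBimod k}

lemma mem_hom_shift {f : M →ₗ[k] N} (hf : f ∈ hom M N) (n : ℤ) :
    f ∈ hom (M.shift n) (N.shift n) :=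
  ⟨hf.1, hf.2.1, fun i => hf.2.2 (n + i)⟩

lemma IsIso.shift (h : IsIso M N) (n : ℤ) : IsIso (M.shift n) (N.shift n) := by
  obtain ⟨f, hf, g, hg, h1, h2⟩ := h.exists_hom
  exact isIso_of_inverse (mem_hom_shift hf n) h1 h2

lemma isIso_of_gr_eq {f : M ≃ₗ[k] N} (h1 : ∀ p m, f (M.left p m) = N.left p (f m))
    (h2 : ∀ p m, f (M.right p m) = N.right p (f m)) (h3 : ∀ i m, m ∈ M.gr i → f m ∈ N.gr i) :
    IsIso M N :=
  isIso_of_bijective (f := f.toLinearMap) ⟨h1, h2, h3⟩ f.bijective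

/-- The identity of the underlying vector spaces of `M` and `M(n)`. -/
def shiftEquiv (M : GrBimod k) (n : ℤ) : M ≃ₗ[k] M.shift n := LinearEquiv.refl k M

lemma shiftEquiv_left (n : ℤ) (p : Poly k) (m : M) :
    (shiftEquiv M n).toLinearMap (M.left p m) =
      (M.shift n).left p ((shiftEquiv M n).toLinearMap m) := rfl

lemma shiftEquiv_right (n : ℤ) (p : Poly k) (m : M) :
    (shiftEquiv M n).toLinearMap (M.right p m) =
      (M.shift n).right p ((shiftEquiv M n).toLinearMap m) := rfl

lemma shiftEquiv_symm_left (n : ℤ) (p : Poly k) (m : M.shift n) :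
    (shiftEquiv M n).symm.toLinearMap ((M.shift n).left p m) =
      M.left p ((shiftEquiv M n).symm.toLinearMap m) := rfl

lemma shiftEquiv_symm_right (n : ℤ) (p : Poly k) (m : M.shift n) :
    (shiftEquiv M n).symm.toLinearMap ((M.shift n).right p m) =
      M.right p ((shiftEquiv M n).symm.toLinearMap m) := rfl

lemma id_left (p : Poly k) (m : M) :
    (LinearMap.id : M →ₗ[k] M) (M.left p m) = M.left p ((LinearMap.id : M →ₗ[k] M) m) := rfl

lemma id_right (p : Poly k) (m : M) :
    (LinearMap.id : M →ₗ[k] M) (M.right p m) = M.right p ((LinearMap.id : M →ₗ[k] M) m) := rfl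

lemma shiftEquiv_mem_gr {n i : ℤ} {m : M} :
    shiftEquiv M n m ∈ (M.shift n).gr i ↔ m ∈ M.gr (n + i) := Iff.rfl

lemma isIso_shift_of_equiv {n : ℤ} (f : M ≃ₗ[k] N) (h1 : ∀ p m, f (M.left p m) = N.left p (f m))
    (h2 : ∀ p m, f (M.right p m) = N.right p (f m))
    (h3 : ∀ i m, m ∈ M.gr i → f m ∈ N.gr (n + i)) : IsIso M (N.shift n) :=
  isIso_of_gr_eq (f := f.trans (shiftEquiv N n)) (fun p m => congrArg (shiftEquiv N n) (h1 p m))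
    (fun p m => congrArg (shiftEquiv N n) (h2 p m)) h3

lemma isIso_shift_shift (M : GrBimod k) (m n : ℤ) :
    IsIso ((M.shift m).shift n) (M.shift (m + n)) :=
  isIso_of_gr_eq (f := LinearEquiv.refl k M) (fun _ _ => rfl) (fun _ _ => rfl) fun i x hx => by
    change x ∈ M.gr (m + n + i)
    rw [add_assoc]; exact hx

lemma isIso_sum_shift (M N : GrBimod k) (n : ℤ) :
    IsIso ((M.sum N).shift n) ((M.shift n).sum (N.shift n)) :=
  isIso_of_gr_eq (f := LinearEquiv.refl k (M × N)) (fun _ _ => rfl) (fun _ _ => rfl)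
    fun _ _ h => h

lemma isIso_zero_shift (n : ℤ) : IsIso ((zero : GrBimod k).shift n) zero :=
  isIso_of_gr_eq (f := (shiftEquiv zero n).symm) (fun _ _ => rfl) (fun _ _ => rfl)
    fun _ _ h => h

end shift

section sum

variable {M M' N N' P : GrBimod k}

/-- The projection `M ⊕ N → M`. -/
def sumFst (M N : GrBimod k) : M.sum N →ₗ[k] M := LinearMap.fst k M N

/-- The projection `M ⊕ N → N`. -/
def sumSnd (M N : GrBimod k) : M.sum N →ₗ[k] N := LinearMap.snd k M N

/-- The inclusion `M → M ⊕ N`. -/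
def sumInl (M N : GrBimod k) : M →ₗ[k] M.sum N := LinearMap.inl k M N

/-- The inclusion `N → M ⊕ N`. -/
def sumInr (M N : GrBimod k) : N →ₗ[k] M.sum N := LinearMap.inr k M N

lemma sumFst_mem_hom : sumFst M N ∈ hom (M.sum N) M :=
  ⟨fun _ _ => rfl, fun _ _ => rfl, fun _ _ h => h.1⟩

lemma sumSnd_mem_hom : sumSnd M N ∈ hom (M.sum N) N :=
  ⟨fun _ _ => rfl, fun _ _ => rfl, fun _ _ h => h.2⟩

lemma sumInl_mem_hom : sumInl M N ∈ hom M (M.sum N) :=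
  ⟨fun p _ => Prod.ext rfl (map_zero (N.left p)).symm,
    fun p _ => Prod.ext rfl (map_zero (N.right p)).symm, fun i _ h => ⟨h, (N.gr i).zero_mem⟩⟩

lemma sumInr_mem_hom : sumInr M N ∈ hom N (M.sum N) :=
  ⟨fun p _ => Prod.ext (map_zero (M.left p)).symm rfl,
    fun p _ => Prod.ext (map_zero (M.right p)).symm rfl, fun i _ h => ⟨(M.gr i).zero_mem, h⟩⟩

lemma sumFst_sumInl (m : M) : sumFst M N (sumInl M N m) = m := rfl

lemma sumFst_sumInr (n : N) : sumFst M N (sumInr M N n) = 0 := rfl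

lemma sumSnd_sumInl (m : M) : sumSnd M N (sumInl M N m) = 0 := rfl

lemma sumSnd_sumInr (n : N) : sumSnd M N (sumInr M N n) = n := rfl

lemma sumInl_add_sumInr (x : M.sum N) : sumInl M N (sumFst M N x) + sumInr M N (sumSnd M N x) = x :=
  Prod.ext (add_zero _) (zero_add _)

/-- Only the two projections have to be homomorphisms, since the inverse of a bijective homomorphism
is again one. -/
lemma isIso_sum_of {f₁ : P →ₗ[k] M} {f₂ : P →ₗ[k] N} (hf₁ : f₁ ∈ hom P M) (hf₂ : f₂ ∈ hom P N)
    (g₁ : M →ₗ[k] P) (g₂ : N →ₗ[k] P) (h₁₁ : ∀ m, f₁ (g₁ m) = m) (h₁₂ : ∀ n, f₁ (g₂ n) = 0)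
    (h₂₁ : ∀ m, f₂ (g₁ m) = 0) (h₂₂ : ∀ n, f₂ (g₂ n) = n) (h : ∀ x, g₁ (f₁ x) + g₂ (f₂ x) = x) :
    IsIso P (M.sum N) := by
  refine isIso_of_inverse (f := sumInl M N ∘ₗ f₁ + sumInr M N ∘ₗ f₂)
    (g := g₁ ∘ₗ sumFst M N + g₂ ∘ₗ sumSnd M N)
    (add_mem (comp_mem_hom sumInl_mem_hom hf₁) (comp_mem_hom sumInr_mem_hom hf₂))
    (LinearMap.ext fun x => ?_) (LinearMap.ext fun x => ?_)
  · simp only [LinearMap.comp_apply, LinearMap.add_apply, map_add, sumFst_sumInl, sumFst_sumInr,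
      sumSnd_sumInl, sumSnd_sumInr, map_zero, add_zero, zero_add, h, LinearMap.id_apply]
  · simp only [LinearMap.comp_apply, LinearMap.add_apply, map_add, h₁₁, h₁₂, h₂₁, h₂₂, add_zero,
      zero_add, map_zero, sumInl_add_sumInr, LinearMap.id_apply]

lemma IsIso.sum (h : IsIso M M') (h' : IsIso N N') : IsIso (M.sum N) (M'.sum N') := by
  obtain ⟨⟨e, h1, h2, h3⟩⟩ := h
  obtain ⟨⟨e', h1', h2', h3'⟩⟩ := h'
  exact isIso_of_gr_eq (f := e.prodCongr e') (fun p m => Prod.ext (h1 p m.1) (h1' p m.2))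
    (fun p m => Prod.ext (h2 p m.1) (h2' p m.2))
    (fun i m hm => ⟨(h3 i m.1).2 hm.1, (h3' i m.2).2 hm.2⟩)

lemma isIso_sum_comm (M N : GrBimod k) : IsIso (M.sum N) (N.sum M) :=
  isIso_of_gr_eq (f := LinearEquiv.prodComm k M N) (fun _ _ => rfl) (fun _ _ => rfl)
    fun _ _ h => ⟨h.2, h.1⟩

lemma isIso_sum_assoc (M N P : GrBimod k) : IsIso ((M.sum N).sum P) (M.sum (N.sum P)) :=
  isIso_of_gr_eq (f := LinearEquiv.prodAssoc k M N P) (fun _ _ => rfl) (fun _ _ => rfl)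
    fun _ _ h => ⟨h.1.1, h.1.2, h.2⟩

lemma isIso_zero_sum (M : GrBimod k) : IsIso (GrBimod.zero.sum M) M :=
  (isIso_sum_comm _ _).trans (isIso_sum_zero M).symm

end sum

/-! ### Tensor products -/

section tensor

variable {A B : Subalgebra k (Poly k)} {M M' N N' P Q : GrBimod k}

/-- The bilinear map `(m, n) ↦ m ⊗ n`, with values in the graded bimodule `M ⊗_A N`. -/
noncomputable def tm (hA : IsGradedSubalg A) : M →ₗ[k] N →ₗ[k] tensorOver A hA M N :=
  tmkBilin A M N

/-- The linear map out of `M ⊗_A N` given by a balanced bilinear map. -/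
noncomputable def tlift (hA : IsGradedSubalg A) {V : Type*} [AddCommGroup V] [Module k V]
    (f : M →ₗ[k] N →ₗ[k] V) (hf : ∀ a ∈ A, ∀ m n, f (M.right a m) n = f m (N.left a n)) :
    tensorOver A hA M N →ₗ[k] V :=
  tensorLift f hf

variable (hA : IsGradedSubalg A) (hB : IsGradedSubalg B)

lemma tlift_tm {V : Type*} [AddCommGroup V] [Module k V] (f : M →ₗ[k] N →ₗ[k] V)
    (hf : ∀ a ∈ A, ∀ m n, f (M.right a m) n = f m (N.left a n)) (m : M) (n : N) :
    tlift hA f hf (tm hA m n) = f m n :=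
  tensorLift_tmk f hf m n

lemma tm_left (p : Poly k) (m : M) (n : N) :
    (tensorOver A hA M N).left p (tm hA m n) = tm hA (M.left p m) n :=
  tensorLeft_tmk p m n

lemma tm_right (p : Poly k) (m : M) (n : N) :
    (tensorOver A hA M N).right p (tm hA m n) = tm hA m (N.right p n) :=
  tensorRight_tmk p m n

variable {hA hB}

lemma tm_balanced {a : Poly k} (ha : a ∈ A) (m : M) (n : N) :
    tm hA (M.right a m) n = tm hA m (N.left a n) :=
  tmk_balanced ha m n

lemma tm_mem_gr {i j d : ℤ} (hd : i + j = d) {m : M} (hm : m ∈ M.gr i) {n : N}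
    (hn : n ∈ N.gr j) : tm hA m n ∈ (tensorOver A hA M N).gr d :=
  show tmk A m n ∈ tensorGr A M N d from Submodule.subset_span ⟨i, j, hd, m, hm, n, hn, rfl⟩

/-- No separate case for zero is needed, because 0 = 0 ⊗ 0. -/
lemma tm_induction {motive : tensorOver A hA M N → Prop} (tm : ∀ m n, motive (tm hA m n))
    (add : ∀ x y, motive x → motive y → motive (x + y)) (t : tensorOver A hA M N) : motive t := by
  obtain ⟨t, rfl⟩ := Submodule.mkQ_surjective _ t
  induction t using TensorProduct.induction_on with
  | zero =>
    have h := tm 0 0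
    rw [LinearMap.map_zero] at h
    exact h
  | tmul m n => exact tm m n
  | add x y hx hy => exact add _ _ hx hy

lemma tm_ext {V : Type*} [AddCommGroup V] [Module k V] {f g : tensorOver A hA M N →ₗ[k] V}
    (h : ∀ m n, f (tm hA m n) = g (tm hA m n)) : f = g :=
  LinearMap.ext fun t => tm_induction (motive := fun t => f t = g t) h
    (fun x y hx hy => by rw [map_add, map_add, hx, hy]) t

lemma gr_induction {d : ℤ} {S : Submodule k (tensorOver A hA M N)}
    (h : ∀ i j, i + j = d → ∀ m ∈ M.gr i, ∀ n ∈ N.gr j, tm hA m n ∈ S) :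
    (tensorOver A hA M N).gr d ≤ S := by
  refine Submodule.span_le.2 ?_
  rintro _ ⟨i, j, hij, m, hm, n, hn, rfl⟩
  exact h i j hij m hm n hn

lemma mem_hom_tensorOver {f : tensorOver A hA M N →ₗ[k] Q}
    (h1 : ∀ p m n, f (tm hA (M.left p m) n) = Q.left p (f (tm hA m n)))
    (h2 : ∀ p m n, f (tm hA m (N.right p n)) = Q.right p (f (tm hA m n)))
    (h3 : ∀ i j, ∀ m ∈ M.gr i, ∀ n ∈ N.gr j, f (tm hA m n) ∈ Q.gr (i + j)) :
    f ∈ hom (tensorOver A hA M N) Q := by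
  refine ⟨fun p t => ?_, fun p t => ?_, fun i t ht => ?_⟩
  · suffices h : f ∘ₗ (tensorOver A hA M N).left p = Q.left p ∘ₗ f from LinearMap.congr_fun h t
    refine tm_ext fun m n => ?_
    rw [LinearMap.comp_apply, LinearMap.comp_apply, tm_left, h1]
  · suffices h : f ∘ₗ (tensorOver A hA M N).right p = Q.right p ∘ₗ f from LinearMap.congr_fun h t
    refine tm_ext fun m n => ?_
    rw [LinearMap.comp_apply, LinearMap.comp_apply, tm_right, h2]
  · have h : (tensorOver A hA M N).gr i ≤ (Q.gr i).comap f :=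
      gr_induction fun a b hab m hm n hn => hab ▸ h3 a b m hm n hn
    exact h ht

variable (hA) in
/-- The map `f ⊗ g : M ⊗_A N → M' ⊗_A N'`. -/
noncomputable def homTensor (f : M →ₗ[k] M') (g : N →ₗ[k] N')
    (hf : ∀ p m, f (M.right p m) = M'.right p (f m))
    (hg : ∀ p n, g (N.left p n) = N'.left p (g n)) :
    tensorOver A hA M N →ₗ[k] tensorOver A hA M' N' :=
  tlift hA ((tm hA).compl₁₂ f g) fun a ha m n => by
    rw [LinearMap.compl₁₂_apply, LinearMap.compl₁₂_apply, hf, hg, tm_balanced ha]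

lemma homTensor_tm {f : M →ₗ[k] M'} {g : N →ₗ[k] N'}
    (hf : ∀ p m, f (M.right p m) = M'.right p (f m))
    (hg : ∀ p n, g (N.left p n) = N'.left p (g n)) (m : M) (n : N) :
    homTensor hA f g hf hg (tm hA m n) = tm hA (f m) (g n) :=
  tlift_tm _ _ _ _ _

lemma homTensor_mem_hom {f : M →ₗ[k] M'} {g : N →ₗ[k] N'} (hf : f ∈ hom M M') (hg : g ∈ hom N N') :
    homTensor hA f g hf.2.1 hg.1 ∈ hom (tensorOver A hA M N) (tensorOver A hA M' N') := by
  refine mem_hom_tensorOver (fun p m n => ?_) (fun p m n => ?_) fun i j m hm n hn => ?_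
  · rw [homTensor_tm, homTensor_tm, hf.1, tm_left]
  · rw [homTensor_tm, homTensor_tm, hg.2.1, tm_right]
  · rw [homTensor_tm]
    exact tm_mem_gr rfl (hf.2.2 i m hm) (hg.2.2 j n hn)

lemma IsIso.tensorOver (h : IsIso M M') (h' : IsIso N N') :
    IsIso (tensorOver A hA M N) (tensorOver A hA M' N') := by
  obtain ⟨f, hf, f', hf', h1, h2⟩ := h.exists_hom
  obtain ⟨g, hg, g', hg', h3, h4⟩ := h'.exists_hom
  refine isIso_of_inverse (homTensor_mem_hom hf hg) (g := homTensor hA f' g' hf'.2.1 hg'.1)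
    (tm_ext fun m n => ?_) (tm_ext fun m n => ?_)
  · rw [LinearMap.comp_apply, homTensor_tm, homTensor_tm]
    exact congrArg₂ (tm hA · ·) (LinearMap.congr_fun h1 m) (LinearMap.congr_fun h3 n)
  · rw [LinearMap.comp_apply, homTensor_tm, homTensor_tm]
    exact congrArg₂ (tm hA · ·) (LinearMap.congr_fun h2 m) (LinearMap.congr_fun h4 n)

lemma isIso_tensorOver_of_inverse {f : GrBimod.tensorOver A hA M N →ₗ[k] Q}
    (hf : f ∈ hom (GrBimod.tensorOver A hA M N) Q) (g : Q →ₗ[k] GrBimod.tensorOver A hA M N)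
    (h1 : ∀ m n, g (f (tm hA m n)) = tm hA m n) (h2 : ∀ q, f (g q) = q) :
    IsIso (GrBimod.tensorOver A hA M N) Q :=
  isIso_of_inverse hf (tm_ext h1) (LinearMap.ext h2)

variable (hA hB)

/-- The map is m ⊗ x ↦ m ⊗ x, and only the count of degrees changes. -/
lemma isIso_shift_tensorOver (M N : GrBimod k) (n : ℤ) :
    IsIso (GrBimod.tensorOver A hA (M.shift n) N) ((GrBimod.tensorOver A hA M N).shift n) := by
  refine isIso_shift_of_equiv (n := n) (LinearEquiv.ofLinearMap
    (homTensor hA _ _ (shiftEquiv_symm_right n) id_left)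
    (homTensor hA _ _ (shiftEquiv_right n) id_left)
    (tm_ext fun m x => ?_) (tm_ext fun m x => ?_)) (fun p t => ?_) (fun p t => ?_) fun i t ht => ?_
  · rw [LinearMap.comp_apply, homTensor_tm, homTensor_tm]; rfl
  · rw [LinearMap.comp_apply, homTensor_tm, homTensor_tm]; rfl
  · rw [LinearEquiv.coe_ofLinearMap]
    induction t using tm_induction with
    | tm m x => rw [tm_left, homTensor_tm, homTensor_tm, tm_left]; rfl
    | add x y hx hy => simp only [map_add, hx, hy]
  · rw [LinearEquiv.coe_ofLinearMap]
    induction t using tm_induction with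
    | tm m x => rw [tm_right, homTensor_tm, homTensor_tm, tm_right]; rfl
    | add x y hx hy => simp only [map_add, hx, hy]
  · refine (gr_induction (S := ((GrBimod.tensorOver A hA M N).gr (n + i)).comap
      (homTensor hA _ _ (shiftEquiv_symm_right n) id_left)) fun a b hab m hm x hx => ?_) ht
    rw [Submodule.mem_comap, homTensor_tm]
    exact tm_mem_gr (by rw [add_assoc, hab])
      ((shiftEquiv_mem_gr (m := (shiftEquiv M n).symm m)).1 hm) hx

lemma isIso_tensorOver_shift (M N : GrBimod k) (n : ℤ) :
    IsIso (GrBimod.tensorOver A hA M (N.shift n)) ((GrBimod.tensorOver A hA M N).shift n) := by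
  refine isIso_shift_of_equiv (n := n) (LinearEquiv.ofLinearMap
    (homTensor hA _ _ id_right (shiftEquiv_symm_left n))
    (homTensor hA _ _ id_right (shiftEquiv_left n))
    (tm_ext fun m x => ?_) (tm_ext fun m x => ?_)) (fun p t => ?_) (fun p t => ?_) fun i t ht => ?_
  · rw [LinearMap.comp_apply, homTensor_tm, homTensor_tm]; rfl
  · rw [LinearMap.comp_apply, homTensor_tm, homTensor_tm]; rfl
  · rw [LinearEquiv.coe_ofLinearMap]
    induction t using tm_induction with
    | tm m x => rw [tm_left, homTensor_tm, homTensor_tm, tm_left]; rfl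
    | add x y hx hy => simp only [map_add, hx, hy]
  · rw [LinearEquiv.coe_ofLinearMap]
    induction t using tm_induction with
    | tm m x => rw [tm_right, homTensor_tm, homTensor_tm, tm_right]; rfl
    | add x y hx hy => simp only [map_add, hx, hy]
  · refine (gr_induction (S := ((GrBimod.tensorOver A hA M N).gr (n + i)).comap
      (homTensor hA _ _ id_right (shiftEquiv_symm_left n))) fun a b hab m hm x hx => ?_) ht
    rw [Submodule.mem_comap, homTensor_tm]
    exact tm_mem_gr (by rw [add_left_comm, hab]) hm
      ((shiftEquiv_mem_gr (m := (shiftEquiv N n).symm x)).1 hx)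

lemma isIso_sum_tensorOver (M M' N : GrBimod k) :
    IsIso (GrBimod.tensorOver A hA (M.sum M') N)
      ((GrBimod.tensorOver A hA M N).sum (GrBimod.tensorOver A hA M' N)) := by
  refine isIso_sum_of (homTensor_mem_hom sumFst_mem_hom id_mem_hom)
    (homTensor_mem_hom sumSnd_mem_hom id_mem_hom) (homTensor hA _ _ sumInl_mem_hom.2.1 id_mem_hom.1)
    (homTensor hA _ _ sumInr_mem_hom.2.1 id_mem_hom.1) ?_ ?_ ?_ ?_ ?_ <;> intro t <;>
    induction t using tm_induction with
    | tm m n =>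
      simp only [homTensor_tm, sumFst_sumInl, sumFst_sumInr, sumSnd_sumInl, sumSnd_sumInr,
        LinearMap.id_apply, LinearMap.map_zero₂, ← LinearMap.map_add₂, sumInl_add_sumInr]
    | add x y hx hy =>
      simp only [map_add, hx, hy, add_zero, add_add_add_comm _ _ (homTensor _ _ _ _ _ _) _]
lemma isIso_tensorOver_sum (M N N' : GrBimod k) :
    IsIso (GrBimod.tensorOver A hA M (N.sum N'))
      ((GrBimod.tensorOver A hA M N).sum (GrBimod.tensorOver A hA M N')) := by
  refine isIso_sum_of (homTensor_mem_hom id_mem_hom sumFst_mem_hom)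
    (homTensor_mem_hom id_mem_hom sumSnd_mem_hom) (homTensor hA _ _ id_mem_hom.2.1 sumInl_mem_hom.1)
    (homTensor hA _ _ id_mem_hom.2.1 sumInr_mem_hom.1) ?_ ?_ ?_ ?_ ?_ <;> intro t <;>
    induction t using tm_induction with
    | tm m n =>
      simp only [homTensor_tm, sumFst_sumInl, sumFst_sumInr, sumSnd_sumInl, sumSnd_sumInr,
        LinearMap.id_apply, map_zero, ← map_add, sumInl_add_sumInr]
    | add x y hx hy =>
      simp only [map_add, hx, hy, add_zero, add_add_add_comm _ _ (homTensor _ _ _ _ _ _) _]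

/-- The map `N ⊗_B P → (M ⊗_A N) ⊗_B P`, `n ⊗ p ↦ (m ⊗ n) ⊗ p`. -/
noncomputable def assocInvAux (N P : GrBimod k) (m : M) : GrBimod.tensorOver B hB N P →ₗ[k]
    GrBimod.tensorOver B hB (GrBimod.tensorOver A hA M N) P :=
  tlift hB (tm hB ∘ₗ tm hA m) fun b hb n p => by
    rw [LinearMap.comp_apply, LinearMap.comp_apply, ← tm_right, tm_balanced hb]

lemma assocInvAux_tm (m : M) (n : N) (p : P) :
    assocInvAux hA hB N P m (tm hB n p) = tm hB (tm hA m n) p := tlift_tm _ _ _ _ _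

/-- The associator `M ⊗_A (N ⊗_B P) → (M ⊗_A N) ⊗_B P`. -/
noncomputable def assocInv (M N P : GrBimod k) :
    GrBimod.tensorOver A hA M (GrBimod.tensorOver B hB N P) →ₗ[k]
      GrBimod.tensorOver B hB (GrBimod.tensorOver A hA M N) P :=
  tlift hA
    { toFun := assocInvAux hA hB N P
      map_add' := fun m m' => tm_ext fun n p => by
        simp only [LinearMap.add_apply, assocInvAux_tm, map_add]
      map_smul' := fun c m => tm_ext fun n p => by
        simp only [LinearMap.smul_apply, assocInvAux_tm, map_smul,
          RingHom.id_apply] }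
    fun a ha m t => by
      simp only [LinearMap.coe_mk, AddHom.coe_mk]
      induction t using tm_induction with
      | tm n p => rw [tm_left, assocInvAux_tm, assocInvAux_tm, tm_balanced ha]
      | add x y hx hy => simp only [map_add, hx, hy]

lemma assocInv_tm (m : M) (n : N) (p : P) :
    assocInv hA hB M N P (tm hA m (tm hB n p)) = tm hB (tm hA m n) p :=
  (tlift_tm _ _ _ _ _).trans (assocInvAux_tm _ _ _ _ _)

/-- The map `M ⊗_A N → M ⊗_A (N ⊗_B P)`, `m ⊗ n ↦ m ⊗ (n ⊗ p)`. -/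
noncomputable def assocHomAux (M N : GrBimod k) (p : P) : GrBimod.tensorOver A hA M N →ₗ[k]
    GrBimod.tensorOver A hA M (GrBimod.tensorOver B hB N P) :=
  tlift hA ((tm hA).compl₂ ((tm hB).flip p)) fun a ha m n => by
    rw [LinearMap.compl₂_apply, LinearMap.compl₂_apply, tm_balanced ha, LinearMap.flip_apply,
      LinearMap.flip_apply, tm_left]

lemma assocHomAux_tm (m : M) (n : N) (p : P) :
    assocHomAux hA hB M N p (tm hA m n) = tm hA m (tm hB n p) := tlift_tm _ _ _ _ _

/-- The associator `(M ⊗_A N) ⊗_B P → M ⊗_A (N ⊗_B P)`. -/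
noncomputable def assocHom (M N P : GrBimod k) :
    GrBimod.tensorOver B hB (GrBimod.tensorOver A hA M N) P →ₗ[k]
      GrBimod.tensorOver A hA M (GrBimod.tensorOver B hB N P) :=
  tlift hB (LinearMap.flip
    { toFun := assocHomAux hA hB M N
      map_add' := fun p p' => tm_ext fun m n => by
        simp only [LinearMap.add_apply, assocHomAux_tm, map_add]
      map_smul' := fun c p => tm_ext fun m n => by
        simp only [LinearMap.smul_apply, assocHomAux_tm, map_smul, RingHom.id_apply] })
    fun b hb t p => by
      simp only [LinearMap.flip_apply, LinearMap.coe_mk, AddHom.coe_mk]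
      induction t using tm_induction with
      | tm m n => rw [tm_right, assocHomAux_tm, assocHomAux_tm, tm_balanced hb]
      | add x y hx hy => simp only [map_add, hx, hy]

lemma assocHom_tm (m : M) (n : N) (p : P) :
    assocHom hA hB M N P (tm hB (tm hA m n) p) = tm hA m (tm hB n p) :=
  (tlift_tm _ _ _ _ _).trans (assocHomAux_tm _ _ _ _ _)

/-- Two different subalgebras are allowed because products of induced bimodules mix ⊗ over R with ⊗
over invariants. -/
lemma isIso_assoc (M N P : GrBimod k) :
    IsIso (GrBimod.tensorOver B hB (GrBimod.tensorOver A hA M N) P)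
      (GrBimod.tensorOver A hA M (GrBimod.tensorOver B hB N P)) := by
  refine isIso_tensorOver_of_inverse (f := assocHom hA hB M N P)
    (mem_hom_tensorOver (fun q t p => ?_) (fun q t p => ?_) fun i j t ht p hp => ?_)
    (assocInv hA hB M N P) (fun t p => ?_) fun t => ?_
  · induction t using tm_induction with
    | tm m n => rw [tm_left, assocHom_tm, assocHom_tm, tm_left]
    | add x y hx hy => simp only [map_add, LinearMap.add_apply, hx, hy]
  · induction t using tm_induction with
    | tm m n => rw [assocHom_tm, assocHom_tm, tm_right, tm_right]
    | add x y hx hy => simp only [map_add, LinearMap.add_apply, hx, hy]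
  · have h : (GrBimod.tensorOver A hA M N).gr i ≤
        ((GrBimod.tensorOver A hA M (GrBimod.tensorOver B hB N P)).gr (i + j)).comap
          (assocHom hA hB M N P ∘ₗ (tm hB).flip p) := by
      refine gr_induction fun a b hab m hm n hn => ?_
      rw [Submodule.mem_comap, LinearMap.comp_apply, LinearMap.flip_apply, assocHom_tm]
      exact tm_mem_gr (by rw [← hab, add_assoc]) hm (tm_mem_gr rfl hn hp)
    exact h ht
  · induction t using tm_induction with
    | tm m n => rw [assocHom_tm, assocInv_tm]
    | add x y hx hy => simp only [map_add, LinearMap.add_apply, hx, hy]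
  · induction t using tm_induction with
    | tm m t =>
      induction t using tm_induction with
      | tm n p => rw [assocInv_tm, assocHom_tm]
      | add x y hx hy => simp only [map_add, hx, hy]
    | add x y hx hy => simp only [map_add, hx, hy]

variable (k) in
/-- The identity `R → R`, with values in the bimodule `R`. -/
noncomputable def toReg : Poly k ≃ₗ[k] regular k := LinearEquiv.refl k (Poly k)

lemma reg_left (p q : Poly k) : (regular k).left p (toReg k q) = toReg k (p * q) := rfl

lemma reg_right (p q : Poly k) : (regular k).right p (toReg k q) = toReg k (p * q) := rfl

lemma toReg_mem_gr {p : Poly k} {i : ℤ} : toReg k p ∈ (regular k).gr i ↔ p ∈ polyGr k i := Iff.rfl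

lemma one_mem_polyGr : (1 : Poly k) ∈ polyGr k 0 :=
  MvPolynomial.isWeightedHomogeneous_one k _

lemma isIso_regular_tensor (M : GrBimod k) : IsIso ((regular k).tensor M) M := by
  refine isIso_tensorOver_of_inverse (hA := isGradedSubalg_top)
    (f := tlift isGradedSubalg_top (M.left.toLinearMap ∘ₗ (toReg k).symm.toLinearMap)
      fun a _ r m => ?_)
    (mem_hom_tensorOver (fun p r m => ?_) (fun p r m => ?_) fun i j r hr m hm => ?_)
    (tm isGradedSubalg_top (toReg k 1)) (fun r m => ?_) fun m => ?_
  · obtain ⟨r, rfl⟩ := (toReg k).surjective r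
    simp [reg_right, mul_comm a r]
  · obtain ⟨r, rfl⟩ := (toReg k).surjective r
    simp [reg_left, tlift_tm]
  · obtain ⟨r, rfl⟩ := (toReg k).surjective r
    simp [tlift_tm, M.comm]
  · obtain ⟨r, rfl⟩ := (toReg k).surjective r
    rw [tlift_tm]
    exact M.left_mem (toReg_mem_gr.1 hr) hm
  · obtain ⟨r, rfl⟩ := (toReg k).surjective r
    rw [tlift_tm]
    refine (tm_balanced (a := r) Algebra.mem_top _ _).symm.trans ?_
    rw [reg_right, mul_one]
  · simp [tlift_tm]

lemma isIso_tensor_regular (M : GrBimod k) : IsIso (M.tensor (regular k)) M := by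
  refine isIso_tensorOver_of_inverse (hA := isGradedSubalg_top)
    (f := tlift isGradedSubalg_top ((M.right.toLinearMap ∘ₗ (toReg k).symm.toLinearMap).flip)
      fun a _ m r => ?_)
    (mem_hom_tensorOver (fun p m r => ?_) (fun p m r => ?_) fun i j m hm r hr => ?_)
    ((tm isGradedSubalg_top).flip (toReg k 1)) (fun m r => ?_) fun m => ?_
  · obtain ⟨r, rfl⟩ := (toReg k).surjective r
    simp [reg_left, mul_comm a r]
  · obtain ⟨r, rfl⟩ := (toReg k).surjective r
    simp [tlift_tm, M.comm]
  · obtain ⟨r, rfl⟩ := (toReg k).surjective r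
    simp [reg_right, tlift_tm]
  · obtain ⟨r, rfl⟩ := (toReg k).surjective r
    rw [tlift_tm, add_comm]
    exact M.right_mem (toReg_mem_gr.1 hr) hm
  · obtain ⟨r, rfl⟩ := (toReg k).surjective r
    rw [tlift_tm]
    refine (tm_balanced (a := r) Algebra.mem_top _ _).trans ?_
    rw [reg_left, mul_one]
  · simp [tlift_tm]

end tensor

end GrBimod

end SoergelS3

namespace SoergelS3

open GrBimod MvPolynomial

variable {k : Type u} [Field k]

/-! ## The polynomial ring over its invariants -/

lemma polyGr_mul {p q : Poly k} {i j : ℤ} (hp : p ∈ polyGr k i) (hq : q ∈ polyGr k j) :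
    p * q ∈ polyGr k (i + j) :=
  IsWeightedHomogeneous.mul hp hq

lemma X_mem_polyGr (n : Fin 3) : (X n : Poly k) ∈ polyGr k 2 := isWeightedHomogeneous_X _ _ _

lemma X_pow_mem_polyGr (n : Fin 3) (a : ℕ) : (X n ^ a : Poly k) ∈ polyGr k (2 * a) := by
  have := IsWeightedHomogeneous.pow (isWeightedHomogeneous_X k (fun _ : Fin 3 => (2 : ℤ)) n) a
  rwa [nsmul_eq_mul, mul_comm] at this

lemma rename_mul_apply (σ τ : S3) (p : Poly k) : rename (σ * τ) p = rename σ (rename τ p) := by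
  rw [rename_rename]; rfl

lemma proj_regular (d : ℤ) (p : Poly k) : (regular k).proj d (toReg k p) =
    toReg k (weightedHomogeneousComponent (fun _ : Fin 3 => (2 : ℤ)) d p) := by
  suffices h : (regular k).proj d ∘ₗ (toReg k).toLinearMap = (toReg k).toLinearMap ∘ₗ
      weightedHomogeneousComponent (fun _ : Fin 3 => (2 : ℤ)) d from LinearMap.congr_fun h p
  refine GrBimod.hom_ext (M := regular k) fun i m hm => ?_
  obtain ⟨m, rfl⟩ := (toReg k).surjective m
  refine ((regular k).proj_apply hm d).trans ?_
  change _ = toReg k (weightedHomogeneousComponent _ d m)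
  have hm' : IsWeightedHomogeneous (fun _ : Fin 3 => (2 : ℤ)) m i := hm
  split_ifs with h
  · rw [← h, hm'.weightedHomogeneousComponent_same]
  · rw [hm'.weightedHomogeneousComponent_ne _ (Ne.symm h), map_zero]

/-- This is `proj_left` read in the regular bimodule. -/
lemma weightedHomogeneousComponent_mul {e : Poly k} {i : ℤ} (he : e ∈ polyGr k i) (d : ℤ)
    (c : Poly k) : weightedHomogeneousComponent (fun _ : Fin 3 => (2 : ℤ)) d (e * c) =
      e * weightedHomogeneousComponent (fun _ : Fin 3 => (2 : ℤ)) (d - i) c := by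
  have h := (regular k).proj_left he d (toReg k c)
  rw [reg_left, proj_regular, proj_regular, reg_left] at h
  exact (toReg k).injective h

/-- A finite homogeneous basis of the polynomial ring over a subalgebra `A`, with its coefficient
functions. -/
structure GrBasis (A : Subalgebra k (Poly k)) (ι : Type) [Fintype ι] where
  /-- the basis elements -/
  e : ι → Poly k
  /-- their degrees -/
  deg : ι → ℤ
  /-- the coefficients -/
  coeff : ι → Poly k →ₗ[k] Poly k
  e_mem : ∀ j, e j ∈ polyGr k (deg j)
  coeff_mem : ∀ j p, coeff j p ∈ A
  sum_coeff : ∀ p, ∑ j, coeff j p * e j = p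
  unique : ∀ c : ι → Poly k, (∀ j, c j ∈ A) → ∑ j, c j * e j = 0 → ∀ j, c j = 0

namespace GrBasis

variable {A : Subalgebra k (Poly k)} {ι : Type} [Fintype ι]

lemma coeff_eq (b : GrBasis A ι) {p : Poly k} {c : ι → Poly k} (hc : ∀ j, c j ∈ A)
    (h : ∑ j, c j * b.e j = p) (j : ι) : b.coeff j p = c j := by
  refine sub_eq_zero.1 (b.unique (fun j => b.coeff j p - c j)
    (fun j => A.sub_mem (b.coeff_mem j p) (hc j)) ?_ j)
  simp only [sub_mul, Finset.sum_sub_distrib, b.sum_coeff, h, sub_self]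

lemma coeff_mul (b : GrBasis A ι) {a : Poly k} (ha : a ∈ A) (p : Poly k) (j : ι) :
    b.coeff j (a * p) = a * b.coeff j p := by
  refine b.coeff_eq (c := fun j => a * b.coeff j p) (fun j => A.mul_mem ha (b.coeff_mem j p)) ?_ j
  simp only [mul_assoc, ← Finset.mul_sum, b.sum_coeff]

lemma coeff_e [DecidableEq ι] (b : GrBasis A ι) (i j : ι) :
    b.coeff i (b.e j) = if i = j then 1 else 0 := by
  refine b.coeff_eq (c := fun i => if i = j then 1 else 0) (fun i => ?_) ?_ i
  · split_ifs
    · exact A.one_mem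
    · exact A.zero_mem
  · simp

/-- Taking the component of degree d in p = ∑ c_j e_j replaces c_j by its component of degree d −
deg e_j. That component still lies in A because A is graded, so uniqueness of coefficients
identifies it with c_j. -/
lemma coeff_mem_polyGr (hA : IsGradedSubalg A) (b : GrBasis A ι) {p : Poly k} {d : ℤ}
    (hp : p ∈ polyGr k d) (j : ι) : b.coeff j p ∈ polyGr k (d - b.deg j) := by
  have h := b.coeff_eq (p := p) (c := fun j =>
    weightedHomogeneousComponent (fun _ : Fin 3 => (2 : ℤ)) (d - b.deg j) (b.coeff j p))
    (fun j => hA _ (b.coeff_mem j p) _) ?_ j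
  · rw [h]; exact weightedHomogeneousComponent_mem _ _ _
  · have h := congrArg (weightedHomogeneousComponent (fun _ : Fin 3 => (2 : ℤ)) d) (b.sum_coeff p)
    rw [map_sum, IsWeightedHomogeneous.weightedHomogeneousComponent_same hp] at h
    refine Eq.trans (Finset.sum_congr rfl fun j _ => ?_) h
    rw [mul_comm (b.coeff j p), weightedHomogeneousComponent_mul (b.e_mem j), mul_comm]

/-- A basis from elements that span and are independent. -/
noncomputable def mk' (e : ι → Poly k) (deg : ι → ℤ) (e_mem : ∀ j, e j ∈ polyGr k (deg j))
    (span : ∀ p : Poly k, p ∈ Submodule.span A (Set.range e))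
    (unique : ∀ c : ι → Poly k, (∀ j, c j ∈ A) → ∑ j, c j * e j = 0 → ∀ j, c j = 0) :
    GrBasis A ι :=
  have ex (p : Poly k) : ∃ c : ι → Poly k, (∀ j, c j ∈ A) ∧ ∑ j, c j * e j = p := by
    obtain ⟨c, hc⟩ := (Submodule.mem_span_range_iff_exists_fun A).1 (span p)
    exact ⟨fun j => c j, fun j => (c j).2, hc⟩
  -- Uniqueness makes the chosen coefficients additive and k-linear in p.
  have un (p : Poly k) (c : ι → Poly k) (hc : ∀ j, c j ∈ A) (h : ∑ j, c j * e j = p) :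
      (ex p).choose = c := by
    obtain ⟨h1, h2⟩ := (ex p).choose_spec
    refine funext fun j => sub_eq_zero.1 (unique ((ex p).choose - c) (fun j => A.sub_mem (h1 j) (hc j)) ?_ j)
    simp only [Pi.sub_apply, sub_mul, Finset.sum_sub_distrib, h, h2, sub_self]
  { e := e
    deg := deg
    coeff := fun j =>
      { toFun := fun p => (ex p).choose j
        map_add' := fun p q => by
          refine congrFun (un (p + q) ((ex p).choose + (ex q).choose)
            (fun j => A.add_mem ((ex p).choose_spec.1 j) ((ex q).choose_spec.1 j)) ?_) j
          simp only [Pi.add_apply, add_mul, Finset.sum_add_distrib, (ex p).choose_spec.2,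
            (ex q).choose_spec.2]
        map_smul' := fun a p => by
          refine congrFun (un (a • p) (a • (ex p).choose)
            (fun j => A.smul_mem ((ex p).choose_spec.1 j) a) ?_) j
          simp only [Pi.smul_apply, smul_mul_assoc, ← Finset.smul_sum, (ex p).choose_spec.2] }
    e_mem := e_mem
    coeff_mem := fun j p => (ex p).choose_spec.1 j
    sum_coeff := fun p => (ex p).choose_spec.2
    unique := unique }

end GrBasis

lemma mem_of_mul_X_mem {A : Subalgebra k (Poly k)} (S : Submodule A (Poly k)) (h1 : (1 : Poly k) ∈ S)
    (hX : ∀ n, ∀ p ∈ S, X n * p ∈ S) (p : Poly k) : p ∈ S := by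
  induction p using MvPolynomial.induction_on with
  | C a =>
    have := S.smul_mem (algebraMap k A a) h1
    rwa [Subalgebra.smul_def, smul_eq_mul, mul_one] at this
  | add p q hp hq => exact S.add_mem hp hq
  | mul_X p n hp => rw [mul_comm]; exact hX n p hp

lemma mul_mem_span_range {A : Subalgebra k (Poly k)} {ι : Type} {e : ι → Poly k} (a : Poly k)
    (h : ∀ j, a * e j ∈ Submodule.span A (Set.range e)) {p : Poly k}
    (hp : p ∈ Submodule.span A (Set.range e)) : a * p ∈ Submodule.span A (Set.range e) := by
  induction hp using Submodule.span_induction with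
  | mem p hp => obtain ⟨j, rfl⟩ := hp; exact h j
  | zero => simp
  | add p q _ _ hp hq => rw [mul_add]; exact add_mem hp hq
  | smul c p _ hp =>
    rw [mul_smul_comm]
    exact Submodule.smul_mem _ c hp

lemma mul_mem_submodule {A : Subalgebra k (Poly k)} (S : Submodule A (Poly k)) {a p : Poly k}
    (ha : a ∈ A) (hp : p ∈ S) : a * p ∈ S :=
  S.smul_mem ⟨a, ha⟩ hp

/-! ### The invariants of a simple reflection -/

/-- The index of the variable fixed by the simple reflection `i`. -/
def outer (i : Fin 2) : Fin 3 := ![2, 0] i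

lemma simpleRefl_outer (i : Fin 2) : simpleRefl i (outer i) = outer i := by revert i; decide

lemma simpleRefl_one (i : Fin 2) : simpleRefl i 1 = outer i.rev := by revert i; decide

lemma simpleRefl_outer_rev (i : Fin 2) : simpleRefl i (outer i.rev) = 1 := by revert i; decide

lemma outer_cases (i : Fin 2) (n : Fin 3) : n = outer i ∨ n = outer i.rev ∨ n = 1 := by
  revert i n; decide

lemma outer_rev_ne_one (i : Fin 2) : outer i.rev ≠ 1 := by revert i; decide

lemma mem_invariants_singleton {i : Fin 2} {p : Poly k} :
    p ∈ invariants k {i} ↔ rename (simpleRefl i) p = p :=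
  ⟨fun h => h i rfl, fun h j hj => by rw [Set.mem_singleton_iff.1 hj]; exact h⟩

lemma X_outer_mem (i : Fin 2) : (X (outer i) : Poly k) ∈ invariants k {i} := by
  rw [mem_invariants_singleton, rename_X, simpleRefl_outer]

lemma X_add_X_mem (i : Fin 2) : (X 1 + X (outer i.rev) : Poly k) ∈ invariants k {i} := by
  rw [mem_invariants_singleton, map_add, rename_X, rename_X, simpleRefl_one, simpleRefl_outer_rev,
    add_comm]

lemma X_mul_X_mem (i : Fin 2) : (X 1 * X (outer i.rev) : Poly k) ∈ invariants k {i} := by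
  rw [mem_invariants_singleton, map_mul, rename_X, rename_X, simpleRefl_one, simpleRefl_outer_rev,
    mul_comm]

/-- Vandermonde for two points. -/
lemma eq_zero_of_add_mul_eq_zero {a b x y : Poly k} (hxy : x ≠ y) (h1 : a + b * x = 0)
    (h2 : a + b * y = 0) : a = 0 ∧ b = 0 := by
  have hb : b = 0 := by
    have h : b * (x - y) = 0 := by linear_combination h1 - h2
    exact (mul_eq_zero.1 h).resolve_right (sub_ne_zero.2 hxy)
  refine ⟨?_, hb⟩
  rw [hb, zero_mul, add_zero] at h1
  exact h1

variable (k) in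
/-- The polynomial ring is free over the invariants of a simple reflection, with basis `1, y`. -/
noncomputable def simpleBasis (i : Fin 2) : GrBasis (invariants k {i}) (Fin 2) :=
  GrBasis.mk' ![1, X 1] ![0, 2] (by
    intro j
    fin_cases j
    · exact isWeightedHomogeneous_one k _
    · exact X_mem_polyGr 1) (by
    set e : Fin 2 → Poly k := ![1, X 1] with he
    set S := Submodule.span (invariants k {i}) (Set.range e) with hS
    have h0 : (1 : Poly k) ∈ S := Submodule.subset_span ⟨0, rfl⟩
    have h1 : (X 1 : Poly k) ∈ S := Submodule.subset_span ⟨1, rfl⟩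
    have hy : ∀ p ∈ S, X 1 * p ∈ S := by
      refine fun p hp => mul_mem_span_range (X 1) (fun j => ?_) hp
      fin_cases j
      · change X 1 * 1 ∈ S
        rwa [mul_one]
      -- y is a root of T² − (y + y')T + y y', whose coefficients are invariant; here y' is the
      -- variable exchanged with y.
      · have : (X 1 * X 1 : Poly k) = (X 1 + X (outer i.rev)) * X 1 - (X 1 * X (outer i.rev)) * 1 := by
          ring
        change X 1 * X 1 ∈ S
        rw [this]
        exact sub_mem (mul_mem_submodule S (X_add_X_mem i) h1) (mul_mem_submodule S (X_mul_X_mem i) h0)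
    refine mem_of_mul_X_mem S h0 fun n p hp => ?_
    rcases outer_cases i n with rfl | rfl | rfl
    · exact mul_mem_submodule S (X_outer_mem i) hp
    · have : (X (outer i.rev) * p : Poly k) = (X 1 + X (outer i.rev)) * p - X 1 * p := by ring
      rw [this]
      exact sub_mem (mul_mem_submodule S (X_add_X_mem i) hp) (hy p hp)
    · exact hy p hp) (by
    intro c hc h
    have h1 : c 0 + c 1 * X 1 = 0 := by simpa [Fin.sum_univ_two] using h
    -- The reflection fixes the coefficients and gives a second linear equation, with y' in place of
    -- y.
    have h2 := congrArg (rename (simpleRefl i)) h1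
    rw [map_add, map_mul, mem_invariants_singleton.1 (hc 0), mem_invariants_singleton.1 (hc 1),
      rename_X, simpleRefl_one, map_zero] at h2
    have := eq_zero_of_add_mul_eq_zero (fun h => outer_rev_ne_one i (X_injective h).symm) h1 h2
    intro j
    fin_cases j
    · exact this.1
    · exact this.2)

lemma simpleBasis_e (i : Fin 2) : (simpleBasis k i).e = ![1, X 1] := rfl

lemma simpleBasis_deg (i : Fin 2) : (simpleBasis k i).deg = ![0, 2] := rfl

lemma simple_decomposition (i : Fin 2) (p : Poly k) :
    p = (simpleBasis k i).coeff 0 p + (simpleBasis k i).coeff 1 p * X 1 := by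
  have h := (simpleBasis k i).sum_coeff p
  rw [Fin.sum_univ_two, simpleBasis_e] at h
  simpa using h.symm

/-! ### The symmetric polynomials -/

lemma invariants_univ_le (i : Fin 2) : invariants k Set.univ ≤ invariants k {i} :=
  fun _ hp j _ => hp j trivial

lemma rename_of_mem_invariants {p : Poly k} (hp : p ∈ invariants k Set.univ) (σ : S3) :
    rename σ p = p := by
  have h (i) : rename (simpleRefl i) p = p := hp i trivial
  induction σ using S3_induction with
  | h1 => exact rename_id_apply p
  | hs => exact h 0
  | hr => exact h 1
  | hsr => rw [rename_mul_apply, h, h]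
  | hrs => rw [rename_mul_apply, h, h]
  | hl => rw [longest, rename_mul_apply, rename_mul_apply, h, h, h]

lemma esymm_one_mem : (X 0 + X 1 + X 2 : Poly k) ∈ invariants k Set.univ := by
  intro i _
  fin_cases i
  · simp only [map_add, rename_X, show simpleRefl 0 0 = 1 by decide,
      show simpleRefl 0 1 = 0 by decide, show simpleRefl 0 2 = 2 by decide, Fin.zero_eta]
    ring
  · simp only [map_add, rename_X, show simpleRefl 1 0 = 0 by decide,
      show simpleRefl 1 1 = 2 by decide, show simpleRefl 1 2 = 1 by decide, Fin.mk_one]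
    ring

lemma esymm_two_mem : (X 0 * X 1 + X 0 * X 2 + X 1 * X 2 : Poly k) ∈ invariants k Set.univ := by
  intro i _
  fin_cases i
  · simp only [map_add, map_mul, rename_X, show simpleRefl 0 0 = 1 by decide,
      show simpleRefl 0 1 = 0 by decide, show simpleRefl 0 2 = 2 by decide, Fin.zero_eta]
    ring
  · simp only [map_add, map_mul, rename_X, show simpleRefl 1 0 = 0 by decide,
      show simpleRefl 1 1 = 2 by decide, show simpleRefl 1 2 = 1 by decide, Fin.mk_one]
    ring

lemma esymm_three_mem : (X 0 * X 1 * X 2 : Poly k) ∈ invariants k Set.univ := by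
  intro i _
  fin_cases i
  · simp only [map_mul, rename_X, show simpleRefl 0 0 = 1 by decide,
      show simpleRefl 0 1 = 0 by decide, show simpleRefl 0 2 = 2 by decide, Fin.zero_eta]
    ring
  · simp only [map_mul, rename_X, show simpleRefl 1 0 = 0 by decide,
      show simpleRefl 1 1 = 2 by decide, show simpleRefl 1 2 = 1 by decide, Fin.mk_one]
    ring

/-- Vandermonde for three points, by divided differences. -/
lemma eq_zero_of_quadratic {a b c x y z : Poly k} (hxy : x ≠ y) (hxz : x ≠ z) (hyz : y ≠ z)
    (hx : a + b * x + c * x ^ 2 = 0) (hy : a + b * y + c * y ^ 2 = 0)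
    (hz : a + b * z + c * z ^ 2 = 0) : a = 0 ∧ b = 0 ∧ c = 0 := by
  have h1 : b + c * (x + y) = 0 := by
    have h : (b + c * (x + y)) * (x - y) = 0 := by linear_combination hx - hy
    exact (mul_eq_zero.1 h).resolve_right (sub_ne_zero.2 hxy)
  have h2 : b + c * (x + z) = 0 := by
    have h : (b + c * (x + z)) * (x - z) = 0 := by linear_combination hx - hz
    exact (mul_eq_zero.1 h).resolve_right (sub_ne_zero.2 hxz)
  have hc : c = 0 := by
    have h : c * (y - z) = 0 := by linear_combination h1 - h2
    exact (mul_eq_zero.1 h).resolve_right (sub_ne_zero.2 hyz)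
  have hb : b = 0 := by rw [hc, zero_mul, add_zero] at h1; exact h1
  exact ⟨by rw [hc, hb] at hx; simpa using hx, hb, hc⟩

/-- The six translates of the family y^a z^b form an invertible matrix over the fraction field,
inverted here in two stages. The coefficients are arbitrary polynomials, so the lemma proves both
freeness over the symmetric polynomials and joint injectivity of the evaluations a ⊗ b ↦ a σ(b). -/
lemma eq_zero_of_sum_rename_eq_zero (c : Fin 2 × Fin 3 → Poly k)
    (h : ∀ σ : S3, ∑ j, c j * rename σ (X 1 ^ (j.1 : ℕ) * X 2 ^ (j.2 : ℕ)) = 0) (j) : c j = 0 := by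
  have hX {m n : Fin 3} (hmn : m ≠ n) : (X m : Poly k) ≠ X n := fun h => hmn (X_injective h)
  have key (σ : S3) (a : Fin 2) :
      c (a, 0) + c (a, 1) * X (σ 2) + c (a, 2) * X (σ 2) ^ 2 = 0 := by
    have h1 := h σ
    -- σ and σs agree on z and give different values to y, so the two equations separate the powers
    -- of y.
    have h2 := h (σ * simpleRefl 0)
    simp only [Fintype.sum_prod_type, Fin.sum_univ_two, Fin.sum_univ_three, map_mul, map_pow,
      rename_X, Fin.val_zero, Fin.val_one, Fin.val_two, pow_zero, pow_one, one_mul, mul_one,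
      Equiv.Perm.mul_apply, show simpleRefl 0 1 = 0 by decide, show simpleRefl 0 2 = 2 by decide]
      at h1 h2
    have := eq_zero_of_add_mul_eq_zero
      (a := c (0, 0) + c (0, 1) * X (σ 2) + c (0, 2) * X (σ 2) ^ 2)
      (b := c (1, 0) + c (1, 1) * X (σ 2) + c (1, 2) * X (σ 2) ^ 2)
      (x := X (σ 1)) (y := X (σ 0)) (hX (σ.injective.ne (by decide)))
      (by linear_combination h1) (by linear_combination h2)
    fin_cases a
    · exact this.1
    · exact this.2
  obtain ⟨a, b⟩ := j
  -- The permutations 1, r and srs send z to z, y and x: three points for a quadratic in z.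
  obtain ⟨h0, h1, h2⟩ := eq_zero_of_quadratic (hX (by decide)) (hX (by decide)) (hX (by decide))
    (key 1 a) (key (simpleRefl 1) a) (key longest a)
  fin_cases b
  · exact h0
  · exact h1
  · exact h2

variable (k) in
/-- The polynomial ring is free over the symmetric polynomials, with basis `y ^ a z ^ b` for `a < 2`
and `b < 3`. -/
noncomputable def symmBasis : GrBasis (invariants k Set.univ) (Fin 2 × Fin 3) :=
  GrBasis.mk' (fun j => X 1 ^ (j.1 : ℕ) * X 2 ^ (j.2 : ℕ)) (fun j => 2 * j.1 + 2 * j.2) (by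
    intro j
    exact polyGr_mul (X_pow_mem_polyGr _ _) (X_pow_mem_polyGr _ _)) (by
    set e : Fin 2 × Fin 3 → Poly k := fun j => X 1 ^ (j.1 : ℕ) * X 2 ^ (j.2 : ℕ) with he
    set S := Submodule.span (invariants k Set.univ) (Set.range e) with hS
    have hm (a : Fin 2) (b : Fin 3) : (X 1 ^ (a : ℕ) * X 2 ^ (b : ℕ) : Poly k) ∈ S :=
      Submodule.subset_span ⟨(a, b), rfl⟩
    have h0 : (1 : Poly k) ∈ S := by simpa using hm 0 0
    have hz : ∀ p ∈ S, X 2 * p ∈ S := by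
      refine fun p hp => mul_mem_span_range (X 2) ?_ hp
      rintro ⟨a, b⟩
      change X 2 * (X 1 ^ (a : ℕ) * X 2 ^ (b : ℕ)) ∈ S
      fin_cases b
      · convert hm a 1 using 1
        simp [mul_comm]
      · convert hm a 2 using 1
        simp only [Fin.val_two]
        ring
      -- z is a root of T³ − e₁T² + e₂T − e₃, with e₁, e₂, e₃ the elementary symmetric polynomials.
      · have h : (X 2 * (X 1 ^ (a : ℕ) * X 2 ^ 2) : Poly k) =
            (X 0 + X 1 + X 2) * (X 1 ^ (a : ℕ) * X 2 ^ 2)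
            - (X 0 * X 1 + X 0 * X 2 + X 1 * X 2) * (X 1 ^ (a : ℕ) * X 2 ^ 1)
            + (X 0 * X 1 * X 2) * (X 1 ^ (a : ℕ) * X 2 ^ 0) := by ring
        refine (congrArg (· ∈ S) h).mpr ?_
        exact add_mem (sub_mem (mul_mem_submodule S esymm_one_mem (hm a 2))
          (mul_mem_submodule S esymm_two_mem (hm a 1))) (mul_mem_submodule S esymm_three_mem (hm a 0))
    have hy : ∀ p ∈ S, X 1 * p ∈ S := by
      refine fun p hp => mul_mem_span_range (X 1) ?_ hp
      rintro ⟨a, b⟩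
      change X 1 * (X 1 ^ (a : ℕ) * X 2 ^ (b : ℕ)) ∈ S
      fin_cases a
      · convert hm 1 b using 1
        simp
      -- y is a root of T² − (x + y)T + xy, where x + y = e₁ − z and xy = e₂ − z(e₁ − z). The
      -- resulting powers of z are handled by `hz`.
      · have h : (X 1 * (X 1 ^ 1 * X 2 ^ (b : ℕ)) : Poly k) =
            (X 0 + X 1 + X 2) * (X 1 ^ 1 * X 2 ^ (b : ℕ)) - X 2 * (X 1 ^ 1 * X 2 ^ (b : ℕ))
            - (X 0 * X 1 + X 0 * X 2 + X 1 * X 2) * (X 1 ^ 0 * X 2 ^ (b : ℕ))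
            + X 2 * ((X 0 + X 1 + X 2) * (X 1 ^ 0 * X 2 ^ (b : ℕ)))
            - X 2 * (X 2 * (X 1 ^ 0 * X 2 ^ (b : ℕ))) := by ring
        refine (congrArg (· ∈ S) h).mpr ?_
        exact sub_mem (add_mem (sub_mem (sub_mem (mul_mem_submodule S esymm_one_mem (hm 1 b))
          (hz _ (hm 1 b))) (mul_mem_submodule S esymm_two_mem (hm 0 b)))
          (hz _ (mul_mem_submodule S esymm_one_mem (hm 0 b)))) (hz _ (hz _ (hm 0 b)))
    refine mem_of_mul_X_mem S h0 fun n p hp => ?_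
    fin_cases n
    · have : (X 0 * p : Poly k) = (X 0 + X 1 + X 2) * p - X 1 * p - X 2 * p := by ring
      refine (congrArg (· ∈ S) this).mpr ?_
      exact sub_mem (sub_mem (mul_mem_submodule S esymm_one_mem hp) (hy p hp)) (hz p hp)
    · exact hy p hp
    · exact hz p hp) (by
    intro c hc h
    refine eq_zero_of_sum_rename_eq_zero c fun σ => ?_
    have h' := congrArg (rename σ) h
    rw [map_sum, map_zero] at h'
    rw [← h']
    exact Finset.sum_congr rfl fun j _ => by
      rw [map_mul (rename σ) (c j), rename_of_mem_invariants (hc j)])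

lemma symmBasis_e (j : Fin 2 × Fin 3) : (symmBasis k).e j = X 1 ^ (j.1 : ℕ) * X 2 ^ (j.2 : ℕ) := rfl

lemma symmBasis_deg (j : Fin 2 × Fin 3) : (symmBasis k).deg j = 2 * j.1 + 2 * j.2 := rfl

end SoergelS3

namespace SoergelS3

open GrBimod MvPolynomial

variable {k : Type u} [Field k]

/-! ## Direct sum decompositions -/

lemma listSum_cons (M : GrBimod k) (L : List (GrBimod k)) :
    listSum (M :: L) = M.sum (listSum L) := rfl

/-- The last two clauses carry the induction: they keep the indices not yet used orthogonal to the
sum already built. The bimodule Q is given through an equation so that the induction can treat it as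
opaque. -/
lemma exists_hom_listSum {M : GrBimod k} {ι : Type} {N : ι → GrBimod k}
    {f : ∀ j, M →ₗ[k] N j} {g : ∀ j, N j →ₗ[k] M} (hf : ∀ j, f j ∈ hom M (N j))
    (h1 : ∀ j x, f j (g j x) = x) (h0 : ∀ i j x, i ≠ j → f i (g j x) = 0) (l : List ι)
    (hl : l.Nodup) : ∃ Q : GrBimod k, Q = listSum (l.map N) ∧ ∃ F ∈ hom M Q, ∃ G : Q →ₗ[k] M,
      (∀ x, G (F x) = (l.map fun j => g j (f j x)).sum) ∧ (∀ t, F (G t) = t) ∧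
      (∀ i ∉ l, ∀ x, F (g i x) = 0) ∧ ∀ i ∉ l, ∀ t, f i (G t) = 0 := by
  induction l with
  | nil =>
    exact ⟨GrBimod.zero, rfl, 0, zero_mem _, 0, fun x => rfl, fun t => rfl, fun i _ x => rfl,
      fun i _ t => map_zero _⟩
  | cons j l ih =>
    obtain ⟨hj, hl⟩ := List.nodup_cons.1 hl
    obtain ⟨Q, hQ, F, hF, G, hGF, hFG, hFg, hfG⟩ := ih hl
    refine ⟨(N j).sum Q, by rw [hQ]; rfl, sumInl _ _ ∘ₗ f j + sumInr _ _ ∘ₗ F,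
      add_mem (comp_mem_hom sumInl_mem_hom (hf j)) (comp_mem_hom sumInr_mem_hom hF),
      g j ∘ₗ sumFst _ _ + G ∘ₗ sumSnd _ _, fun x => ?_, fun t => ?_, fun i hi x => ?_,
      fun i hi t => ?_⟩
    · simp only [LinearMap.comp_apply, LinearMap.add_apply, map_add, sumFst_sumInl, sumFst_sumInr,
        sumSnd_sumInl, sumSnd_sumInr, map_zero, add_zero, zero_add, hGF, List.map_cons,
        List.sum_cons]
    · simp only [LinearMap.comp_apply, LinearMap.add_apply, map_add, h1, hfG j hj, hFg j hj, hFG,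
        map_zero, add_zero, zero_add, sumInl_add_sumInr]
    · rw [List.mem_cons, not_or] at hi
      simp only [LinearMap.comp_apply, LinearMap.add_apply, h0 j i x (Ne.symm hi.1), hFg i hi.2,
        map_zero, add_zero]
    · rw [List.mem_cons, not_or] at hi
      simp only [LinearMap.comp_apply, LinearMap.add_apply, map_add, h0 i j _ hi.1, hfG i hi.2,
        add_zero]

lemma isIso_listSum_of {M : GrBimod k} {ι : Type} [Fintype ι] {N : ι → GrBimod k}
    {f : ∀ j, M →ₗ[k] N j} {g : ∀ j, N j →ₗ[k] M} (hf : ∀ j, f j ∈ hom M (N j))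
    (h1 : ∀ j x, f j (g j x) = x) (h0 : ∀ i j x, i ≠ j → f i (g j x) = 0)
    (h : ∀ x, ∑ j, g j (f j x) = x) : IsIso M (listSum (Finset.univ.toList.map N)) := by
  obtain ⟨Q, rfl, F, hF, G, hGF, hFG, -, -⟩ := exists_hom_listSum hf h1 h0 Finset.univ.toList
    (Finset.nodup_toList _)
  refine isIso_of_inverse hF (g := G) (LinearMap.ext fun x => ?_) (LinearMap.ext hFG)
  refine (hGF x).trans ?_
  rw [Finset.sum_map_toList, h, LinearMap.id_apply]

/-! ### Induced bimodules -/

/-- The bimodule `R ⊗_{R^I} N`. -/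
noncomputable def indT (I : Set (Fin 2)) (N : GrBimod k) : GrBimod k :=
  tensorOver (invariants k I) (isGradedSubalg_invariants I) (regular k) N

variable (k) in
/-- The bimodule `R ⊗_{R^I} R`. -/
noncomputable def ind (I : Set (Fin 2)) : GrBimod k := indT I (regular k)

variable (I J : Set (Fin 2)) {N : GrBimod k}

/-- The element `a ⊗ n` of `R ⊗_{R^I} N`. -/
noncomputable def it : Poly k →ₗ[k] N →ₗ[k] indT I N :=
  (tm (isGradedSubalg_invariants I) : regular k →ₗ[k] N →ₗ[k] _) ∘ₗ (toReg k).toLinearMap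

/-- The element `a ⊗ b` of `R ⊗_{R^I} R`. -/
noncomputable def it₂ : Poly k →ₗ[k] Poly k →ₗ[k] ind k I :=
  (it (N := regular k) I).compl₂ (toReg k).toLinearMap

/-- The map `(a, n) ↦ a ⊗ n` with `n` in the bimodule `R`. -/
noncomputable def itReg : Poly k →ₗ[k] regular k →ₗ[k] ind k I := it I

lemma itReg_toReg (a b : Poly k) : itReg I a (toReg k b) = it₂ I a b := rfl

lemma it_left (p a : Poly k) (n : N) : (indT I N).left p (it I a n) = it I (p * a) n :=
  tm_left _ _ _ _

lemma it_right (p a : Poly k) (n : N) : (indT I N).right p (it I a n) = it I a (N.right p n) :=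
  tm_right _ _ _ _

lemma it₂_left (p a b : Poly k) : (ind k I).left p (it₂ I a b) = it₂ I (p * a) b :=
  it_left I p a (toReg k b)

lemma it₂_right (p a b : Poly k) : (ind k I).right p (it₂ I a b) = it₂ I a (p * b) :=
  it_right I p a (toReg k b)

variable {I J}

lemma it_balanced {c : Poly k} (hc : c ∈ invariants k I) (a : Poly k) (n : N) :
    it I (a * c) n = it I a (N.left c n) := by
  rw [mul_comm]
  exact tm_balanced hc (toReg k a) n

lemma it₂_balanced {c : Poly k} (hc : c ∈ invariants k I) (a b : Poly k) :
    it₂ I (a * c) b = it₂ I a (c * b) :=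
  it_balanced hc a (toReg k b)

lemma it_induction {motive : indT I N → Prop} (it : ∀ a n, motive (it I a n))
    (add : ∀ x y, motive x → motive y → motive (x + y)) (t : indT I N) : motive t :=
  tm_induction it add t

lemma it₂_induction {motive : ind k I → Prop} (it₂ : ∀ a b, motive (it₂ I a b))
    (add : ∀ x y, motive x → motive y → motive (x + y)) (t : ind k I) : motive t :=
  it_induction (I := I) (N := regular k) it₂ add t

lemma it_mem_gr {i j d : ℤ} (hd : i + j = d) {a : Poly k} (ha : a ∈ polyGr k i) {n : N}
    (hn : n ∈ N.gr j) : it I a n ∈ (indT I N).gr d :=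
  tm_mem_gr hd (toReg_mem_gr.2 ha) hn

lemma it₂_mem_gr {i j d : ℤ} (hd : i + j = d) {a b : Poly k} (ha : a ∈ polyGr k i)
    (hb : b ∈ polyGr k j) : it₂ I a b ∈ (ind k I).gr d :=
  it_mem_gr hd ha (toReg_mem_gr.2 hb)

lemma indT_gr_le {d : ℤ} {S : Submodule k (indT I N)}
    (h : ∀ i j, i + j = d → ∀ a ∈ polyGr k i, ∀ n ∈ N.gr j, it I a n ∈ S) :
    (indT I N).gr d ≤ S :=
  gr_induction h

lemma ind_gr_le {d : ℤ} {S : Submodule k (ind k I)}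
    (h : ∀ i j, i + j = d → ∀ a ∈ polyGr k i, ∀ b ∈ polyGr k j, it₂ I a b ∈ S) :
    (ind k I).gr d ≤ S :=
  indT_gr_le (I := I) (N := regular k) h

section lift

variable {V : Type*} [AddCommGroup V] [Module k V]

/-- The linear map out of `R ⊗_{R^I} N` given by a balanced bilinear map. -/
noncomputable def itLift (f : Poly k →ₗ[k] N →ₗ[k] V)
    (hf : ∀ c ∈ invariants k I, ∀ a n, f (a * c) n = f a (N.left c n)) : indT I N →ₗ[k] V :=
  tlift (M := regular k) (isGradedSubalg_invariants I) (f ∘ₗ (toReg k).symm.toLinearMap)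
    fun c hc a n => (congrArg (f · n) (mul_comm c a)).trans (hf c hc a n)

lemma itLift_it (f : Poly k →ₗ[k] N →ₗ[k] V)
    (hf : ∀ c ∈ invariants k I, ∀ a n, f (a * c) n = f a (N.left c n)) (a : Poly k) (n : N) :
    itLift f hf (it I a n) = f a n :=
  tlift_tm _ _ _ _ _

/-- The linear map out of `R ⊗_{R^I} R` given by a balanced bilinear map. -/
noncomputable def it₂Lift (f : Poly k →ₗ[k] Poly k →ₗ[k] V)
    (hf : ∀ c ∈ invariants k I, ∀ a b, f (a * c) b = f a (c * b)) : ind k I →ₗ[k] V :=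
  itLift (N := regular k) (f.compl₂ (toReg k).symm.toLinearMap) hf

lemma it₂Lift_it₂ (f : Poly k →ₗ[k] Poly k →ₗ[k] V)
    (hf : ∀ c ∈ invariants k I, ∀ a b, f (a * c) b = f a (c * b)) (a b : Poly k) :
    it₂Lift f hf (it₂ I a b) = f a b :=
  itLift_it _ _ _ _

lemma it_ext {f g : indT I N →ₗ[k] V} (h : ∀ a n, f (it I a n) = g (it I a n)) : f = g :=
  tm_ext h

lemma it₂_ext {f g : ind k I →ₗ[k] V} (h : ∀ a b, f (it₂ I a b) = g (it₂ I a b)) : f = g :=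
  it_ext (I := I) (N := regular k) h

end lift

lemma mem_hom_indT {Q : GrBimod k} {f : indT I N →ₗ[k] Q}
    (h1 : ∀ p a n, f (it I (p * a) n) = Q.left p (f (it I a n)))
    (h2 : ∀ p a n, f (it I a (N.right p n)) = Q.right p (f (it I a n)))
    (h3 : ∀ i j, ∀ a ∈ polyGr k i, ∀ n ∈ N.gr j, f (it I a n) ∈ Q.gr (i + j)) :
    f ∈ hom (indT I N) Q :=
  mem_hom_tensorOver h1 h2 h3

lemma mem_hom_ind {Q : GrBimod k} {f : ind k I →ₗ[k] Q}
    (h1 : ∀ p a b, f (it₂ I (p * a) b) = Q.left p (f (it₂ I a b)))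
    (h2 : ∀ p a b, f (it₂ I a (p * b)) = Q.right p (f (it₂ I a b)))
    (h3 : ∀ i j, ∀ a ∈ polyGr k i, ∀ b ∈ polyGr k j, f (it₂ I a b) ∈ Q.gr (i + j)) :
    f ∈ hom (ind k I) Q :=
  mem_hom_indT (I := I) (N := regular k) h1 h2 h3

/-- A bimodule map that raises degrees by `n` is a homomorphism to the shift by `n`. -/
lemma shiftEquiv_comp_mem_hom {M Q : GrBimod k} {f : M →ₗ[k] Q} {n : ℤ}
    (h1 : ∀ p m, f (M.left p m) = Q.left p (f m)) (h2 : ∀ p m, f (M.right p m) = Q.right p (f m))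
    (h3 : ∀ i, ∀ m ∈ M.gr i, f m ∈ Q.gr (n + i)) :
    (shiftEquiv Q n).toLinearMap ∘ₗ f ∈ hom M (Q.shift n) :=
  ⟨fun p m => congrArg (shiftEquiv Q n) (h1 p m), fun p m => congrArg (shiftEquiv Q n) (h2 p m), h3⟩

/-- Associativity and R ⊗_R N ≅ N. It turns a product with B_s, B_r or B_srs into one tensor product
over invariants. -/
lemma isIso_ind_tensor (N : GrBimod k) : IsIso ((ind k I).tensor N) (indT I N) :=
  (isIso_assoc _ _ _ _ _).trans (IsIso.tensorOver (IsIso.refl _) (isIso_regular_tensor N))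

lemma isIso_indT_shift (N : GrBimod k) (n : ℤ) :
    IsIso (indT I (N.shift n)) ((indT I N).shift n) :=
  isIso_tensorOver_shift _ _ _ _

section decomposition

variable {ι : Type} [Fintype ι]

/-! If `R` has a basis `e_j` over `R^I` and `R^J ⊆ R^I`, then `R ⊗_{R^I} R ⊗_{R^J} R` is the direct
sum of copies of `R ⊗_{R^J} R`, with `a ⊗ b ⊗ c` corresponding to `(a b_j ⊗ c)_j` for
`b = ∑ b_j e_j`. -/

section left

variable (b : GrBasis (invariants k I) ι)

/-- The map `b ⊗ c ↦ b_j ⊗ c` on `R ⊗_{R^J} R`. -/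
noncomputable def coeffLeft (h : invariants k J ≤ invariants k I) (j : ι) : ind k J →ₗ[k] ind k J :=
  it₂Lift (it₂ J ∘ₗ b.coeff j) fun c hc p q => by
    rw [LinearMap.comp_apply, LinearMap.comp_apply, mul_comm p, b.coeff_mul (h hc), mul_comm c,
      it₂_balanced hc]

lemma coeffLeft_it₂ (h : invariants k J ≤ invariants k I) (j : ι) (p q : Poly k) :
    coeffLeft b h j (it₂ J p q) = it₂ J (b.coeff j p) q :=
  it₂Lift_it₂ _ _ _ _

lemma coeffLeft_left (h : invariants k J ≤ invariants k I) (j : ι) {c : Poly k} (hc : c ∈ invariants k I) (t : ind k J) :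
    coeffLeft b h j ((ind k J).left c t) = (ind k J).left c (coeffLeft b h j t) := by
  induction t using it₂_induction with
  | it₂ p q => rw [it₂_left, coeffLeft_it₂, coeffLeft_it₂, b.coeff_mul hc, it₂_left]
  | add x y hx hy => simp only [map_add, hx, hy]

/-- The projection `a ⊗ b ⊗ c ↦ a b_j ⊗ c`. -/
noncomputable def splitLeft (h : invariants k J ≤ invariants k I) (j : ι) : indT I (ind k J) →ₗ[k] ind k J :=
  itLift ((ind k J).left.toLinearMap.compl₂ (coeffLeft b h j)) fun c hc a t => by
    simp only [LinearMap.compl₂_apply, coeffLeft_left b h j hc, AlgHom.toLinearMap_apply, map_mul,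
      Module.End.mul_apply]

lemma splitLeft_it (h : invariants k J ≤ invariants k I) (j : ι) (a p q : Poly k) :
    splitLeft b h j (it I a (it₂ J p q)) = it₂ J (a * b.coeff j p) q := by
  refine (itLift_it _ _ _ _).trans ?_
  rw [LinearMap.compl₂_apply, coeffLeft_it₂, AlgHom.toLinearMap_apply, it₂_left]

/-- The inclusion `a ⊗ c ↦ a ⊗ e_j ⊗ c`. -/
noncomputable def inclLeft (h : invariants k J ≤ invariants k I) (j : ι) : ind k J →ₗ[k] indT I (ind k J) :=
  it₂Lift ((it I).compl₂ (it₂ J (b.e j))) fun c hc p q => by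
    rw [LinearMap.compl₂_apply, LinearMap.compl₂_apply, it_balanced (h hc), it₂_left, mul_comm c,
      it₂_balanced hc]

lemma inclLeft_it₂ (h : invariants k J ≤ invariants k I) (j : ι) (p q : Poly k) :
    inclLeft b h j (it₂ J p q) = it I p (it₂ J (b.e j) q) :=
  it₂Lift_it₂ _ _ _ _

lemma ind_ind_induction {motive : indT I (ind k J) → Prop}
    (it : ∀ a p q, motive (it I a (it₂ J p q)))
    (add : ∀ x y, motive x → motive y → motive (x + y)) (t : indT I (ind k J)) : motive t := by
  induction t using it_induction with
  | it a t =>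
    induction t using it₂_induction with
    | it₂ p q => exact it a p q
    | add x y hx hy => rw [map_add]; exact add _ _ hx hy
  | add x y hx hy => exact add _ _ hx hy

lemma ind_ind_gr_le {d : ℤ} {S : Submodule k (indT I (ind k J))}
    (h : ∀ x y z, x + y + z = d → ∀ a ∈ polyGr k x, ∀ p ∈ polyGr k y, ∀ q ∈ polyGr k z,
      it I a (it₂ J p q) ∈ S) : (indT I (ind k J)).gr d ≤ S := by
  refine indT_gr_le fun x y hxy a ha n hn => ?_
  have : (ind k J).gr y ≤ S.comap (it I a) :=
    ind_gr_le fun y' z hyz p hp q hq => h x y' z (by omega) a ha p hp q hq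
  exact this hn

/-- Extracting the coefficient of e_j lowers degrees by deg e_j, whence the shift by −deg e_j.
Orthogonality of the projections and inclusions is `coeff_e`. -/
lemma isIso_indT_ind_left (h : invariants k J ≤ invariants k I) : IsIso (indT I (ind k J))
    (listSum ((Finset.univ : Finset ι).toList.map fun j => (ind k J).shift (-b.deg j))) := by
  classical
  refine isIso_listSum_of
    (f := fun j => (shiftEquiv (ind k J) (-b.deg j)).toLinearMap ∘ₗ splitLeft b h j)
    (g := fun j => inclLeft b h j ∘ₗ (shiftEquiv (ind k J) (-b.deg j)).symm.toLinearMap)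
    (fun j => shiftEquiv_comp_mem_hom (fun p m => ?_) (fun p m => ?_) fun i => ?_)
    (fun j x => ?_) (fun i j x hij => ?_) fun x => ?_
  · induction m using ind_ind_induction with
    | it a q r => rw [it_left, splitLeft_it, splitLeft_it, it₂_left, mul_assoc]
    | add x y hx hy => simp only [map_add, hx, hy]
  · induction m using ind_ind_induction with
    | it a q r => rw [it_right, it₂_right, splitLeft_it, splitLeft_it, it₂_right]
    | add x y hx hy => simp only [map_add, hx, hy]
  · refine ind_ind_gr_le (S := ((ind k J).gr (-b.deg j + i)).comap (splitLeft b h j))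
      fun x y z hxyz a ha p hp q hq => ?_
    rw [Submodule.mem_comap, splitLeft_it]
    exact it₂_mem_gr (by omega)
      (polyGr_mul ha (b.coeff_mem_polyGr (isGradedSubalg_invariants I) hp j)) hq
  · obtain ⟨x, rfl⟩ := (shiftEquiv (ind k J) (-b.deg j)).surjective x
    simp only [LinearMap.comp_apply, LinearEquiv.coe_coe, LinearEquiv.symm_apply_apply]
    congr 1
    induction x using it₂_induction with
    | it₂ p q => rw [inclLeft_it₂, splitLeft_it, b.coeff_e, if_pos rfl, mul_one]
    | add x y hx hy => simp only [map_add, hx, hy]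
  · obtain ⟨x, rfl⟩ := (shiftEquiv (ind k J) (-b.deg j)).surjective x
    simp only [LinearMap.comp_apply, LinearEquiv.coe_coe, LinearEquiv.symm_apply_apply,
      LinearEquiv.map_eq_zero_iff]
    induction x using it₂_induction with
    | it₂ p q =>
      rw [inclLeft_it₂, splitLeft_it, b.coeff_e, if_neg hij, mul_zero, LinearMap.map_zero₂]
    | add x y hx hy => simp only [map_add, hx, hy, add_zero]
  · simp only [LinearMap.comp_apply, LinearEquiv.coe_coe, LinearEquiv.symm_apply_apply]
    induction x using ind_ind_induction with
    | it a p q =>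
      -- The coefficients b_j are invariant and cross the first tensor sign; ∑ b_j e_j then gives
      -- back b.
      simp only [splitLeft_it, inclLeft_it₂, it_balanced (b.coeff_mem _ _), it₂_left]
      rw [← map_sum, ← LinearMap.sum_apply, ← map_sum, b.sum_coeff]
    | add x y hx hy => simp only [map_add, Finset.sum_add_distrib, hx, hy]

end left

/-! Symmetrically, `R ⊗_{R^J} R ⊗_{R^I} R` is a direct sum of copies of `R ⊗_{R^J} R`, with
`a ⊗ b ⊗ c` corresponding to `(a ⊗ b_j c)_j`. -/

section right

variable (b : GrBasis (invariants k I) ι)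

/-- The map `b ⊗ c ↦ b_j c`. -/
noncomputable def coeffRight (j : ι) : ind k I →ₗ[k] regular k :=
  it₂Lift ((LinearMap.mul k (Poly k) ∘ₗ b.coeff j).compr₂ (toReg k).toLinearMap) fun c hc p q => by
    simp only [LinearMap.compr₂_apply, LinearMap.comp_apply, LinearMap.mul_apply']
    rw [mul_comm p, b.coeff_mul hc, mul_comm c, mul_assoc]

lemma coeffRight_it₂ (j : ι) (p q : Poly k) :
    coeffRight b j (it₂ I p q) = toReg k (b.coeff j p * q) :=
  it₂Lift_it₂ _ _ _ _

lemma coeffRight_left (j : ι) {c : Poly k} (hc : c ∈ invariants k I) (t : ind k I) :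
    coeffRight b j ((ind k I).left c t) = (regular k).left c (coeffRight b j t) := by
  induction t using it₂_induction with
  | it₂ p q => rw [it₂_left, coeffRight_it₂, coeffRight_it₂, b.coeff_mul hc, reg_left, mul_assoc]
  | add x y hx hy => simp only [map_add, hx, hy]

/-- The projection `a ⊗ b ⊗ c ↦ a ⊗ b_j c`. -/
noncomputable def splitRight (h : invariants k J ≤ invariants k I) (j : ι) : indT J (ind k I) →ₗ[k] ind k J :=
  itLift ((itReg J).compl₂ (coeffRight b j)) fun c hc a t => by
    rw [LinearMap.compl₂_apply, LinearMap.compl₂_apply, coeffRight_left b j (h hc)]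
    exact it_balanced hc _ _

lemma splitRight_it (h : invariants k J ≤ invariants k I) (j : ι) (a p q : Poly k) :
    splitRight b h j (it J a (it₂ I p q)) = it₂ J a (b.coeff j p * q) := by
  refine (itLift_it _ _ _ _).trans ?_
  rw [LinearMap.compl₂_apply, coeffRight_it₂, itReg_toReg]

/-- The inclusion `a ⊗ c ↦ a ⊗ e_j ⊗ c`. -/
noncomputable def inclRight (h : invariants k J ≤ invariants k I) (j : ι) : ind k J →ₗ[k] indT J (ind k I) :=
  it₂Lift ((it J).compl₂ (it₂ I (b.e j))) fun c hc p q => by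
    rw [LinearMap.compl₂_apply, LinearMap.compl₂_apply, it_balanced hc, it₂_left, mul_comm c,
      it₂_balanced (h hc)]

lemma inclRight_it₂ (h : invariants k J ≤ invariants k I) (j : ι) (p q : Poly k) :
    inclRight b h j (it₂ J p q) = it J p (it₂ I (b.e j) q) :=
  it₂Lift_it₂ _ _ _ _

/-- The mirror version is required for B_srs B_i, where the smaller ring of invariants sits at the
first tensor sign. -/
lemma isIso_indT_ind_right (h : invariants k J ≤ invariants k I) : IsIso (indT J (ind k I))
    (listSum ((Finset.univ : Finset ι).toList.map fun j => (ind k J).shift (-b.deg j))) := by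
  classical
  refine isIso_listSum_of
    (f := fun j => (shiftEquiv (ind k J) (-b.deg j)).toLinearMap ∘ₗ splitRight b h j)
    (g := fun j => inclRight b h j ∘ₗ (shiftEquiv (ind k J) (-b.deg j)).symm.toLinearMap)
    (fun j => shiftEquiv_comp_mem_hom (fun p m => ?_) (fun p m => ?_) fun i => ?_)
    (fun j x => ?_) (fun i j x hij => ?_) fun x => ?_
  · induction m using ind_ind_induction with
    | it a q r => rw [it_left, splitRight_it, splitRight_it, it₂_left]
    | add x y hx hy => simp only [map_add, hx, hy]
  · induction m using ind_ind_induction with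
    | it a q r => rw [it_right, it₂_right, splitRight_it, splitRight_it, it₂_right, mul_left_comm]
    | add x y hx hy => simp only [map_add, hx, hy]
  · refine ind_ind_gr_le (S := ((ind k J).gr (-b.deg j + i)).comap (splitRight b h j))
      fun x y z hxyz a ha p hp q hq => ?_
    rw [Submodule.mem_comap, splitRight_it]
    exact it₂_mem_gr (by omega) ha
      (polyGr_mul (b.coeff_mem_polyGr (isGradedSubalg_invariants I) hp j) hq)
  · obtain ⟨x, rfl⟩ := (shiftEquiv (ind k J) (-b.deg j)).surjective x
    simp only [LinearMap.comp_apply, LinearEquiv.coe_coe, LinearEquiv.symm_apply_apply]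
    congr 1
    induction x using it₂_induction with
    | it₂ p q => rw [inclRight_it₂, splitRight_it, b.coeff_e, if_pos rfl, one_mul]
    | add x y hx hy => simp only [map_add, hx, hy]
  · obtain ⟨x, rfl⟩ := (shiftEquiv (ind k J) (-b.deg j)).surjective x
    simp only [LinearMap.comp_apply, LinearEquiv.coe_coe, LinearEquiv.symm_apply_apply,
      LinearEquiv.map_eq_zero_iff]
    induction x using it₂_induction with
    | it₂ p q =>
      rw [inclRight_it₂, splitRight_it, b.coeff_e, if_neg hij, zero_mul, map_zero]
    | add x y hx hy => simp only [map_add, hx, hy, add_zero]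
  · simp only [LinearMap.comp_apply, LinearEquiv.coe_coe, LinearEquiv.symm_apply_apply]
    induction x using ind_ind_induction with
    | it a p q =>
      simp only [splitRight_it, inclRight_it₂, ← it₂_balanced (b.coeff_mem _ _),
        mul_comm (b.e _)]
      rw [← map_sum, ← LinearMap.sum_apply, ← map_sum, b.sum_coeff]
    | add x y hx hy => simp only [map_add, Finset.sum_add_distrib, hx, hy]

end right

end decomposition

end SoergelS3

namespace SoergelS3

open GrBimod MvPolynomial

variable {k : Type u} [Field k]

/-! ### Evaluation maps -/

section eval

variable {I : Set (Fin 2)} {N : GrBimod k}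

/-- `g` is a linear map `N → R` with `g (p n q) = p g(n) σ(q)`. -/
structure IsTwisted (σ : S3) (g : N →ₗ[k] Poly k) : Prop where
  map_left : ∀ p n, g (N.left p n) = p * g n
  map_right : ∀ p n, g (N.right p n) = g n * rename σ p

lemma isTwisted_regular : IsTwisted (N := regular k) 1 (toReg k).symm.toLinearMap where
  map_left _ _ := rfl
  map_right p n := by
    rw [show (rename (1 : S3) p : Poly k) = p from rename_id_apply p]
    exact mul_comm p ((toReg k).symm n)

/-- The map `a ⊗ n ↦ a σ(g(n))`. -/
noncomputable def evalT {σ τ : S3} (hσ : ∀ c ∈ invariants k I, rename σ c = c)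
    {g : N →ₗ[k] Poly k} (hg : IsTwisted τ g) : indT I N →ₗ[k] Poly k :=
  itLift ((LinearMap.mul k (Poly k)).compl₂ ((rename σ).toLinearMap ∘ₗ g)) fun c hc a n => by
    simp only [LinearMap.compl₂_apply, LinearMap.comp_apply, LinearMap.mul_apply', hg.map_left,
      AlgHom.toLinearMap_apply, map_mul, hσ c hc, mul_assoc]

variable {σ τ : S3} (hσ : ∀ c ∈ invariants k I, rename σ c = c) {g : N →ₗ[k] Poly k}
  (hg : IsTwisted τ g)

lemma evalT_it (a : Poly k) (n : N) : evalT hσ hg (it I a n) = a * rename σ (g n) :=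
  itLift_it _ _ _ _

lemma isTwisted_evalT : IsTwisted (σ * τ) (evalT hσ hg) where
  map_left p t := by
    induction t using it_induction with
    | it a n => rw [it_left, evalT_it, evalT_it, mul_assoc]
    | add x y hx hy => simp only [map_add, mul_add, hx, hy]
  map_right p t := by
    induction t using it_induction with
    | it a n =>
      rw [it_right, evalT_it, evalT_it, hg.map_right, map_mul, rename_mul_apply, mul_assoc]
    | add x y hx hy => simp only [map_add, add_mul, hx, hy]

/-- The map `R ⊗_{R^I} R → R`, `a ⊗ b ↦ a σ(b)`. -/
noncomputable def evalInd (hσ : ∀ c ∈ invariants k I, rename σ c = c) : ind k I →ₗ[k] Poly k :=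
  evalT hσ isTwisted_regular

lemma evalInd_it₂ (a b : Poly k) : evalInd hσ (it₂ I a b) = a * rename σ b :=
  evalT_it hσ isTwisted_regular a (toReg k b)

lemma isTwisted_evalInd : IsTwisted σ (evalInd hσ) := by
  have := isTwisted_evalT hσ isTwisted_regular
  rwa [mul_one] at this

end eval

lemma rename_one_of_mem {I : Set (Fin 2)} (c : Poly k) (_ : c ∈ invariants k I) :
    rename (1 : S3) c = c :=
  rename_id_apply c

lemma rename_of_mem_singleton {i : Fin 2} {σ : S3} (hσ : σ = 1 ∨ σ = simpleRefl i) (c : Poly k)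
    (hc : c ∈ invariants k {i}) : rename σ c = c := by
  rcases hσ with rfl | rfl
  · exact rename_id_apply c
  · exact mem_invariants_singleton.1 hc

lemma exists_eq_sum_it₂ {I : Set (Fin 2)} {ι : Type} [Fintype ι] (b : GrBasis (invariants k I) ι)
    (t : ind k I) : ∃ c : ι → Poly k, t = ∑ j, it₂ I (c j) (b.e j) := by
  induction t using it₂_induction with
  | it₂ p q =>
    refine ⟨fun j => p * b.coeff j q, ?_⟩
    simp only [it₂_balanced (b.coeff_mem _ _)]
    rw [← map_sum, b.sum_coeff]
  | add x y hx hy =>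
    obtain ⟨c, rfl⟩ := hx
    obtain ⟨d, rfl⟩ := hy
    exact ⟨c + d, by simp only [Pi.add_apply, map_add, LinearMap.add_apply, Finset.sum_add_distrib]⟩

/-- An element of `R ⊗_{R^{s,r}} R` is determined by its images under the maps `a ⊗ b ↦ a σ(b)`. -/
lemma eq_zero_of_evalInd_eq_zero (t : ind k Set.univ)
    (h : ∀ σ : S3, evalInd (σ := σ) (fun _ hc => rename_of_mem_invariants hc σ) t = 0) : t = 0 := by
  obtain ⟨c, rfl⟩ := exists_eq_sum_it₂ (symmBasis k) t
  have hc : ∀ j, c j = 0 := by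
    -- In the coordinates c_j with respect to 1 ⊗ e_j, the six evaluations are exactly the six
    -- equations of this lemma.
    refine eq_zero_of_sum_rename_eq_zero c fun σ => ?_
    have := h σ
    rw [map_sum] at this
    simpa only [evalInd_it₂, symmBasis_e] using this
  simp only [hc, LinearMap.map_zero₂, Finset.sum_const_zero]

/-! ### The braid decomposition -/

section delta

variable {i : Fin 2} {N : GrBimod k}

lemma it_balanced' {I : Set (Fin 2)} {c : Poly k} (hc : c ∈ invariants k I) (a : Poly k) (n : N) :
    it I (c * a) n = it I a (N.left c n) := by
  rw [mul_comm, it_balanced hc]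

variable (i N) in
/-- The bimodule map `N → R ⊗_{R^i} N`, `n ↦ y ⊗ n - 1 ⊗ y' n`, where `y'` is the variable exchanged
with `y` by the reflection `i`. -/
noncomputable def delta : N →ₗ[k] indT {i} N :=
  it {i} (X 1) - it {i} 1 ∘ₗ N.left (X (outer i.rev))

lemma delta_apply (n : N) :
    delta i N n = it {i} (X 1) n - it {i} 1 (N.left (X (outer i.rev)) n) := rfl

/-- The identity py ⊗ n − p ⊗ y'n = y ⊗ pn − 1 ⊗ y'pn. It is checked on p = p₀ + p₁ y with p₀ and p₁
invariant, which can cross the tensor sign. -/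
lemma delta_left (p : Poly k) (n : N) : delta i N (N.left p n) = (indT {i} N).left p (delta i N n) := by
  set p₀ := (simpleBasis k i).coeff 0 p with hp₀
  set p₁ := (simpleBasis k i).coeff 1 p with hp₁
  have hp : p = p₀ + p₁ * X 1 := simple_decomposition i p
  have h₀ : p₀ ∈ invariants k {i} := (simpleBasis k i).coeff_mem _ _
  have h₁ : p₁ ∈ invariants k {i} := (simpleBasis k i).coeff_mem _ _
  set o : Poly k := X (outer i.rev) with ho
  have e1 : it {i} (p * X 1) n = it {i} (X 1) (N.left p₀ n) +
      it {i} (X 1) (N.left (p₁ * (X 1 + o)) n) - it {i} 1 (N.left (p₁ * (X 1 * o)) n) := by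
    -- The square of y is removed by y² = (y + y') y − y y'.
    have e : p * X 1 = p₀ * X 1 + (p₁ * (X 1 + o)) * X 1 - (p₁ * (X 1 * o)) * 1 := by
      rw [hp]; ring
    rw [e, map_sub, map_add, LinearMap.sub_apply, LinearMap.add_apply, it_balanced' h₀,
      it_balanced' (mul_mem h₁ (X_add_X_mem i)), it_balanced' (mul_mem h₁ (X_mul_X_mem i))]
  have e2 : it {i} p (N.left o n) = it {i} 1 (N.left p₀ (N.left o n)) +
      it {i} (X 1) (N.left p₁ (N.left o n)) := by
    have e : p = p₀ * 1 + p₁ * X 1 := by rw [mul_one]; exact hp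
    rw [e, map_add, LinearMap.add_apply, it_balanced' h₀, it_balanced' h₁]
  rw [delta_apply, delta_apply, map_sub, it_left, it_left, mul_one, e1, e2, ← Module.End.mul_apply,
    ← map_mul, mul_comm _ p, hp]
  simp only [map_add, map_mul, mul_add, add_mul, LinearMap.add_apply, Module.End.mul_apply]
  abel

lemma delta_right (p : Poly k) (n : N) :
    delta i N (N.right p n) = (indT {i} N).right p (delta i N n) := by
  rw [delta_apply, delta_apply, N.comm, map_sub, it_right, it_right]

lemma delta_mem_gr {d : ℤ} {n : N} (hn : n ∈ N.gr d) : delta i N n ∈ (indT {i} N).gr (2 + d) :=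
  sub_mem (it_mem_gr rfl (X_mem_polyGr 1) hn)
    (it_mem_gr (zero_add _) one_mem_polyGr (N.left_mem (X_mem_polyGr _) hn))

/-- The multiplication map `R ⊗_{R^I} N → N`. -/
noncomputable def mulMap (I : Set (Fin 2)) (N : GrBimod k) : indT I N →ₗ[k] N :=
  itLift N.left.toLinearMap fun c _ a n => by
    rw [AlgHom.toLinearMap_apply, map_mul]; rfl

lemma mulMap_it (I : Set (Fin 2)) (a : Poly k) (n : N) : mulMap I N (it I a n) = N.left a n :=
  itLift_it _ _ _ _

lemma mulMap_left (I : Set (Fin 2)) (p : Poly k) (t : indT I N) :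
    mulMap I N ((indT I N).left p t) = N.left p (mulMap I N t) := by
  induction t using it_induction with
  | it a n => rw [it_left, mulMap_it, mulMap_it, map_mul]; rfl
  | add x y hx hy => simp only [map_add, hx, hy]

end delta

section braid

variable (k) (i : Fin 2)

/-- The bimodule `R ⊗_{R^i} R ⊗_{R^j} R ⊗_{R^i} R`, where `{i, j} = {s, r}`. -/
noncomputable abbrev tripleInd : GrBimod k := indT {i} (indT {i.rev} (ind k {i}))

/-- The map `a ⊗ d ↦ a ⊗ 1 ⊗ 1 ⊗ d`. -/
noncomputable def braidIncl : ind k Set.univ →ₗ[k] tripleInd k i :=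
  it₂Lift ((it {i}).compl₂ (it {i.rev} 1 ∘ₗ it₂ {i} 1)) fun c hc a d => by
    have h (j) : c ∈ invariants k {j} := invariants_univ_le j hc
    simp only [LinearMap.compl₂_apply, LinearMap.comp_apply]
    rw [it_balanced (h i), it_left, it_balanced' (h i.rev), it₂_left, ← it₂_balanced (h i), mul_one,
      one_mul]

/-- The map `a ⊗ d ↦ a ⊗ (y ⊗ 1 - 1 ⊗ y') ⊗ d`. -/
noncomputable def deltaIncl : ind k {i} →ₗ[k] tripleInd k i :=
  it₂Lift ((it {i}).compl₂ (delta i.rev (ind k {i}) ∘ₗ it₂ {i} 1)) fun c hc a d => by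
    simp only [LinearMap.compl₂_apply, LinearMap.comp_apply]
    rw [it_balanced hc, ← delta_left, it₂_left, ← it₂_balanced hc, mul_one, one_mul]

/-- The map `a ⊗ b ⊗ c ⊗ d ↦ a ∂(b c) ⊗ d`. -/
noncomputable def deltaRetr : tripleInd k i →ₗ[k] ind k {i} :=
  itLift ((ind k {i}).left.toLinearMap.compl₂
    (coeffLeft (simpleBasis k i) le_rfl 1 ∘ₗ mulMap {i.rev} (ind k {i}))) fun c hc a t => by
    simp only [LinearMap.compl₂_apply, LinearMap.comp_apply, mulMap_left,
      coeffLeft_left (simpleBasis k i) le_rfl 1 hc, AlgHom.toLinearMap_apply, map_mul,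
      Module.End.mul_apply]

variable {k}

lemma braidIncl_it₂ (a d : Poly k) :
    braidIncl k i (it₂ Set.univ a d) = it {i} a (it {i.rev} 1 (it₂ {i} 1 d)) :=
  it₂Lift_it₂ _ _ _ _

lemma deltaIncl_it₂ (a d : Poly k) :
    deltaIncl k i (it₂ {i} a d) = it {i} a (delta i.rev (ind k {i}) (it₂ {i} 1 d)) :=
  it₂Lift_it₂ _ _ _ _

lemma deltaRetr_it (a b c d : Poly k) :
    deltaRetr k i (it {i} a (it {i.rev} b (it₂ {i} c d))) =
      it₂ {i} (a * (simpleBasis k i).coeff 1 (b * c)) d := by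
  refine (itLift_it _ _ _ _).trans ?_
  rw [LinearMap.compl₂_apply, LinearMap.comp_apply, mulMap_it, it₂_left, coeffLeft_it₂,
    AlgHom.toLinearMap_apply, it₂_left]

lemma coeff_one_X : (simpleBasis k i).coeff 1 (X 1) = 1 := by
  have := (simpleBasis k i).coeff_e 1 1
  rwa [if_pos rfl] at this

lemma coeff_one_of_mem {c : Poly k} (hc : c ∈ invariants k {i}) :
    (simpleBasis k i).coeff 1 c = 0 := by
  have h := (simpleBasis k i).coeff_e 1 0
  rw [if_neg (by decide)] at h
  have := (simpleBasis k i).coeff_mul hc ((simpleBasis k i).e 0) 1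
  rw [h, mul_zero] at this
  rwa [simpleBasis_e, Matrix.cons_val_zero, mul_one] at this

/-- The retraction reads off the y-coefficient of the product of the two middle factors, here 1 · 1.
-/
lemma deltaRetr_braidIncl (t : ind k Set.univ) : deltaRetr k i (braidIncl k i t) = 0 := by
  induction t using it₂_induction with
  | it₂ a d =>
    rw [braidIncl_it₂, deltaRetr_it, mul_one, coeff_one_of_mem i (one_mem _), mul_zero,
      LinearMap.map_zero₂]
  | add x y hx hy => rw [map_add, map_add, hx, hy, add_zero]

/-- The variable that the other reflection exchanges with y is fixed by reflection i. So of the two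
terms y ⊗ 1 and 1 ⊗ y' only the first has a y-coefficient over R^i, and it equals 1. -/
lemma deltaRetr_deltaIncl (t : ind k {i}) : deltaRetr k i (deltaIncl k i t) = t := by
  induction t using it₂_induction with
  | it₂ a d =>
    rw [deltaIncl_it₂, delta_apply, map_sub, map_sub, it₂_left, deltaRetr_it, deltaRetr_it, mul_one,
      coeff_one_X, one_mul, mul_one, mul_one, Fin.rev_rev, coeff_one_of_mem i (X_outer_mem i),
      mul_zero, LinearMap.map_zero₂, sub_zero]
  | add x y hx hy => rw [map_add, map_add, hx, hy]

lemma exists_word (i : Fin 2) (σ : S3) : ∃ σ₁ σ₂ σ₃ : S3, (σ₁ = 1 ∨ σ₁ = simpleRefl i) ∧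
    (σ₂ = 1 ∨ σ₂ = simpleRefl i.rev) ∧ (σ₃ = 1 ∨ σ₃ = simpleRefl i) ∧ σ = σ₁ * (σ₂ * σ₃) := by
  revert i σ; decide

/-- Every σ is a product σ₁σ₂σ₃ with σ₁, σ₃ in the group of reflection i and σ₂ in that of the other
one. Hence a ⊗ d ↦ a σ(d) factors through the inclusion as an iterated evaluation, and the six
evaluations are jointly injective. -/
lemma braidIncl_injective : Function.Injective (braidIncl k i) := by
  rw [injective_iff_map_eq_zero]
  intro t ht
  refine eq_zero_of_evalInd_eq_zero t fun σ => ?_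
  obtain ⟨σ₁, σ₂, σ₃, h₁, h₂, h₃, rfl⟩ := exists_word i σ
  have h3 := isTwisted_evalInd (k := k) (rename_of_mem_singleton h₃)
  have h2 := isTwisted_evalT (rename_of_mem_singleton h₂) h3
  have key (t : ind k Set.univ) :
      evalT (rename_of_mem_singleton h₁) h2 (braidIncl k i t) =
      evalInd (σ := σ₁ * (σ₂ * σ₃)) (fun _ hc => rename_of_mem_invariants hc _) t := by
    induction t using it₂_induction with
    | it₂ a d =>
      rw [braidIncl_it₂, evalInd_it₂, evalT_it, evalT_it, evalInd_it₂, one_mul, one_mul,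
        rename_mul_apply, rename_mul_apply]
    | add x y hx hy => rw [map_add, map_add, map_add, hx, hy]
  rw [← key, ht, map_zero]

lemma braidIncl_mem_hom : braidIncl k i ∈ hom (ind k Set.univ) (tripleInd k i) := by
  refine mem_hom_ind (fun p a b => ?_) (fun p a b => ?_) fun x y a ha b hb => ?_
  · rw [braidIncl_it₂, braidIncl_it₂, it_left]
  · rw [braidIncl_it₂, braidIncl_it₂, it_right, it_right, it₂_right]
  · rw [braidIncl_it₂]
    exact it_mem_gr rfl ha (it_mem_gr (zero_add _) one_mem_polyGr
      (it₂_mem_gr (zero_add _) one_mem_polyGr hb))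

lemma deltaIncl_mem_hom :
    deltaIncl k i ∘ₗ (shiftEquiv (ind k {i}) (-2)).symm.toLinearMap ∈
      hom ((ind k {i}).shift (-2)) (tripleInd k i) := by
  have hl (p t) : deltaIncl k i ((ind k {i}).left p t) =
      (tripleInd k i).left p (deltaIncl k i t) := by
    induction t using it₂_induction with
    | it₂ a b => rw [it₂_left, deltaIncl_it₂, deltaIncl_it₂, it_left]
    | add x y hx hy => simp only [map_add, hx, hy]
  have hr (p t) : deltaIncl k i ((ind k {i}).right p t) =
      (tripleInd k i).right p (deltaIncl k i t) := by
    induction t using it₂_induction with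
    | it₂ a b =>
      rw [it₂_right, deltaIncl_it₂, deltaIncl_it₂, it_right, ← delta_right, it₂_right]
    | add x y hx hy => simp only [map_add, hx, hy]
  refine ⟨fun p t => ?_, fun p t => ?_, fun d t ht => ?_⟩
  · obtain ⟨t, rfl⟩ := (shiftEquiv (ind k {i}) (-2)).surjective t
    exact hl p t
  · obtain ⟨t, rfl⟩ := (shiftEquiv (ind k {i}) (-2)).surjective t
    exact hr p t
  · obtain ⟨t, rfl⟩ := (shiftEquiv (ind k {i}) (-2)).surjective t
    rw [shiftEquiv_mem_gr] at ht
    rw [LinearMap.comp_apply, LinearEquiv.coe_coe, LinearEquiv.symm_apply_apply]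
    refine (ind_gr_le (S := ((tripleInd k i).gr d).comap (deltaIncl k i)) ?_) ht
    intro x y hxy a ha b hb
    rw [Submodule.mem_comap, deltaIncl_it₂]
    exact it_mem_gr (by omega) ha (delta_mem_gr (it₂_mem_gr (zero_add _) one_mem_polyGr hb))

/-- Both inner factors are reduced to 1 by pushing invariants outwards. Over R^i the second factor
reduces to 1 and y, with coefficients moving left, and the third to 1 and y, with coefficients
moving right. A second factor y is traded for an element of the second image. -/
lemma range_braidIncl_deltaIncl (t : tripleInd k i) :
    t ∈ LinearMap.range (braidIncl k i) ⊔ LinearMap.range (deltaIncl k i) := by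
  set S := LinearMap.range (braidIncl k i) ⊔ LinearMap.range (deltaIncl k i) with hS
  have h0 (a d : Poly k) : it {i} a (it {i.rev} 1 (it₂ {i} 1 d)) ∈ S :=
    Submodule.mem_sup_left ⟨it₂ _ a d, braidIncl_it₂ i a d⟩
  have h1 (a d : Poly k) : it {i} a (it {i.rev} (X 1) (it₂ {i} 1 d)) ∈ S := by
    have e : it {i} a (it {i.rev} (X 1) (it₂ {i} 1 d)) = deltaIncl k i (it₂ {i} a d) +
        it {i} a (it {i.rev} 1 (it₂ {i} 1 (X (outer i) * d))) := by
      rw [deltaIncl_it₂, delta_apply, map_sub, it₂_left, Fin.rev_rev, ← it₂_balanced (X_outer_mem i),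
        mul_one, one_mul, sub_add_cancel]
    rw [e]
    exact add_mem (Submodule.mem_sup_right ⟨_, rfl⟩) (h0 _ _)
  have h2 (a b d : Poly k) : it {i} a (it {i.rev} b (it₂ {i} 1 d)) ∈ S := by
    have e : it {i} a (it {i.rev} b (it₂ {i} 1 d)) =
        it {i} (a * (simpleBasis k i).coeff 0 b) (it {i.rev} 1 (it₂ {i} 1 d)) +
        it {i} (a * (simpleBasis k i).coeff 1 b) (it {i.rev} (X 1) (it₂ {i} 1 d)) := by
      rw [it_balanced ((simpleBasis k i).coeff_mem _ _),
        it_balanced ((simpleBasis k i).coeff_mem _ _), it_left, it_left, ← map_add,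
        ← LinearMap.add_apply, ← map_add, mul_one, ← simple_decomposition]
    rw [e]
    exact add_mem (h0 _ _) (h1 _ _)
  have h3 (a b d : Poly k) : it {i} a (it {i.rev} b (it₂ {i} (X 1) d)) ∈ S := by
    have hm : (X 1 + X (outer i) : Poly k) ∈ invariants k {i.rev} := by
      have := X_add_X_mem (k := k) i.rev
      rwa [Fin.rev_rev] at this
    -- Write y = (y + y') − y', with y' exchanged with y by the other reflection. The sum y + y'
    -- crosses the middle tensor sign to the left, and y' is fixed by reflection i and crosses the
    -- last one to the right.
    have e : it {i} a (it {i.rev} b (it₂ {i} (X 1) d)) =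
        it {i} a (it {i.rev} (b * (X 1 + X (outer i))) (it₂ {i} 1 d)) -
        it {i} a (it {i.rev} b (it₂ {i} 1 (X (outer i) * d))) := by
      rw [it_balanced hm, it₂_left, ← it₂_balanced (X_outer_mem i), ← map_sub, ← map_sub,
        ← LinearMap.sub_apply, ← map_sub, mul_one, one_mul, add_sub_cancel_right]
    rw [e]
    exact sub_mem (h2 _ _ _) (h2 _ _ _)
  induction t using it_induction with
  | it a t =>
    induction t using it_induction with
    | it b t =>
      induction t using it₂_induction with
      | it₂ c d =>
        have e : it₂ {i} c d = it₂ {i} 1 ((simpleBasis k i).coeff 0 c * d) +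
            it₂ {i} (X 1) ((simpleBasis k i).coeff 1 c * d) := by
          rw [← it₂_balanced ((simpleBasis k i).coeff_mem _ _),
            ← it₂_balanced ((simpleBasis k i).coeff_mem _ _), ← LinearMap.add_apply, ← map_add,
            one_mul, mul_comm (X 1), ← simple_decomposition]
        rw [e, map_add, map_add]
        exact add_mem (h2 _ _ _) (h3 _ _ _)
      | add x y hx hy => rw [map_add, map_add]; exact add_mem hx hy
    | add x y hx hy => rw [map_add]; exact add_mem hx hy
  | add x y hx hy => exact add_mem hx hy

/-- The retraction kills the first summand and is the identity on the second. Injectivity therefore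
reduces to that of `braidIncl`, and no projection onto the first summand has to be constructed. -/
lemma isIso_tripleInd :
    IsIso ((ind k Set.univ).sum ((ind k {i}).shift (-2))) (tripleInd k i) := by
  refine isIso_of_bijective (f := braidIncl k i ∘ₗ sumFst _ _ +
    (deltaIncl k i ∘ₗ (shiftEquiv (ind k {i}) (-2)).symm.toLinearMap) ∘ₗ sumSnd _ _)
    (add_mem (comp_mem_hom (braidIncl_mem_hom i) sumFst_mem_hom)
      (comp_mem_hom (deltaIncl_mem_hom i) sumSnd_mem_hom)) ⟨?_, ?_⟩
  · rw [injective_iff_map_eq_zero]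
    intro x hx
    simp only [LinearMap.add_apply, LinearMap.comp_apply, LinearEquiv.coe_coe] at hx
    have h2 : (shiftEquiv (ind k {i}) (-2)).symm (sumSnd _ _ x) = 0 := by
      have := congrArg (deltaRetr k i) hx
      rwa [map_add, deltaRetr_braidIncl, deltaRetr_deltaIncl, map_zero, zero_add] at this
    rw [h2, map_zero, add_zero] at hx
    rw [← sumInl_add_sumInr x, (injective_iff_map_eq_zero _).1 (braidIncl_injective i) _ hx,
      (LinearEquiv.map_eq_zero_iff _).1 h2, map_zero, map_zero, add_zero]
  · intro t
    obtain ⟨_, ⟨x, rfl⟩, _, ⟨y, rfl⟩, rfl⟩ := Submodule.mem_sup.1 (range_braidIncl_deltaIncl i t)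
    refine ⟨sumInl _ _ x + sumInr _ _ (shiftEquiv _ _ y), ?_⟩
    simp only [LinearMap.add_apply, LinearMap.comp_apply, map_add, sumFst_sumInl, sumFst_sumInr,
      sumSnd_sumInl, sumSnd_sumInr, map_zero, add_zero, zero_add, LinearEquiv.coe_coe,
      LinearEquiv.symm_apply_apply]

end braid

end SoergelS3

namespace SoergelS3

open GrBimod MvPolynomial

variable {k : Type u} [Field k]

/-! ## Bricks and multiplicities -/

namespace GrBimod

/-- `M` is nonzero, and its endomorphisms are scalars. -/
def IsBrick (M : GrBimod k) : Prop :=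
  Nontrivial M ∧ ∀ f ∈ hom M M, ∃ c : k, f = c • LinearMap.id

/-- The projection onto N is an endomorphism, hence a scalar. It is the identity on N and zero on P,
so N and P cannot both be nonzero. -/
lemma IsBrick.indecomposable {M : GrBimod k} (h : IsBrick M) : M.Indecomposable := by
  refine ⟨h.1, fun N P hNP => ?_⟩
  by_contra! hcon
  obtain ⟨hN, hP⟩ := hcon
  obtain ⟨n, hn⟩ := exists_ne (0 : N)
  obtain ⟨p, hp⟩ := exists_ne (0 : P)
  obtain ⟨f, hf, g, hg, hgf, hfg⟩ := hNP.exists_hom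
  have hfg' (x) : f (g x) = x := LinearMap.congr_fun hfg x
  obtain ⟨c, hc⟩ := h.2 (g ∘ₗ sumInl N P ∘ₗ sumFst N P ∘ₗ f)
    (comp_mem_hom hg (comp_mem_hom sumInl_mem_hom (comp_mem_hom sumFst_mem_hom hf)))
  have key (x : N.sum P) : sumInl N P (sumFst N P x) = c • x := by
    have := congrArg f (LinearMap.congr_fun hc (g x))
    rwa [LinearMap.comp_apply, LinearMap.comp_apply, LinearMap.comp_apply, hfg', hfg',
      LinearMap.smul_apply, map_smul, LinearMap.id_apply, hfg'] at this
  have h1 := congrArg (sumFst N P) (key (sumInl N P n))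
  have h2 := congrArg (sumSnd N P) (key (sumInr N P p))
  rw [sumFst_sumInl, sumFst_sumInl, map_smul, sumFst_sumInl] at h1
  rw [sumFst_sumInr, map_zero, map_zero, map_smul, sumSnd_sumInr] at h2
  rcases smul_eq_zero.1 h2.symm with rfl | h2
  · exact hn (by rw [h1, zero_smul])
  · exact hp h2

/-- If gf is a nonzero scalar, then f is injective. This forces the scalar fg to be nonzero too, and
f becomes an isomorphism. -/
lemma IsBrick.comp_eq_zero {X Y : GrBimod k} (hX : IsBrick X) (hY : IsBrick Y) (h : ¬ IsIso X Y)
    {f : X →ₗ[k] Y} (hf : f ∈ hom X Y) {g : Y →ₗ[k] X} (hg : g ∈ hom Y X) : g ∘ₗ f = 0 := by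
  obtain ⟨c, hc⟩ := hX.2 _ (comp_mem_hom hg hf)
  obtain ⟨d, hd⟩ := hY.2 _ (comp_mem_hom hf hg)
  by_cases hc0 : c = 0
  · rw [hc, hc0, zero_smul]
  exfalso
  have hgf (x) : g (f x) = c • x := LinearMap.congr_fun hc x
  have hfg (y) : f (g y) = d • y := LinearMap.congr_fun hd y
  have hinj : Function.Injective f := by
    rw [injective_iff_map_eq_zero]
    intro x hx
    have := hgf x
    rw [hx, map_zero] at this
    exact (smul_eq_zero.1 this.symm).resolve_left hc0
  have hd0 : d ≠ 0 := by
    rintro rfl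
    have := hX.1
    obtain ⟨x, hx⟩ := exists_ne (0 : X)
    have h1 := hfg (f x)
    rw [hgf, zero_smul, map_smul] at h1
    exact hx (hinj (((smul_eq_zero.1 h1).resolve_left hc0).trans (map_zero f).symm))
  exact h (isIso_of_bijective hf ⟨hinj, fun y => ⟨d⁻¹ • g y, by
    rw [map_smul, hfg, smul_smul, inv_mul_cancel₀ hd0, one_smul]⟩⟩)

variable {X M N : GrBimod k}

variable (X M) in
/-- The homomorphisms `X → M` whose composition with every homomorphism `M → X` is zero. -/
def rad : Submodule k (hom X M) where
  carrier := {f | ∀ g ∈ hom M X, g ∘ₗ f.1 = 0}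
  add_mem' {f f'} hf hf' g hg := by
    have : g ∘ₗ (f + f').1 = g ∘ₗ f.1 + g ∘ₗ f'.1 := LinearMap.comp_add _ _ _
    rw [this, hf g hg, hf' g hg, add_zero]
  zero_mem' g _ := LinearMap.comp_zero g
  smul_mem' c f hf g hg := by
    have : g ∘ₗ (c • f).1 = c • (g ∘ₗ f.1) := LinearMap.comp_smul _ _ _
    rw [this, hf g hg, smul_zero]

variable (X M) in
/-- The multiplicity of `X` as a direct summand of `M`, if the endomorphisms of `X` are scalars. -/
noncomputable def mult : Cardinal.{u} := Module.rank k (hom X M ⧸ rad X M)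

lemma mult_eq_rank {V : Type u} [AddCommGroup V] [Module k V] (F : hom X M →ₗ[k] V)
    (hF : Function.Surjective F) (h : ∀ f, F f = 0 ↔ f ∈ rad X M) :
    mult X M = Module.rank k V := by
  have hk : LinearMap.ker F = rad X M := Submodule.ext h
  rw [mult, ← hk]
  exact (F.quotKerEquivOfSurjective hF).rank_eq

lemma mult_eq_zero (h : ∀ f ∈ hom X M, ∀ g ∈ hom M X, g ∘ₗ f = 0) : mult X M = 0 := by
  rw [mult_eq_rank (0 : hom X M →ₗ[k] PUnit.{u + 1}) (fun _ => ⟨0, Subsingleton.elim _ _⟩)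
    fun f => ⟨fun _ => h f.1 f.2, fun _ => Subsingleton.elim _ _⟩]
  exact rank_subsingleton' k PUnit.{u + 1}

/-- Hom(X, X) is the line spanned by the identity, and the identity is not in `rad`. -/
lemma IsBrick.mult_self (h : IsBrick X) : mult X X = 1 := by
  have := h.1
  let F : k →ₗ[k] hom X X ⧸ rad X X :=
    (rad X X).mkQ ∘ₗ LinearMap.toSpanSingleton k (hom X X) ⟨LinearMap.id, id_mem_hom⟩
  have hF : Function.Bijective F := by
    constructor
    · rw [injective_iff_map_eq_zero]
      intro c hc
      obtain ⟨x, hx⟩ := exists_ne (0 : X)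
      have h1 := LinearMap.congr_fun ((Submodule.Quotient.mk_eq_zero _).1 hc _ id_mem_hom) x
      exact (smul_eq_zero.1 h1).resolve_right hx
    · intro q
      obtain ⟨⟨f, hf⟩, rfl⟩ := Submodule.Quotient.mk_surjective _ q
      obtain ⟨c, rfl⟩ := h.2 f hf
      exact ⟨c, rfl⟩
  rw [mult, ← (LinearEquiv.ofBijective F hF).rank_eq, Module.rank_self]

/-- Composition with a homomorphism `M → N`. -/
def postcomp (X : GrBimod k) {g : M →ₗ[k] N} (hg : g ∈ hom M N) : hom X M →ₗ[k] hom X N where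
  toFun f := ⟨g ∘ₗ f.1, comp_mem_hom hg f.2⟩
  map_add' _ _ := Subtype.ext (LinearMap.comp_add _ _ _)
  map_smul' _ _ := Subtype.ext (LinearMap.comp_smul _ _ _)

lemma postcomp_coe {g : M →ₗ[k] N} (hg : g ∈ hom M N) (f : hom X M) :
    (postcomp X hg f).1 = g ∘ₗ f.1 := rfl

lemma postcomp_mem_rad {g : M →ₗ[k] N} (hg : g ∈ hom M N) {f : hom X M} (hf : f ∈ rad X M) :
    postcomp X hg f ∈ rad X N := fun g' hg' => by
  rw [postcomp_coe, ← LinearMap.comp_assoc]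
  exact hf _ (comp_mem_hom hg' hg)

lemma IsIso.mult_eq (h : IsIso M N) : mult X M = mult X N := by
  obtain ⟨f, hf, g, hg, hgf, hfg⟩ := h.exists_hom
  have h1 (a) : postcomp X hf (postcomp X hg a) = a := Subtype.ext (by
    rw [postcomp_coe, postcomp_coe, ← LinearMap.comp_assoc, hfg, LinearMap.id_comp])
  have h2 (a) : postcomp X hg (postcomp X hf a) = a := Subtype.ext (by
    rw [postcomp_coe, postcomp_coe, ← LinearMap.comp_assoc, hgf, LinearMap.id_comp])
  refine mult_eq_rank ((rad X N).mkQ ∘ₗ postcomp X hf)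
    ((Submodule.mkQ_surjective _).comp fun a => ⟨_, h1 a⟩) fun a => ?_
  rw [LinearMap.comp_apply, Submodule.mkQ_apply, Submodule.Quotient.mk_eq_zero]
  refine ⟨fun ha => ?_, postcomp_mem_rad hf⟩
  rw [← h2 a]
  exact postcomp_mem_rad hg ha

/-- A map to a direct sum lies in `rad` exactly when both of its components do. -/
lemma mult_sum : mult X (M.sum N) = mult X M + mult X N := by
  have hs (f : hom X (M.sum N)) : postcomp X sumInl_mem_hom (postcomp X sumFst_mem_hom f) +
      postcomp X sumInr_mem_hom (postcomp X sumSnd_mem_hom f) = f :=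
    Subtype.ext (LinearMap.ext fun x => sumInl_add_sumInr (f.1 x))
  rw [mult, mult, mult, ← rank_prod']
  refine mult_eq_rank (((rad X M).mkQ ∘ₗ postcomp X sumFst_mem_hom).prod
    ((rad X N).mkQ ∘ₗ postcomp X sumSnd_mem_hom)) ?_ fun f => ?_
  · rintro ⟨a, b⟩
    obtain ⟨a, rfl⟩ := Submodule.mkQ_surjective _ a
    obtain ⟨b, rfl⟩ := Submodule.mkQ_surjective _ b
    refine ⟨postcomp X sumInl_mem_hom a + postcomp X sumInr_mem_hom b, Prod.ext ?_ ?_⟩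
    · refine congrArg (rad X M).mkQ (Subtype.ext (LinearMap.ext fun x => ?_))
      exact (map_add (sumFst M N) _ _).trans
        (by rw [postcomp_coe, postcomp_coe, LinearMap.comp_apply, sumFst_sumInl, LinearMap.comp_apply,
          sumFst_sumInr, add_zero])
    · refine congrArg (rad X N).mkQ (Subtype.ext (LinearMap.ext fun x => ?_))
      exact (map_add (sumSnd M N) _ _).trans
        (by rw [postcomp_coe, postcomp_coe, LinearMap.comp_apply, sumSnd_sumInl, LinearMap.comp_apply,
          sumSnd_sumInr, zero_add])
  · change ((rad X M).mkQ (postcomp X sumFst_mem_hom f), (rad X N).mkQ (postcomp X sumSnd_mem_hom f)) =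
      0 ↔ _
    rw [Prod.mk_eq_zero, Submodule.mkQ_apply, Submodule.mkQ_apply, Submodule.Quotient.mk_eq_zero,
      Submodule.Quotient.mk_eq_zero]
    refine ⟨fun h => ?_, fun h => ⟨postcomp_mem_rad _ h, postcomp_mem_rad _ h⟩⟩
    rw [← hs f]
    exact add_mem (postcomp_mem_rad _ h.1) (postcomp_mem_rad _ h.2)

end GrBimod

/-! ### Multiplicities in finite sums and Krull–Schmidt -/

lemma isIso_listSum_of_perm {L L' : List (GrBimod k)} (h : L.Perm L') :
    IsIso (listSum L) (listSum L') := by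
  induction h with
  | nil => exact IsIso.refl _
  | cons M _ ih => exact (IsIso.refl M).sum ih
  | swap M N L => exact ((isIso_sum_assoc N M _).symm.trans
      ((isIso_sum_comm N M).sum (IsIso.refl _))).trans (isIso_sum_assoc M N _)
  | trans _ _ ih ih' => exact ih.trans ih'

lemma mult_listSum {ι : Type*} [DecidableEq ι] {B : ι → GrBimod k} (hB : ∀ i, IsBrick (B i))
    (h : ∀ i j, IsIso (B i) (B j) → i = j) (i : ι) (L : List ι) :
    mult (B i) (listSum (L.map B)) = L.count i := by
  induction L with
  | nil =>
    rw [List.map_nil, List.count_nil, Nat.cast_zero]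
    exact mult_eq_zero fun f _ g _ => LinearMap.ext fun x =>
      (congrArg g (Subsingleton.elim (α := PUnit) (f x) 0)).trans (map_zero g)
  | cons j L ih =>
    rw [List.map_cons, listSum_cons, mult_sum, ih, List.count_cons]
    by_cases hij : j = i
    · subst hij
      rw [(hB j).mult_self, beq_self_eq_true, if_pos rfl, Nat.cast_add, Nat.cast_one, add_comm]
    · have hij' : (j == i) = false := beq_false_of_ne hij
      rw [mult_eq_zero fun f hf g hg =>
        (hB i).comp_eq_zero (hB j) (fun hi => hij (h i j hi).symm) hf hg, hij']
      simp

/-- The Krull–Schmidt property. -/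
lemma perm_of_isIso_listSum {ι : Type*} [DecidableEq ι] {B : ι → GrBimod k}
    (hB : ∀ i, IsBrick (B i)) (h : ∀ i j, IsIso (B i) (B j) → i = j) {L L' : List ι}
    (hL : IsIso (listSum (L.map B)) (listSum (L'.map B))) : L.Perm L' := by
  rw [List.perm_iff_count]
  intro i
  have := hL.mult_eq (X := B i)
  rw [mult_listSum hB h, mult_listSum hB h] at this
  exact_mod_cast this

/-! ### Cyclic bimodules -/

lemma monomial_mem_polyGr (s : Fin 3 →₀ ℕ) (c : k) :
    (monomial s c : Poly k) ∈ polyGr k (2 * ((s 0 : ℤ) + s 1 + s 2)) := by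
  refine isWeightedHomogeneous_monomial _ _ _ ?_
  rw [Finsupp.weight_apply, Finsupp.sum_fintype _ _ (by simp), Fin.sum_univ_three]
  simp only [nsmul_eq_mul]
  ring

namespace GrBimod

/-- `M` is generated by a nonzero element of degree `d`. -/
def IsCyclic (M : GrBimod k) (d : ℤ) : Prop :=
  ∃ u ∈ M.gr d, u ≠ 0 ∧ Submodule.span k {m | ∃ p q, M.left p (M.right q u) = m} = ⊤

variable {M N : GrBimod k} {d e : ℤ}

/-- For monomials p and q, the degree of p u q is at least that of u, with equality only for
constants. So nothing lives below degree d, and degree d contributes multiples of u only. -/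
lemma exists_proj_left_right {u : M} (hu : u ∈ M.gr d) (p q : Poly k) :
    ∃ c : k, ∀ e ≤ d, M.proj e (M.left p (M.right q u)) = if e = d then c • u else 0 := by
  have hadd {x y : M} (hx : ∃ c : k, ∀ e ≤ d, M.proj e x = if e = d then c • u else 0)
      (hy : ∃ c : k, ∀ e ≤ d, M.proj e y = if e = d then c • u else 0) :
      ∃ c : k, ∀ e ≤ d, M.proj e (x + y) = if e = d then c • u else 0 := by
    obtain ⟨a, ha⟩ := hx
    obtain ⟨b, hb⟩ := hy
    refine ⟨a + b, fun e he => ?_⟩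
    rw [map_add, ha e he, hb e he]
    split_ifs
    · rw [add_smul]
    · rw [add_zero]
  induction p using MvPolynomial.induction_on' with
  | add p p' hp hp' => rw [map_add, LinearMap.add_apply]; exact hadd hp hp'
  | monomial s a =>
    induction q using MvPolynomial.induction_on' with
    | add q q' hq hq' => rw [map_add, LinearMap.add_apply, map_add]; exact hadd hq hq'
    | monomial t b =>
      have hm := M.left_mem (monomial_mem_polyGr s a) (M.right_mem (monomial_mem_polyGr t b) hu)
      by_cases h0 : (s 0 : ℤ) + s 1 + s 2 + (t 0 + t 1 + t 2) = 0
      · have hs : s = 0 := by ext i; fin_cases i <;> simp <;> omega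
        have ht : t = 0 := by ext i; fin_cases i <;> simp <;> omega
        subst hs ht
        refine ⟨a * b, fun e _ => ?_⟩
        have h1 (c : k) : (monomial 0 c : Poly k) = algebraMap k (Poly k) c := rfl
        rw [M.proj_apply hm, h1, h1, AlgHom.commutes, AlgHom.commutes, Module.algebraMap_end_apply,
          Module.algebraMap_end_apply, smul_smul]
        simp [eq_comm]
      · refine ⟨0, fun e he => ?_⟩
        rw [M.proj_ne hm (by omega), zero_smul, ite_self]

/-- The induction principle needs no case for scalars, since they can be absorbed into p. -/
lemma IsCyclic.exists_generator (h : IsCyclic M d) : ∃ u ∈ M.gr d, u ≠ 0 ∧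
    (∀ {P : M → Prop}, (∀ p q, P (M.left p (M.right q u))) → (∀ x y, P x → P y → P (x + y)) →
      ∀ m, P m) ∧
    ∀ m, ∃ c : k, ∀ e ≤ d, M.proj e m = if e = d then c • u else 0 := by
  obtain ⟨u, hu, hu0, hs⟩ := h
  have hP {P : M → Prop} (h1 : ∀ p q, P (M.left p (M.right q u)))
      (h2 : ∀ x y, P x → P y → P (x + y)) (m : M) : P m := by
    have hm : m ∈ Submodule.span k {m | ∃ p q, M.left p (M.right q u) = m} := hs ▸ trivial
    induction hm using Submodule.closure_induction with
    | zero => simpa using h1 0 0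
    | add x y _ _ hx hy => exact h2 x y hx hy
    | smul_mem c x hx =>
      obtain ⟨p, q, rfl⟩ := hx
      have := h1 (c • p) q
      rwa [map_smul] at this
  refine ⟨u, hu, hu0, hP, hP (exists_proj_left_right hu) ?_⟩
  rintro x y ⟨a, ha⟩ ⟨b, hb⟩
  refine ⟨a + b, fun e he => ?_⟩
  rw [map_add, ha e he, hb e he]
  split_ifs
  · rw [add_smul]
  · rw [add_zero]

/-- The part of degree d is the line through the generator u. An endomorphism preserves it, so it
multiplies u by a scalar, and then all of M. -/
lemma IsCyclic.isBrick (h : IsCyclic M d) : IsBrick M := by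
  obtain ⟨u, hu, hu0, hP, hproj⟩ := h.exists_generator
  refine ⟨⟨u, 0, hu0⟩, fun f hf => ?_⟩
  obtain ⟨c, hc⟩ := hproj (f u)
  have hfu : f u = c • u := by
    have := hc d le_rfl
    rwa [M.proj_same (hf.2.2 d u hu), if_pos rfl] at this
  refine ⟨c, LinearMap.ext fun m => hP (P := fun m => f m = c • m) (fun p q => ?_)
    (fun x y hx hy => by rw [map_add, hx, hy, smul_add]) m⟩
  rw [hf.1, hf.2.1, hfu, map_smul, map_smul]

lemma IsCyclic.of_isIso (h : IsCyclic M d) (hMN : IsIso M N) : IsCyclic N d := by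
  obtain ⟨u, hu, hu0, hs⟩ := h
  obtain ⟨e, h1, h2, h3⟩ := hMN
  refine ⟨e u, (h3 d u).2 hu, (LinearEquiv.map_ne_zero_iff e).2 hu0, ?_⟩
  have := congrArg (Submodule.map e.toLinearMap) hs
  rw [Submodule.map_span, Submodule.map_top, LinearEquiv.range] at this
  rw [← this]
  congr 1
  ext n
  constructor
  · rintro ⟨p, q, rfl⟩
    exact ⟨_, ⟨p, q, rfl⟩, (h1 _ _).trans (congrArg _ (h2 _ _))⟩
  · rintro ⟨_, ⟨p, q, rfl⟩, rfl⟩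
    exact ⟨p, q, ((h1 _ _).trans (congrArg _ (h2 _ _))).symm⟩

lemma IsCyclic.shift (h : IsCyclic M d) {n : ℤ} (he : d = n + e) : IsCyclic (M.shift n) e := by
  subst he; exact h

/-- The degree of a generator is the lowest degree in which M is nonzero. -/
lemma IsCyclic.degree_le (h : IsCyclic M d) (h' : IsCyclic M e) : d ≤ e := by
  obtain ⟨u, hu, hu0, -, hproj⟩ := h.exists_generator
  obtain ⟨v, hv, hv0, -⟩ := h'
  by_contra! hlt
  obtain ⟨c, hc⟩ := hproj v
  have := hc e hlt.le
  rw [M.proj_same hv, if_neg hlt.ne] at this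
  exact hv0 this

lemma IsCyclic.degree_eq (h : IsCyclic M d) (h' : IsCyclic M e) : d = e :=
  (h.degree_le h').antisymm (h'.degree_le h)

end GrBimod

end SoergelS3

namespace SoergelS3

open GrBimod MvPolynomial

variable {k : Type u} [Field k]

/-! ## The six bimodules -/

lemma isIso_Bgen_tensor (i : Fin 2) (N : GrBimod k) :
    IsIso ((Bgen k i).tensor N) ((indT {i} N).shift 1) :=
  (isIso_shift_tensorOver _ (ind k {i}) N 1).trans ((isIso_ind_tensor N).shift 1)

lemma isIso_Bgen_tensor_shift (i : Fin 2) (N : GrBimod k) (n : ℤ) :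
    IsIso ((Bgen k i).tensor (N.shift n)) ((indT {i} N).shift (n + 1)) :=
  (isIso_Bgen_tensor i _).trans (((isIso_indT_shift N n).shift 1).trans (isIso_shift_shift _ _ _))

lemma BW_one : BW k 1 = regular k := if_pos rfl

lemma BW_simple (i : Fin 2) : BW k (simpleRefl i) = (ind k {i}).shift 1 := by
  fin_cases i
  · exact (if_neg (by decide)).trans (if_pos rfl)
  · exact (if_neg (by decide)).trans ((if_neg (by decide)).trans (if_pos rfl))

lemma BW_mul (i : Fin 2) :
    BW k (simpleRefl i * simpleRefl i.rev) = (Bgen k i).tensor (Bgen k i.rev) := by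
  fin_cases i
  · exact (if_neg (by decide)).trans ((if_neg (by decide)).trans
      ((if_neg (by decide)).trans (if_pos rfl)))
  · exact (if_neg (by decide)).trans ((if_neg (by decide)).trans
      ((if_neg (by decide)).trans ((if_neg (by decide)).trans (if_pos rfl))))

lemma BW_longest : BW k longest = (ind k Set.univ).shift 3 :=
  (if_neg (by decide)).trans ((if_neg (by decide)).trans ((if_neg (by decide)).trans
    ((if_neg (by decide)).trans (if_neg (by decide)))))

lemma isIso_BW_mul (i : Fin 2) : IsIso (BW k (simpleRefl i * simpleRefl i.rev))
    ((indT {i} (ind k {i.rev})).shift 2) := by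
  rw [BW_mul]
  exact isIso_Bgen_tensor_shift i (ind k {i.rev}) 1

/-! ### Generators -/

lemma isCyclic_regular : IsCyclic (regular k) 0 := by
  refine ⟨toReg k 1, toReg_mem_gr.2 one_mem_polyGr, (LinearEquiv.map_ne_zero_iff _).2 one_ne_zero,
    Submodule.eq_top_iff'.2 fun m => Submodule.subset_span ⟨(toReg k).symm m, 1, ?_⟩⟩
  rw [reg_right, reg_left, mul_one, mul_one, LinearEquiv.apply_symm_apply]

lemma it₂_one_one_ne_zero (I : Set (Fin 2)) : it₂ (k := k) I 1 1 ≠ 0 := fun h => by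
  have := evalInd_it₂ (I := I) rename_one_of_mem (1 : Poly k) 1
  rw [h, map_zero, map_one, mul_one] at this
  exact zero_ne_one this

lemma isCyclic_ind (I : Set (Fin 2)) : IsCyclic (ind k I) 0 := by
  refine ⟨it₂ I 1 1, it₂_mem_gr (add_zero 0) one_mem_polyGr one_mem_polyGr, it₂_one_one_ne_zero I,
    Submodule.eq_top_iff'.2 fun m => ?_⟩
  induction m using it₂_induction with
  | it₂ a b =>
    refine Submodule.subset_span ⟨a, b, ?_⟩
    rw [it₂_right, it₂_left, mul_one, mul_one]
  | add x y hx hy => exact add_mem hx hy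

/-- The middle factor dissolves. Its coefficients over R^i go to the left, and the remaining y = (y
+ y') − y' is shared out: y + y' is invariant under reflection i and goes left, y' is invariant
under the other one and goes right. -/
lemma span_indT_ind (i : Fin 2) : Submodule.span k
    {m | ∃ p q, (indT {i} (ind k {i.rev})).left p ((indT {i} (ind k {i.rev})).right q
      (it {i} 1 (it₂ {i.rev} 1 1))) = m} = ⊤ := by
  set S := Submodule.span k
    {m | ∃ p q, (indT {i} (ind k {i.rev})).left p ((indT {i} (ind k {i.rev})).right q
      (it {i} 1 (it₂ {i.rev} 1 1))) = m} with hS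
  have key (a d : Poly k) : it {i} a (it₂ {i.rev} 1 d) ∈ S := by
    refine Submodule.subset_span ⟨a, d, ?_⟩
    rw [it_right, it₂_right, it_left, mul_one, mul_one]
  refine Submodule.eq_top_iff'.2 fun m => ?_
  induction m using ind_ind_induction with
  | it a b d =>
    have e : it {i} a (it₂ {i.rev} b d) =
        it {i} (a * (simpleBasis k i).coeff 0 b) (it₂ {i.rev} 1 d) +
        (it {i} (a * (simpleBasis k i).coeff 1 b * (X 1 + X (outer i.rev))) (it₂ {i.rev} 1 d) -
        it {i} (a * (simpleBasis k i).coeff 1 b) (it₂ {i.rev} 1 (X (outer i.rev) * d))) := by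
      rw [it_balanced (X_add_X_mem i), ← it₂_balanced (X_outer_mem i.rev), ← map_sub, it₂_left,
        ← LinearMap.sub_apply, ← map_sub, mul_one, one_mul, add_sub_cancel_right,
        it_balanced ((simpleBasis k i).coeff_mem _ _),
        it_balanced ((simpleBasis k i).coeff_mem _ _), it₂_left, it₂_left, ← map_add,
        ← LinearMap.add_apply, ← map_add, mul_one, ← simple_decomposition]
    rw [e]
    exact add_mem (key _ _) (sub_mem (key _ _) (key _ _))
  | add x y hx hy => exact add_mem hx hy

lemma isCyclic_indT_ind (i : Fin 2) : IsCyclic (indT {i} (ind k {i.rev})) 0 := by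
  refine ⟨it {i} 1 (it₂ {i.rev} 1 1), it_mem_gr (add_zero 0) one_mem_polyGr
    (it₂_mem_gr (add_zero 0) one_mem_polyGr one_mem_polyGr), fun h => ?_, span_indT_ind i⟩
  have := congrArg (mulMap {i} (ind k {i.rev})) h
  rw [mulMap_it, map_zero, map_one] at this
  exact it₂_one_one_ne_zero _ this

/-- The length function of `S_3`. -/
def len (w : S3) : ℤ := (redWord w).length

/-- The generator is the tensor product of ones, in degree 0 before the shift by the length of w
that is built into B_w. -/
lemma isCyclic_BW (w : S3) : IsCyclic (BW k w) (-len w) := by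
  have hs (i : Fin 2) : IsCyclic (BW k (simpleRefl i)) (-len (simpleRefl i)) := by
    rw [BW_simple]
    exact (isCyclic_ind {i}).shift (by revert i; decide)
  have hsr (i : Fin 2) : IsCyclic (BW k (simpleRefl i * simpleRefl i.rev))
      (-len (simpleRefl i * simpleRefl i.rev)) :=
    ((isCyclic_indT_ind i).shift (n := 2) (by revert i; decide)).of_isIso (isIso_BW_mul i).symm
  induction w using S3_induction with
  | h1 => rw [BW_one]; exact isCyclic_regular
  | hs => exact hs 0
  | hr => exact hs 1
  | hsr => exact hsr 0
  | hrs => exact hsr 1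
  | hl => rw [BW_longest]; exact (isCyclic_ind _).shift (by decide)

lemma isCyclic_BW_shift (p : S3 × ℤ) : IsCyclic ((BW k p.1).shift p.2) (-len p.1 - p.2) :=
  (isCyclic_BW p.1).shift (by ring)

/-! ### Twisted maps distinguish the six bimodules -/

namespace GrBimod

/-- There is a nonzero map `g : M → R` with `g (p m q) = p g(m) σ(q)`. -/
def Sees (M : GrBimod k) (σ : S3) : Prop := ∃ g : M →ₗ[k] Poly k, g ≠ 0 ∧ IsTwisted σ g

variable {M N : GrBimod k} {σ : S3}

lemma Sees.of_isIso (h : Sees M σ) (hMN : IsIso M N) : Sees N σ := by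
  obtain ⟨g, hg, hl, hr⟩ := h
  obtain ⟨e, h1, h2, -⟩ := hMN.symm
  refine ⟨g ∘ₗ e.toLinearMap, fun h => hg (LinearMap.ext fun m => ?_), fun p n => ?_, fun p n => ?_⟩
  · obtain ⟨n, rfl⟩ := e.surjective m
    exact LinearMap.congr_fun h n
  · exact (congrArg g (h1 p n)).trans (hl _ _)
  · exact (congrArg g (h2 p n)).trans (hr _ _)

lemma Sees.shift (h : Sees M σ) (n : ℤ) : Sees (M.shift n) σ := by
  obtain ⟨g, hg, hl, hr⟩ := h
  exact ⟨g ∘ₗ (shiftEquiv M n).symm.toLinearMap, hg, hl, hr⟩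

lemma Sees.of_shift {n : ℤ} (h : Sees (M.shift n) σ) : Sees M σ := by
  obtain ⟨g, hg, hl, hr⟩ := h
  exact ⟨g ∘ₗ (shiftEquiv M n).toLinearMap, hg, hl, hr⟩

end GrBimod

/-- Left and right multiplication agree on R, so g(1) σ(p) = p g(1). -/
lemma sees_regular {σ : S3} (h : Sees (regular k) σ) : σ = 1 := by
  obtain ⟨g, hg, hl, hr⟩ := h
  have h1 (p : Poly k) : g (toReg k p) = p * g (toReg k 1) := by
    rw [← hl, reg_left, mul_one]
  have h0 : g (toReg k 1) ≠ 0 := fun h0 => hg (LinearMap.ext fun p => by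
    obtain ⟨p, rfl⟩ := (toReg k).surjective p
    rw [h1, h0, mul_zero, LinearMap.zero_apply])
  refine Equiv.ext fun i => X_injective (R := k) (mul_left_cancel₀ h0 ?_)
  rw [← rename_X σ, ← hr, reg_right, mul_one, h1, mul_comm, Equiv.Perm.one_apply]

/-- The variable fixed by reflection i acts on 1 ⊗ 1 in the same way from the left and from the
right. -/
lemma sees_ind {i : Fin 2} {σ : S3} (h : Sees (ind k {i}) σ) : σ (outer i) = outer i := by
  obtain ⟨g, hg, hl, hr⟩ := h
  have h1 (p q : Poly k) : g (it₂ {i} p q) = p * (g (it₂ {i} 1 1) * rename σ q) := by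
    rw [← hr, it₂_right, ← hl, it₂_left, mul_one, mul_one]
  have h0 : g (it₂ {i} 1 1) ≠ 0 := fun h0 => hg (it₂_ext fun p q => by
    rw [h1, h0, zero_mul, mul_zero, LinearMap.zero_apply])
  refine X_injective (R := k) (mul_left_cancel₀ h0 ?_)
  have h2 := h1 1 (X (outer i))
  rw [one_mul, rename_X] at h2
  rw [← h2, mul_comm (g _), ← hl, it₂_left, mul_one, ← one_mul (X (outer i)),
    it₂_balanced (X_outer_mem i), mul_one, one_mul]

lemma outer_facts (i : Fin 2) : 1 ≠ outer i ∧ outer i.rev ≠ outer i := by revert i; decide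

lemma sees_indT_ind {i : Fin 2} {σ : S3} (h : Sees (indT {i} (ind k {i.rev})) σ) :
    σ (outer i.rev) ≠ outer i := by
  intro hσ
  obtain ⟨g, hg, hl, hr⟩ := h
  set o : Poly k := X (outer i) with ho
  set o' : Poly k := X (outer i.rev) with ho'
  set F : Poly k → Poly k := fun b => g (it {i} 1 (it₂ {i.rev} b 1)) with hF
  have hFl (c b : Poly k) (hc : c ∈ invariants k {i}) : F (c * b) = c * F b := by
    simp only [hF]
    rw [← hl, it_left, mul_one, ← one_mul c, it_balanced hc, it₂_left, one_mul]
  have hFr (c b : Poly k) (hc : c ∈ invariants k {i.rev}) : F (b * c) = F b * rename σ c := by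
    simp only [hF]
    rw [← hr, it_right, it₂_right, it₂_balanced hc]
  have hFadd (a b : Poly k) : F (a + b) = F a + F b := by
    simp only [hF, map_add, LinearMap.add_apply]
  have h0 : F 1 ≠ 0 := fun h0 => hg (LinearMap.ext_on (span_indT_ind i) (by
    rintro _ ⟨p, q, rfl⟩
    rw [hl, hr, LinearMap.zero_apply]
    exact mul_eq_zero_of_right _ (mul_eq_zero_of_left h0 _)))
  -- The sum y + o' lies in R^i, so F(y) + F(o') = (y + o') F(1). Also o' lies in the other ring of
  -- invariants, so F(o') = F(1) σ(o') = F(1) o.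
  have hy : F (X 1) = (X 1 + o' - o) * F 1 := by
    have h1 := hFl _ 1 (X_add_X_mem i)
    have h2 := hFr _ 1 (X_outer_mem i.rev)
    rw [mul_one, hFadd] at h1
    rw [one_mul, rename_X, hσ] at h2
    rw [sub_mul, ← h1, h2]
    ring
  -- F(o y) is computed twice, with o taken out on the left and with o y taken out on the right.
  -- After cancelling F(1) this reads o(y + o' − o) = σ(y) σ(o).
  have hyo := hFr _ 1 (X_mul_X_mem i.rev)
  rw [Fin.rev_rev, one_mul, mul_comm (X 1), hFl _ _ (X_outer_mem i), hy, mul_comm (F 1), ← mul_assoc,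
    map_mul, rename_X, rename_X] at hyo
  -- At the point where o is 1 and the other two variables are 0, the left side is −1. The right
  -- side is 0, since σ(o') = o forces σ(y) ≠ o.
  have h1 := congrArg (eval (Pi.single (outer i) 1)) (mul_right_cancel₀ h0 hyo)
  have e1 : (1 : Fin 3) ≠ outer i := (outer_facts i).1
  have e2 : σ 1 ≠ outer i := fun h => outer_rev_ne_one i (σ.injective (hσ.trans h.symm))
  have e3 : outer i.rev ≠ outer i := (outer_facts i).2
  simp [ho, ho', Pi.single_eq_of_ne e1, Pi.single_eq_of_ne e2, Pi.single_eq_of_ne e3] at h1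

lemma sees_BW_self (w : S3) : Sees (BW k w) w := by
  have hi (i : Fin 2) := isTwisted_evalInd (k := k) (rename_of_mem_singleton (i := i) (Or.inr rfl))
  have hs (i : Fin 2) : Sees (BW k (simpleRefl i)) (simpleRefl i) := by
    rw [BW_simple]
    refine Sees.shift ⟨_, fun h => ?_, hi i⟩ 1
    have := LinearMap.congr_fun h (it₂ {i} 1 1)
    rw [evalInd_it₂, map_one, mul_one] at this
    exact one_ne_zero this
  have hsr (i : Fin 2) :
      Sees (BW k (simpleRefl i * simpleRefl i.rev)) (simpleRefl i * simpleRefl i.rev) := by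
    refine Sees.of_isIso (Sees.shift ⟨_, fun h => ?_,
      isTwisted_evalT (rename_of_mem_singleton (i := i) (Or.inr rfl)) (hi i.rev)⟩ 2)
      (isIso_BW_mul i).symm
    have := LinearMap.congr_fun h (it {i} 1 (it₂ {i.rev} 1 1))
    rw [evalT_it, evalInd_it₂, map_one, mul_one, map_one, mul_one] at this
    exact one_ne_zero this
  induction w using S3_induction with
  | h1 =>
    rw [BW_one]
    refine ⟨_, fun h => ?_, isTwisted_regular⟩
    exact one_ne_zero (LinearMap.congr_fun h (toReg k 1))
  | hs => exact hs 0
  | hr => exact hs 1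
  | hsr => exact hsr 0
  | hrs => exact hsr 1
  | hl =>
    rw [BW_longest]
    refine Sees.shift ⟨_, fun h => ?_,
      isTwisted_evalInd fun _ hc => rename_of_mem_invariants hc longest⟩ 3
    have := LinearMap.congr_fun h (it₂ Set.univ 1 1)
    rw [evalInd_it₂, map_one, mul_one] at this
    exact one_ne_zero this

/-- For `w ≠ srs`, this says that `v ≤ w` in the Bruhat order. -/
def Below (w v : S3) : Prop := (w = 1 → v = 1) ∧
  (∀ i, w = simpleRefl i → v (outer i) = outer i) ∧
  ∀ i, w = simpleRefl i * simpleRefl i.rev → v (outer i.rev) ≠ outer i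

instance (w v : S3) : Decidable (Below w v) := inferInstanceAs (Decidable (_ ∧ _ ∧ _))

lemma Below.antisymm : ∀ {w v : S3}, Below w v → Below v w → w = v := by decide

lemma below_of_sees {w v : S3} (h : Sees (BW k w) v) : Below w v := by
  refine ⟨?_, ?_, ?_⟩
  · rintro rfl
    exact sees_regular (by rwa [BW_one] at h)
  · rintro i rfl
    rw [BW_simple] at h
    exact sees_ind h.of_shift
  · rintro i rfl
    exact sees_indT_ind (h.of_isIso (isIso_BW_mul i)).of_shift

/-- Each B_w sees w itself, so isomorphic bimodules have labels below each other, hence equal. The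
degree of the generator then fixes the shift. -/
lemma eq_of_isIso_BW_shift {p q : S3 × ℤ}
    (h : IsIso ((BW k p.1).shift p.2) ((BW k q.1).shift q.2)) : p = q := by
  have h1 : p.1 = q.1 := Below.antisymm
    (below_of_sees (((sees_BW_self q.1).shift q.2).of_isIso h.symm).of_shift)
    (below_of_sees (((sees_BW_self p.1).shift p.2).of_isIso h).of_shift)
  have h2 := ((isCyclic_BW_shift p).of_isIso h).degree_eq (isCyclic_BW_shift q)
  rw [h1] at h2
  exact Prod.ext h1 (by omega)

/-- The direct sum of the bimodules `B_w(m)` for the pairs `(w, m)` in a list. -/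
noncomputable abbrev sumBW (k : Type u) [Field k] (L : List (S3 × ℤ)) : GrBimod k :=
  listSum (L.map fun p => (BW k p.1).shift p.2)

lemma perm_of_isIso_sumBW {L L' : List (S3 × ℤ)} (h : IsIso (sumBW k L) (sumBW k L')) :
    L.Perm L' :=
  perm_of_isIso_listSum (fun p => (isCyclic_BW_shift p).isBrick)
    (fun _ _ => eq_of_isIso_BW_shift) h

end SoergelS3

namespace SoergelS3

open GrBimod

variable {k : Type u} [Field k]

/-! ## Characters of Soergel bimodules -/

/-- The Kazhdan–Lusztig elements as a basis of the Hecke algebra. -/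
noncomputable def klBasis : Module.Basis S3 ℤ[T;T⁻¹] Hecke :=
  Module.Basis.mk linearIndependent_bKL span_bKL.ge

lemma klBasis_apply (w : S3) : klBasis w = bKL w := Module.Basis.mk_apply _ _ _

/-- The element `v ^ m b_w` of the Hecke algebra. -/
noncomputable def klShift (p : S3 × ℤ) : Hecke := (LaurentPolynomial.T p.2 : ℤ[T;T⁻¹]) • bKL p.1

/-- The elements `v ^ m b_w` form a basis of the Hecke algebra over `ℤ`. -/
noncomputable def klShiftBasis : Module.Basis (S3 × ℤ) ℤ Hecke :=
  ((AddMonoidAlgebra.basis ℤ ℤ).smulTower klBasis).reindex (Equiv.prodComm ℤ S3)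

lemma klShiftBasis_apply (p : S3 × ℤ) : klShiftBasis p = klShift p := by
  rw [klShiftBasis, Module.Basis.reindex_apply, Equiv.prodComm_symm, Equiv.prodComm_apply,
    Module.Basis.smulTower_apply, klBasis_apply, AddMonoidAlgebra.basis_apply]
  rfl

/-- The element `∑ v ^ m b_w`, the sum being over the pairs `(w, m)` in a list. -/
noncomputable def charOf (L : List (S3 × ℤ)) : Hecke := (L.map klShift).sum

lemma repr_charOf (L : List (S3 × ℤ)) (p : S3 × ℤ) :
    klShiftBasis.repr (charOf L) p = L.count p := by
  induction L with
  | nil => simp [charOf]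
  | cons q L ih =>
    have h : charOf (q :: L) = klShiftBasis q + charOf L := by
      rw [klShiftBasis_apply, charOf, List.map_cons, List.sum_cons, charOf]
    rw [h, map_add, Finsupp.add_apply, ih, Module.Basis.repr_self, List.count_cons, Nat.cast_add,
      add_comm, Finsupp.single_apply]
    simp

/-- The coordinates of `charOf L` in the ℤ-basis v^m b_w are the multiplicities in L. -/
lemma charOf_eq_iff {L L' : List (S3 × ℤ)} : charOf L = charOf L' ↔ L.Perm L' := by
  refine ⟨fun h => List.perm_iff_count.2 fun p => ?_, fun h => (h.map _).sum_eq⟩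
  have := repr_charOf L p
  rw [h, repr_charOf] at this
  exact_mod_cast this.symm

lemma charOf_append (L L' : List (S3 × ℤ)) : charOf (L ++ L') = charOf L + charOf L' := by
  rw [charOf, List.map_append, List.sum_append, charOf, charOf]

/-- The list `L` with all shifts increased by `n`. -/
def shiftList (n : ℤ) (L : List (S3 × ℤ)) : List (S3 × ℤ) := L.map fun p => (p.1, p.2 + n)

lemma T_smul_klShift (n : ℤ) (p : S3 × ℤ) :
    (LaurentPolynomial.T n : ℤ[T;T⁻¹]) • klShift p = klShift (p.1, p.2 + n) := by
  rw [klShift, klShift, smul_smul, ← LaurentPolynomial.T_add, add_comm]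

lemma charOf_shiftList (n : ℤ) (L : List (S3 × ℤ)) :
    charOf (shiftList n L) = (LaurentPolynomial.T n : ℤ[T;T⁻¹]) • charOf L := by
  rw [charOf, charOf, shiftList, List.smul_sum, List.map_map, List.map_map]
  simp only [Function.comp_def, T_smul_klShift]

lemma isIso_listSum_append (L L' : List (GrBimod k)) :
    IsIso ((listSum L).sum (listSum L')) (listSum (L ++ L')) := by
  induction L with
  | nil => exact isIso_zero_sum _
  | cons M L ih => exact (isIso_sum_assoc M _ _).trans ((IsIso.refl M).sum ih)

lemma isIso_sumBW_append (L L' : List (S3 × ℤ)) :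
    IsIso ((sumBW k L).sum (sumBW k L')) (sumBW k (L ++ L')) := by
  rw [sumBW, sumBW, sumBW, List.map_append]
  exact isIso_listSum_append _ _

lemma isIso_sumBW_shift (n : ℤ) (L : List (S3 × ℤ)) :
    IsIso ((sumBW k L).shift n) (sumBW k (shiftList n L)) := by
  induction L with
  | nil => exact isIso_zero_shift n
  | cons p L ih => exact (isIso_sum_shift _ _ n).trans ((isIso_shift_shift _ _ _).sum ih)

/-- `M` is a Soergel bimodule with image `h` in the Hecke algebra. -/
def HasChar (M : GrBimod k) (h : Hecke) : Prop := ∃ L, IsIso M (sumBW k L) ∧ charOf L = h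

variable {M N : GrBimod k} {h h' : Hecke}

lemma isSoergel_iff : IsSoergel M ↔ ∃ h, HasChar M h :=
  ⟨fun ⟨L, hL⟩ => ⟨_, L, hL, rfl⟩, fun ⟨_, L, hL, _⟩ => ⟨L, hL⟩⟩

lemma HasChar.isSoergel (hM : HasChar M h) : IsSoergel M := isSoergel_iff.2 ⟨h, hM⟩

lemma HasChar.of_isIso (hM : HasChar M h) (hMN : IsIso M N) : HasChar N h := by
  obtain ⟨L, hL, rfl⟩ := hM
  exact ⟨L, hMN.symm.trans hL, rfl⟩

/-- By Krull–Schmidt the character does not depend on the chosen decomposition. -/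
lemma HasChar.eq_of_isIso (hM : HasChar M h) (hN : HasChar N h') (hMN : IsIso M N) : h = h' := by
  obtain ⟨L, hL, rfl⟩ := hM
  obtain ⟨L', hL', rfl⟩ := hN
  exact charOf_eq_iff.2 (perm_of_isIso_sumBW ((hL.symm.trans hMN).trans hL'))

lemma HasChar.isIso (hM : HasChar M h) (hN : HasChar N h) : IsIso M N := by
  obtain ⟨L, hL, rfl⟩ := hM
  obtain ⟨L', hL', hLL'⟩ := hN
  exact (hL.trans (isIso_listSum_of_perm ((charOf_eq_iff.1 hLL'.symm).map _))).trans hL'.symm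

lemma HasChar.sum (hM : HasChar M h) (hN : HasChar N h') : HasChar (M.sum N) (h + h') := by
  obtain ⟨L, hL, rfl⟩ := hM
  obtain ⟨L', hL', rfl⟩ := hN
  exact ⟨L ++ L', (hL.sum hL').trans (isIso_sumBW_append L L'), charOf_append L L'⟩

lemma HasChar.shift (hM : HasChar M h) (n : ℤ) :
    HasChar (M.shift n) ((LaurentPolynomial.T n : ℤ[T;T⁻¹]) • h) := by
  obtain ⟨L, hL, rfl⟩ := hM
  exact ⟨shiftList n L, (hL.shift n).trans (isIso_sumBW_shift n L), charOf_shiftList n L⟩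

lemma hasChar_zero : HasChar (GrBimod.zero : GrBimod k) 0 := ⟨[], IsIso.refl _, rfl⟩

lemma hasChar_sumBW (L : List (S3 × ℤ)) : HasChar (sumBW k L) (charOf L) := ⟨L, IsIso.refl _, rfl⟩

lemma hasChar_BW_shift (w : S3) (n : ℤ) : HasChar ((BW k w).shift n) (klShift (w, n)) :=
  ⟨[(w, n)], isIso_sum_zero _, add_zero _⟩

lemma hasChar_BW (w : S3) : HasChar (BW k w) (bKL w) := by
  have := (hasChar_BW_shift (k := k) w 0).of_isIso (isIso_shift_zero _).symm
  rwa [klShift, LaurentPolynomial.T_zero, one_smul] at this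

lemma hasChar_listSum {ι : Type*} {N : ι → GrBimod k} {c : ι → Hecke} (hN : ∀ j, HasChar (N j) (c j))
    (L : List ι) : HasChar (listSum (L.map N)) (L.map c).sum := by
  induction L with
  | nil => exact hasChar_zero
  | cons j L ih => exact (hN j).sum ih

lemma hasChar_listSum_univ {ι : Type*} [Fintype ι] {N : ι → GrBimod k} {c : ι → Hecke}
    (hN : ∀ j, HasChar (N j) (c j)) : HasChar (listSum (Finset.univ.toList.map N)) (∑ j, c j) := by
  rw [← Finset.sum_map_toList]
  exact hasChar_listSum hN _

lemma HasChar.shift_of_shift {m n : ℤ} (hM : HasChar (M.shift m) h) (hn : n = m + n') :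
    HasChar (M.shift n) ((LaurentPolynomial.T n' : ℤ[T;T⁻¹]) • h) := by
  subst hn
  exact (hM.shift n').of_isIso (isIso_shift_shift _ _ _)

lemma hasChar_ind_singleton (i : Fin 2) (n : ℤ) :
    HasChar ((ind k {i}).shift n) ((LaurentPolynomial.T (n - 1) : ℤ[T;T⁻¹]) • bGen i) := by
  have h := hasChar_BW (k := k) (simpleRefl i)
  rw [BW_simple, bKL_simple] at h
  exact h.shift_of_shift (by ring)

lemma hasChar_ind_univ (n : ℤ) :
    HasChar ((ind k Set.univ).shift n) ((LaurentPolynomial.T (n - 3) : ℤ[T;T⁻¹]) • bKL longest) := by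
  have h := hasChar_BW (k := k) longest
  rw [BW_longest] at h
  exact h.shift_of_shift (by ring)

/-! ### Products -/

lemma isIso_tensor_sum (M N P : GrBimod k) :
    IsIso (M.tensor (N.sum P)) ((M.tensor N).sum (M.tensor P)) :=
  isIso_tensorOver_sum _ _ _ _

lemma isIso_sum_tensor (M N P : GrBimod k) :
    IsIso ((M.sum N).tensor P) ((M.tensor P).sum (N.tensor P)) :=
  isIso_sum_tensorOver _ _ _ _

lemma isIso_tensor_shift (M N : GrBimod k) (n : ℤ) :
    IsIso (M.tensor (N.shift n)) ((M.tensor N).shift n) :=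
  isIso_tensorOver_shift _ _ _ _

lemma isIso_shift_tensor (M N : GrBimod k) (n : ℤ) :
    IsIso ((M.shift n).tensor N) ((M.tensor N).shift n) :=
  isIso_shift_tensorOver _ _ _ _

lemma isIso_tensor_assoc (M N P : GrBimod k) :
    IsIso ((M.tensor N).tensor P) (M.tensor (N.tensor P)) :=
  isIso_assoc _ _ _ _ _

lemma GrBimod.IsIso.tensor {M M' N N' : GrBimod k} (h : IsIso M M') (h' : IsIso N N') :
    IsIso (M.tensor N) (M'.tensor N') :=
  IsIso.tensorOver h h'

lemma isIso_zero_of_subsingleton (h : ∀ x : M, x = 0) : IsIso M GrBimod.zero :=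
  isIso_of_inverse (f := 0) (g := 0) (zero_mem _) (LinearMap.ext fun x => (h x).symm)
    (LinearMap.ext fun _ => rfl)

lemma isIso_tensorOver_zero {A : Subalgebra k (Poly k)} (hA : IsGradedSubalg A) (M : GrBimod k) :
    IsIso (M.tensorOver A hA GrBimod.zero) GrBimod.zero :=
  isIso_zero_of_subsingleton fun t => by
    induction t using tm_induction with
    | tm m n => exact (tm hA m).map_zero
    | add x y hx hy => rw [hx, hy, add_zero]

lemma isIso_zero_tensorOver {A : Subalgebra k (Poly k)} (hA : IsGradedSubalg A) (M : GrBimod k) :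
    IsIso (GrBimod.zero.tensorOver A hA M) GrBimod.zero :=
  isIso_zero_of_subsingleton fun t => by
    induction t using tm_induction with
    | tm m n => exact LinearMap.map_zero₂ (tm hA) n
    | add x y hx hy => rw [hx, hy, add_zero]

/-- Multiplication by `M` on the left corresponds to multiplication by `h`. -/
def LeftChar (M : GrBimod k) (h : Hecke) : Prop :=
  ∀ (N : GrBimod k) (n : Hecke), HasChar N n → HasChar (M.tensor N) (h * n)

lemma leftChar_of_BW (H : ∀ w, HasChar (M.tensor (BW k w)) (h * bKL w)) : LeftChar M h := by
  rintro N _ ⟨L, hL, rfl⟩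
  refine HasChar.of_isIso ?_ ((IsIso.refl M).tensor hL.symm)
  clear hL
  induction L with
  | nil =>
    rw [charOf, List.map_nil, List.sum_nil, mul_zero]
    exact hasChar_zero.of_isIso (isIso_tensorOver_zero _ M).symm
  | cons p L ih =>
    have h1 : charOf (p :: L) = klShift p + charOf L := by
      rw [charOf, List.map_cons, List.sum_cons, charOf]
    rw [h1, mul_add, klShift, mul_smul_comm]
    exact (((H p.1).shift p.2).of_isIso (isIso_tensor_shift _ _ _).symm |>.sum ih).of_isIso
      (isIso_tensor_sum _ _ _).symm

lemma LeftChar.tensor (hM : LeftChar M h) (hN : LeftChar N h') : LeftChar (M.tensor N) (h * h') :=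
  fun P p hP => by
    rw [mul_assoc]
    exact (hM _ _ (hN P p hP)).of_isIso (isIso_tensor_assoc M N P).symm

/-- M(PN) ≅ (MP)N ≅ (MN)(1) ⊕ (MN)(−1). It is applied with P = B_i and with M = B_i or M = B_srs,
and plays the role of `bGen_sq` and `longest_mul_bGen`. -/
lemma HasChar.tensor_of_isIso_shift_sum_shift {P : GrBimod k}
    (hMP : IsIso (M.tensor P) ((M.shift 1).sum (M.shift (-1)))) (hMN : HasChar (M.tensor N) h) :
    HasChar (M.tensor (P.tensor N)) (quantumTwo • h) := by
  rw [quantumTwo, add_smul]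
  exact ((hMN.shift 1).of_isIso (isIso_shift_tensor _ _ _).symm |>.sum
    ((hMN.shift (-1)).of_isIso (isIso_shift_tensor _ _ _).symm)).of_isIso
    (((isIso_sum_tensor _ _ _).symm.trans (hMP.symm.tensor (IsIso.refl N))).trans
      (isIso_tensor_assoc _ _ _))

lemma hasChar_shift_simpleBasis {J : Set (Fin 2)} {c : ℤ}
    (hJ : ∀ n, HasChar ((ind k J).shift n) ((LaurentPolynomial.T (n - c) : ℤ[T;T⁻¹]) • h))
    (i : Fin 2) (m : ℤ) (hm : m = c + 1) :
    HasChar ((listSum ((Finset.univ : Finset (Fin 2)).toList.map fun j =>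
      (ind k J).shift (-(simpleBasis k i).deg j))).shift m) (quantumTwo • h) := by
  have := (hasChar_listSum_univ fun j => hJ (-(simpleBasis k i).deg j)).shift m
  rw [Fin.sum_univ_two, smul_add, smul_smul, smul_smul, ← LaurentPolynomial.T_add,
    ← LaurentPolynomial.T_add, simpleBasis_deg, ← add_smul] at this
  -- The basis elements 1 and y have degrees 0 and 2; the total shift c + 1 centres these to the
  -- exponents 1 and −1.
  have e0 : m + (-![0, 2] (0 : Fin 2) - c) = 1 := by rw [Matrix.cons_val_zero]; omega
  have e1 : m + (-![0, 2] (1 : Fin 2) - c) = -1 := by rw [Matrix.cons_val_one]; simp; omega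
  rwa [e0, e1] at this

/-! ### Left multiplication by `B_s` and `B_r` -/

lemma hasChar_Bgen (i : Fin 2) : HasChar (Bgen k i) (bGen i) := by
  have h := hasChar_BW (k := k) (simpleRefl i)
  rwa [BW_simple, bKL_simple] at h

lemma bKL_mul (i : Fin 2) : bKL (simpleRefl i * simpleRefl i.rev) = bGen i * bGen i.rev := by
  fin_cases i
  · exact bKL_sr
  · exact bKL_rs

lemma bGen_mul_rev_mul (i : Fin 2) : bGen i * (bGen i.rev * bGen i) = bKL longest + bGen i := by
  fin_cases i
  · exact (congrArg _ bKL_rs.symm).trans bGen_zero_mul_rs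
  · exact (congrArg _ bKL_sr.symm).trans bGen_one_mul_sr

lemma isIso_tensor_of_hasChar (hM : HasChar M h) {P : GrBimod k}
    (hP : HasChar (M.tensor P) (quantumTwo • h)) :
    IsIso (M.tensor P) ((M.shift 1).sum (M.shift (-1))) := by
  rw [quantumTwo, add_smul] at hP
  exact hP.isIso ((hM.shift 1).sum (hM.shift (-1)))

lemma hasChar_Bgen_Bgen (i : Fin 2) :
    HasChar ((Bgen k i).tensor (Bgen k i)) (quantumTwo • bGen i) :=
  (hasChar_shift_simpleBasis (hasChar_ind_singleton i) i 2 rfl).of_isIso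
    (((isIso_indT_ind_left (simpleBasis k i) le_rfl).symm.shift 2).trans
      (isIso_Bgen_tensor_shift i (ind k {i}) 1).symm)

lemma hasChar_Bgen_longest (i : Fin 2) :
    HasChar ((Bgen k i).tensor (BW k longest)) (quantumTwo • bKL longest) := by
  rw [BW_longest]
  exact (hasChar_shift_simpleBasis hasChar_ind_univ i 4 rfl).of_isIso
    (((isIso_indT_ind_left (simpleBasis k i) (invariants_univ_le i)).symm.shift 4).trans
      (isIso_Bgen_tensor_shift i (ind k Set.univ) 3).symm)

/-- The three factors shift `tripleInd` by 3. This makes the first summand B_srs, and the shift −2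
of the second becomes 1, which gives B_i. -/
lemma hasChar_Bgen_Bgen_Bgen (i : Fin 2) :
    HasChar ((Bgen k i).tensor ((Bgen k i.rev).tensor (Bgen k i))) (bKL longest + bGen i) := by
  have h1 : IsIso ((tripleInd k i).shift 3)
      ((Bgen k i).tensor ((Bgen k i.rev).tensor (Bgen k i))) :=
    (isIso_Bgen_tensor_shift i _ 2).symm.trans
      ((IsIso.refl _).tensor (isIso_Bgen_tensor_shift i.rev (ind k {i}) 1).symm)
  refine HasChar.of_isIso ?_ (((isIso_tripleInd i).shift 3).trans h1)
  have h2 := (hasChar_ind_univ (k := k) 0).of_isIso (isIso_shift_zero _).symm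
  have h3 := (h2.sum (hasChar_ind_singleton i (-2))).shift 3
  rw [smul_add, smul_smul, smul_smul, ← LaurentPolynomial.T_add, ← LaurentPolynomial.T_add] at h3
  norm_num at h3
  exact h3

lemma leftChar_Bgen (i : Fin 2) : LeftChar (Bgen k i) (bGen i) := by
  have hs : HasChar ((Bgen k i).tensor (BW k (simpleRefl i))) (bGen i * bKL (simpleRefl i)) := by
    rw [BW_simple, bKL_simple, bGen_sq]
    exact hasChar_Bgen_Bgen i
  have hr : HasChar ((Bgen k i).tensor (BW k (simpleRefl i.rev)))
      (bGen i * bKL (simpleRefl i.rev)) := by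
    rw [BW_simple, bKL_simple, ← bKL_mul]
    have := hasChar_BW (k := k) (simpleRefl i * simpleRefl i.rev)
    rwa [BW_mul] at this
  have hsr : HasChar ((Bgen k i).tensor (BW k (simpleRefl i * simpleRefl i.rev)))
      (bGen i * bKL (simpleRefl i * simpleRefl i.rev)) := by
    rw [BW_mul, bKL_mul, ← mul_assoc, bGen_sq, smul_mul_assoc, ← bKL_mul]
    -- B_i B_i B_j is split through B_i B_i ≅ B_i(1) ⊕ B_i(−1).
    refine HasChar.tensor_of_isIso_shift_sum_shift
      (isIso_tensor_of_hasChar (hasChar_Bgen i) (hasChar_Bgen_Bgen i)) ?_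
    rw [← BW_mul]
    exact hasChar_BW _
  have hrs : HasChar ((Bgen k i).tensor (BW k (simpleRefl i.rev * simpleRefl i)))
      (bGen i * bKL (simpleRefl i.rev * simpleRefl i)) := by
    have h1 := BW_mul (k := k) i.rev
    have h2 := bKL_mul i.rev
    rw [Fin.rev_rev] at h1 h2
    rw [h1, h2, bGen_mul_rev_mul]
    exact hasChar_Bgen_Bgen_Bgen i
  refine leftChar_of_BW fun w => ?_
  have h1 : HasChar ((Bgen k i).tensor (BW k 1)) (bGen i * bKL 1) := by
    rw [BW_one, bKL_one, mul_one]
    exact (hasChar_Bgen i).of_isIso (isIso_tensor_regular _).symm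
  have hl : HasChar ((Bgen k i).tensor (BW k longest)) (bGen i * bKL longest) := by
    rw [bGen_mul_longest]
    exact hasChar_Bgen_longest i
  induction w using S3_induction with
  | h1 => exact h1
  | hs => fin_cases i <;> assumption
  | hr => fin_cases i <;> assumption
  | hsr => fin_cases i <;> assumption
  | hrs => fin_cases i <;> assumption
  | hl => exact hl

/-! ### Left multiplication by `B_{srs}` -/

lemma isIso_BW_longest_tensor (N : GrBimod k) (n : ℤ) :
    IsIso ((BW k longest).tensor (N.shift n)) ((indT Set.univ N).shift (n + 3)) := by
  rw [BW_longest]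
  exact (isIso_shift_tensor _ _ _).trans ((((isIso_ind_tensor _).trans
    (isIso_indT_shift N n)).shift 3).trans (isIso_shift_shift _ _ _))

lemma hasChar_longest_Bgen (i : Fin 2) :
    HasChar ((BW k longest).tensor (Bgen k i)) (quantumTwo • bKL longest) :=
  (hasChar_shift_simpleBasis hasChar_ind_univ i 4 rfl).of_isIso
    (((isIso_indT_ind_right (simpleBasis k i) (invariants_univ_le i)).symm.shift 4).trans
      (isIso_BW_longest_tensor (ind k {i}) 1).symm)

lemma hasChar_longest_Bgen_tensor (i : Fin 2) {N : GrBimod k}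
    (hN : HasChar ((BW k longest).tensor N) h) :
    HasChar ((BW k longest).tensor ((Bgen k i).tensor N)) (quantumTwo • h) :=
  HasChar.tensor_of_isIso_shift_sum_shift
    (isIso_tensor_of_hasChar (hasChar_BW longest) (hasChar_longest_Bgen i)) hN

/-- Each b_i acts on b_srs by q = v + v⁻¹, so b_srs acts by q³ − q = v³ + 2v + 2v⁻¹ + v⁻³. The
exponents are 3 minus the degrees 2a + 2b of the basis y^a z^b. -/
lemma longest_mul_longest : bKL longest * bKL longest =
    ∑ j : Fin 2 × Fin 3, (LaurentPolynomial.T (3 - (2 * (j.1 : ℤ) + 2 * (j.2 : ℤ))) : ℤ[T;T⁻¹]) •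
      bKL longest := by
  have h : bKL longest * bKL longest =
      (quantumTwo * (quantumTwo * quantumTwo) - quantumTwo) • bKL longest := by
    nth_rewrite 2 [bKL_longest]
    rw [mul_sub, ← mul_assoc, ← mul_assoc, longest_mul_bGen, smul_mul_assoc, longest_mul_bGen,
      smul_mul_assoc, smul_mul_assoc, longest_mul_bGen, sub_smul, mul_smul, mul_smul]
  rw [h, ← Finset.sum_smul, Fintype.sum_prod_type, Fin.sum_univ_two, Fin.sum_univ_three,
    Fin.sum_univ_three, quantumTwo]
  congr 1
  simp only [mul_add, add_mul, ← LaurentPolynomial.T_add]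
  norm_num
  abel

lemma hasChar_longest_longest :
    HasChar ((BW k longest).tensor (BW k longest)) (bKL longest * bKL longest) := by
  have h1 : IsIso ((BW k longest).tensor (BW k longest))
      ((indT Set.univ (ind k Set.univ)).shift 6) := by
    have := isIso_BW_longest_tensor (ind k Set.univ) 3
    rwa [← BW_longest] at this
  refine HasChar.of_isIso ?_
    (((isIso_indT_ind_left (symmBasis k) le_rfl).symm.shift 6).trans h1.symm)
  have := (hasChar_listSum_univ fun j => hasChar_ind_univ (k := k) (-(symmBasis k).deg j)).shift 6
  rw [Finset.smul_sum] at this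
  rw [longest_mul_longest]
  convert this using 1
  refine Finset.sum_congr rfl fun j _ => ?_
  rw [smul_smul, ← LaurentPolynomial.T_add, symmBasis_deg]
  congr 2
  ring

lemma leftChar_longest : LeftChar (BW k longest) (bKL longest) := by
  have hsr (i : Fin 2) : HasChar ((BW k longest).tensor (BW k (simpleRefl i * simpleRefl i.rev)))
      (bKL longest * bKL (simpleRefl i * simpleRefl i.rev)) := by
    rw [BW_mul, bKL_mul, ← mul_assoc, longest_mul_bGen, smul_mul_assoc, longest_mul_bGen]
    exact hasChar_longest_Bgen_tensor i (hasChar_longest_Bgen _)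
  have hs (i : Fin 2) : HasChar ((BW k longest).tensor (BW k (simpleRefl i)))
      (bKL longest * bKL (simpleRefl i)) := by
    rw [BW_simple, bKL_simple, longest_mul_bGen]
    exact hasChar_longest_Bgen i
  refine leftChar_of_BW fun w => ?_
  induction w using S3_induction with
  | h1 =>
    rw [BW_one, bKL_one, mul_one]
    exact (hasChar_BW _).of_isIso (isIso_tensor_regular _).symm
  | hs => exact hs 0
  | hr => exact hs 1
  | hsr => exact hsr 0
  | hrs => exact hsr 1
  | hl => exact hasChar_longest_longest

/-! ### Products of Soergel bimodules -/

lemma leftChar_BW (w : S3) : LeftChar (BW k w) (bKL w) := by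
  have hs (i : Fin 2) : LeftChar (BW k (simpleRefl i)) (bKL (simpleRefl i)) := by
    rw [BW_simple, bKL_simple]
    exact leftChar_Bgen i
  have hsr (i : Fin 2) : LeftChar (BW k (simpleRefl i * simpleRefl i.rev))
      (bKL (simpleRefl i * simpleRefl i.rev)) := by
    rw [BW_mul, bKL_mul]
    exact (leftChar_Bgen i).tensor (leftChar_Bgen i.rev)
  induction w using S3_induction with
  | h1 =>
    rw [BW_one, bKL_one]
    intro N n hN
    rw [one_mul]
    exact hN.of_isIso (isIso_regular_tensor N).symm
  | hs => exact hs 0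
  | hr => exact hs 1
  | hsr => exact hsr 0
  | hrs => exact hsr 1
  | hl => exact leftChar_longest

/-- Distributivity and shifts on the left reduce this to `leftChar_BW`, which already allows an
arbitrary right factor with a character. -/
lemma HasChar.tensor (hM : HasChar M h) (hN : HasChar N h') : HasChar (M.tensor N) (h * h') := by
  obtain ⟨L, hL, rfl⟩ := hM
  refine HasChar.of_isIso ?_ (hL.symm.tensor (IsIso.refl N))
  clear hL
  induction L with
  | nil =>
    rw [charOf, List.map_nil, List.sum_nil, zero_mul]
    exact hasChar_zero.of_isIso (isIso_zero_tensorOver _ N).symm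
  | cons p L ih =>
    have h1 : charOf (p :: L) = klShift p + charOf L := by
      rw [charOf, List.map_cons, List.sum_cons, charOf]
    rw [h1, add_mul, klShift, smul_mul_assoc]
    exact (((leftChar_BW p.1 N h' hN).shift p.2).of_isIso (isIso_shift_tensor _ _ _).symm |>.sum
      ih).of_isIso (isIso_sum_tensor _ _ _).symm

end SoergelS3

namespace SoergelS3

open GrBimod

variable {k : Type u} [Field k]

/-! ## Indecomposable Soergel bimodules -/

lemma indecomposable_BW_shift (p : S3 × ℤ) : ((BW k p.1).shift p.2).Indecomposable :=
  (isCyclic_BW_shift p).isBrick.indecomposable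

lemma existsUnique_isIso_of_indecomposable {M : GrBimod k} (hM : IsSoergel M)
    (hi : M.Indecomposable) : ∃! p : S3 × ℤ, M.IsIso ((BW k p.1).shift p.2) := by
  obtain ⟨L, hL⟩ := hM
  have key : ∃ p : S3 × ℤ, M.IsIso ((BW k p.1).shift p.2) := by
    cases L with
    | nil =>
      obtain ⟨e, -⟩ := hL
      have := hi.1
      obtain ⟨x, hx⟩ := exists_ne (0 : M)
      exact absurd (e.injective (Subsingleton.elim (α := PUnit) (e x) (e 0))) hx
    | cons p L =>
      refine ⟨p, ?_⟩
      -- The first summand B_w(m) is nonzero, so indecomposability makes the rest of the sum vanish.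
      rcases hi.2 _ _ hL with h | h
      · exact absurd h (not_subsingleton_iff_nontrivial.2 (indecomposable_BW_shift p).1)
      · exact hL.trans (((IsIso.refl _).sum
          (isIso_zero_of_subsingleton fun x => Subsingleton.elim x 0)).trans (isIso_sum_zero _).symm)
  obtain ⟨p, hp⟩ := key
  exact ⟨p, hp, fun q hq => eq_of_isIso_BW_shift (hq.symm.trans hp)⟩

/-! ## The image of a Soergel bimodule in the Hecke algebra -/

/-- The image of a Soergel bimodule in the Hecke algebra. -/
noncomputable def SBim.char (M : SBim k) : Hecke := (isSoergel_iff.1 M.2).choose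

lemma SBim.hasChar (M : SBim k) : HasChar M.1 M.char := (isSoergel_iff.1 M.2).choose_spec

lemma SBim.char_eq {M : SBim k} {N : GrBimod k} {h : Hecke} (hMN : IsIso M.1 N) (hN : HasChar N h) :
    M.char = h :=
  M.hasChar.eq_of_isIso hN hMN

lemma SBim.char_eq_iff {M N : SBim k} : M.char = N.char ↔ isoClass M = isoClass N := by
  refine ⟨fun h => Quotient.sound (M.hasChar.isIso (h ▸ N.hasChar)), fun h => ?_⟩
  have hMN : IsIso M.1 N.1 := Quotient.exact h
  exact SBim.char_eq hMN N.hasChar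

lemma SBim.char_ofW (w : S3) : (SBim.ofW k w).char = bKL w :=
  SBim.char_eq (IsIso.refl _) (hasChar_BW w)

lemma SBim.char_ofWShift (w : S3) (n : ℤ) : (SBim.ofWShift k w n).char = klShift (w, n) :=
  SBim.char_eq (IsIso.refl _) (hasChar_BW_shift w n)

/-! ## The positive part of the Hecke algebra -/

lemma natLaurent_T_smul (n : ℤ) (x : Hecke) :
    (LaurentPolynomial.T n : LaurentPolynomial ℕ) • x = (LaurentPolynomial.T n : ℤ[T;T⁻¹]) • x := by
  rw [natLaurent_smul, natLaurentInclusion_T]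

/-- A coefficient in ℕ[v, v⁻¹] is a finite sum of powers of v, so a positive combination is the same
as a finite list of elements v^m b_w. -/
lemma mem_span_nat_bKL {x : Hecke} :
    x ∈ Submodule.span (LaurentPolynomial ℕ) (Set.range bKL) ↔ ∃ L, charOf L = x := by
  constructor
  · intro hx
    induction hx using Submodule.span_induction with
    | mem x hx =>
      obtain ⟨w, rfl⟩ := hx
      refine ⟨[(w, 0)], ?_⟩
      rw [charOf, List.map_singleton, List.sum_singleton, klShift, LaurentPolynomial.T_zero, one_smul]
    | zero => exact ⟨[], rfl⟩
    | add x y _ _ hx hy =>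
      obtain ⟨L, rfl⟩ := hx
      obtain ⟨L', rfl⟩ := hy
      exact ⟨L ++ L', charOf_append L L'⟩
    | smul a x _ hx =>
      obtain ⟨L, rfl⟩ := hx
      induction a using LaurentPolynomial.induction_on' with
      | add p q hp hq =>
        obtain ⟨L₁, h₁⟩ := hp
        obtain ⟨L₂, h₂⟩ := hq
        exact ⟨L₁ ++ L₂, by rw [charOf_append, h₁, h₂, add_smul]⟩
      | C_mul_T n a =>
        induction a with
        | zero => exact ⟨[], by
            rw [map_zero, zero_mul]
            exact (zero_smul (LaurentPolynomial ℕ) (charOf L)).symm⟩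
        | succ a ih =>
          obtain ⟨L', h'⟩ := ih
          refine ⟨L' ++ shiftList n L, ?_⟩
          rw [charOf_append, h', charOf_shiftList, map_add, map_one, add_mul, one_mul, add_smul,
            natLaurent_T_smul]
  · rintro ⟨L, rfl⟩
    refine list_sum_mem fun x hx => ?_
    obtain ⟨p, -, rfl⟩ := List.mem_map.1 hx
    rw [klShift, ← natLaurent_T_smul]
    exact Submodule.smul_mem _ _ (Submodule.subset_span ⟨_, rfl⟩)

/-- The positive part `⨁ ℕ[v, v⁻¹] b_w` of the Hecke algebra. -/
noncomputable def positivePart : Subalgebra (LaurentPolynomial ℕ) Hecke :=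
  (Submodule.span (LaurentPolynomial ℕ) (Set.range bKL)).toSubalgebra
    (Submodule.subset_span ⟨1, bKL_one⟩) fun x y hx hy => by
      obtain ⟨L, rfl⟩ := mem_span_nat_bKL.1 hx
      obtain ⟨L', rfl⟩ := mem_span_nat_bKL.1 hy
      -- Positivity of the structure constants comes from bimodules: a product of characters is the
      -- character of a tensor product, which is again a sum of B_w(m). The statement does not
      -- mention k, so the field ℚ serves.
      obtain ⟨L'', -, h⟩ := (hasChar_sumBW (k := ℚ) L).tensor (hasChar_sumBW (k := ℚ) L')
      exact mem_span_nat_bKL.2 ⟨L'', h⟩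

lemma toSubmodule_positivePart : Subalgebra.toSubmodule positivePart =
    Submodule.span (LaurentPolynomial ℕ) (Set.range bKL) :=
  Submodule.toSubalgebra_toSubmodule _ _ _

lemma mem_positivePart {x : Hecke} : x ∈ positivePart ↔ ∃ L, charOf L = x := mem_span_nat_bKL

lemma SBim.char_mem_positivePart (M : SBim k) : M.char ∈ positivePart := by
  obtain ⟨L, -, h⟩ := M.hasChar
  exact mem_positivePart.2 ⟨L, h⟩

/-! ## The two Grothendieck objects -/

variable (k) in
/-- The bijection from the isomorphism classes of Soergel bimodules to the positive part. -/
noncomputable def isoClassesEquiv : IsoClasses k ≃ positivePart :=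
  Equiv.ofBijective (Quotient.lift (fun M : SBim k => (⟨M.char, M.char_mem_positivePart⟩ : positivePart))
    fun _ _ h => Subtype.ext (SBim.char_eq_iff.2 (Quotient.sound h))) (by
      constructor
      · rintro ⟨M⟩ ⟨N⟩ h
        exact SBim.char_eq_iff.1 (congrArg Subtype.val h)
      · rintro ⟨x, hx⟩
        obtain ⟨L, rfl⟩ := mem_positivePart.1 hx
        exact ⟨isoClass ⟨sumBW k L, L, IsIso.refl _⟩,
          Subtype.ext (SBim.char_eq (IsIso.refl _) (hasChar_sumBW L))⟩)

lemma isoClassesEquiv_isoClass (M : SBim k) : (isoClassesEquiv k (isoClass M) : Hecke) = M.char := rfl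

variable (k) in
-- The structure is transported from the positive part. That it agrees with direct sum, tensor
-- product and shift is then a statement about characters.
lemma exists_algebra_isoClasses :
    ∃ (_ : Semiring (IsoClasses k)) (_ : Algebra (LaurentPolynomial ℕ) (IsoClasses k))
      (φ : IsoClasses k ≃ₐ[LaurentPolynomial ℕ] positivePart),
      ∀ M : SBim k, (φ (isoClass M) : Hecke) = M.char :=
  letI := (isoClassesEquiv k).semiring
  ⟨inferInstance, (isoClassesEquiv k).algebra (LaurentPolynomial ℕ),
    (isoClassesEquiv k).algEquiv (LaurentPolynomial ℕ), isoClassesEquiv_isoClass⟩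

lemma grothClass_eq_add {M N P : SBim k} (h : IsIso M.1 (N.1.sum P.1)) :
    grothClass M = grothClass N + grothClass P := by
  refine Eq.symm (QuotientAddGroup.eq.2 ?_)
  rw [neg_add_eq_sub]
  exact AddSubgroup.subset_closure ⟨M, N, P, h, rfl⟩

lemma grothClass_eq_sum (L : List (S3 × ℤ)) (M : SBim k) (h : IsIso M.1 (sumBW k L)) :
    grothClass M = (L.map fun p => grothClass (SBim.ofWShift k p.1 p.2)).sum := by
  induction L generalizing M with
  | nil =>
    -- A zero bimodule satisfies M ≅ M ⊕ M, so its class is zero.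
    have := grothClass_eq_add (M := M) (N := M) (P := M)
      ((isIso_sum_zero _).trans ((IsIso.refl _).sum h.symm))
    exact left_eq_add.1 this
  | cons p L ih =>
    rw [List.map_cons, List.sum_cons, ← ih ⟨sumBW k L, L, IsIso.refl _⟩ (IsIso.refl _)]
    exact grothClass_eq_add h

variable (k) in
/-- The homomorphism from the split Grothendieck group to the Hecke algebra. -/
noncomputable def grothChar : SplitGroth k →+ Hecke :=
  QuotientAddGroup.lift (splitRel k) (FreeAbelianGroup.lift SBim.char) (by
    refine (AddSubgroup.closure_le _).2 ?_
    rintro _ ⟨M, N, P, h, rfl⟩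
    rw [SetLike.mem_coe, AddMonoidHom.mem_ker, map_sub, map_add, FreeAbelianGroup.lift_apply_of,
      FreeAbelianGroup.lift_apply_of, FreeAbelianGroup.lift_apply_of, sub_eq_zero]
    exact SBim.char_eq h (N.hasChar.sum P.hasChar))

lemma grothChar_grothClass (M : SBim k) : grothChar k (grothClass M) = M.char :=
  FreeAbelianGroup.lift_apply_of _ _

variable (k) in
/-- The inverse of `grothChar`. -/
noncomputable def grothCharInv : Hecke →+ SplitGroth k :=
  (klShiftBasis.constr ℤ fun p => grothClass (SBim.ofWShift k p.1 p.2)).toAddMonoidHom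

lemma grothCharInv_klShift (p : S3 × ℤ) :
    grothCharInv k (klShift p) = grothClass (SBim.ofWShift k p.1 p.2) := by
  rw [← klShiftBasis_apply]
  exact klShiftBasis.constr_basis ℤ _ p

variable (k) in
/-- The split Grothendieck group is isomorphic to the Hecke algebra as an abelian group. -/
noncomputable def grothEquiv : SplitGroth k ≃+ Hecke :=
  AddMonoidHom.toAddEquiv (grothChar k) (grothCharInv k)
    (by
      refine QuotientAddGroup.addMonoidHom_ext _ (FreeAbelianGroup.lift_ext _ _ fun M => ?_)
      change grothCharInv k (grothChar k (grothClass M)) = grothClass M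
      obtain ⟨L, hL, h⟩ := M.hasChar
      rw [grothChar_grothClass, ← h, charOf, map_list_sum, List.map_map, grothClass_eq_sum L M hL]
      congr 1
      exact List.map_congr_left fun p _ => grothCharInv_klShift p)
    (by
      refine AddMonoidHom.toIntLinearMap_injective (klShiftBasis.ext fun p => ?_)
      rw [klShiftBasis_apply]
      change grothChar k (grothCharInv k (klShift p)) = klShift p
      rw [grothCharInv_klShift, grothChar_grothClass, SBim.char_ofWShift])

lemma grothEquiv_grothClass (M : SBim k) : grothEquiv k (grothClass M) = M.char :=
  grothChar_grothClass M

variable (k) in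
-- The ring is built on top of the given additive group, so that the agreement of the two additions
-- holds by definition.
lemma exists_algebra_splitGroth :
    ∃ (ring : Ring (SplitGroth k)) (_ : Algebra ℤ[T;T⁻¹] (SplitGroth k))
      (φ : SplitGroth k ≃ₐ[ℤ[T;T⁻¹]] Hecke), ring.toAddCommGroup = SplitGroth.instAddCommGroup ∧
      ∀ M : SBim k, φ (grothClass M) = M.char := by
  let e := grothEquiv k
  let ring : Ring (SplitGroth k) :=
    { SplitGroth.instAddCommGroup with
      mul := fun a b => e.symm (e a * e b)
      one := e.symm 1
      mul_assoc := fun a b c => by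
        change e.symm (e (e.symm (e a * e b)) * e c) = e.symm (e a * e (e.symm (e b * e c)))
        rw [e.apply_symm_apply, e.apply_symm_apply, mul_assoc]
      one_mul := fun a => by
        change e.symm (e (e.symm 1) * e a) = a
        rw [e.apply_symm_apply, one_mul, e.symm_apply_apply]
      mul_one := fun a => by
        change e.symm (e a * e (e.symm 1)) = a
        rw [e.apply_symm_apply, mul_one, e.symm_apply_apply]
      left_distrib := fun a b c => by
        change e.symm (e a * e (b + c)) = e.symm (e a * e b) + e.symm (e a * e c)
        rw [map_add, mul_add, map_add]
      right_distrib := fun a b c => by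
        change e.symm (e (a + b) * e c) = e.symm (e a * e c) + e.symm (e b * e c)
        rw [map_add, add_mul, map_add]
      zero_mul := fun a => by
        change e.symm (e 0 * e a) = 0
        rw [map_zero, zero_mul, map_zero]
      mul_zero := fun a => by
        change e.symm (e a * e 0) = 0
        rw [map_zero, mul_zero, map_zero] }
  let E : SplitGroth k ≃+* Hecke :=
    { e with map_mul' := fun a b => e.apply_symm_apply (e a * e b) }
  let alg : Algebra ℤ[T;T⁻¹] (SplitGroth k) :=
    ((E.symm : Hecke →+* SplitGroth k).comp (algebraMap ℤ[T;T⁻¹] Hecke)).toAlgebra' fun c x =>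
      E.injective (by
        rw [map_mul, map_mul]
        change E (E.symm _) * _ = _ * E (E.symm _)
        rw [E.apply_symm_apply, Algebra.commutes])
  exact ⟨ring, alg, AlgEquiv.ofRingEquiv (f := E) fun c => E.apply_symm_apply _, rfl,
    grothEquiv_grothClass⟩

/-! ### Uniqueness of the isomorphisms -/

lemma existsUnique_algEquiv_positivePart {A : Type*} [Semiring A] [Algebra (LaurentPolynomial ℕ) A]
    {b : S3 → A} (φ : A ≃ₐ[LaurentPolynomial ℕ] positivePart)
    (hφ : ∀ w, (φ (b w) : Hecke) = bKL w) :
    ∃! ψ : A ≃ₐ[LaurentPolynomial ℕ] positivePart, ∀ w, (ψ (b w) : Hecke) = bKL w := by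
  refine ⟨φ, hφ, fun ψ hψ => AlgEquiv.ext fun x => ?_⟩
  -- The induction runs over the element φ(x) of the span, and the summands are pulled back through
  -- φ. Thus ψ is compared with φ on combinations of the classes b_w, without subtraction.
  have key (h : Hecke) (hh : h ∈ Submodule.span (LaurentPolynomial ℕ) (Set.range bKL)) :
      ∀ x, (φ x : Hecke) = h → (ψ x : Hecke) = h := by
    induction hh using Submodule.span_induction with
    | mem h hh =>
      obtain ⟨w, rfl⟩ := hh
      intro x hx
      rw [φ.injective (Subtype.ext (hx.trans (hφ w).symm)), hψ]
    | zero =>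
      intro x hx
      have : x = 0 := φ.injective (Subtype.ext (by rw [hx, map_zero]; rfl))
      rw [this, map_zero]; rfl
    | add h h' hh hh' ih ih' =>
      intro x hx
      have e : x = φ.symm ⟨h, hh⟩ + φ.symm ⟨h', hh'⟩ := φ.injective (Subtype.ext (by
        rw [map_add, φ.apply_symm_apply, φ.apply_symm_apply, hx]; rfl))
      rw [e, map_add]
      exact congrArg₂ (· + ·) (ih _ (by rw [φ.apply_symm_apply])) (ih' _ (by rw [φ.apply_symm_apply]))
    | smul a h hh ih =>
      intro x hx
      have e : x = a • φ.symm ⟨h, hh⟩ := φ.injective (Subtype.ext (by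
        rw [map_smul, φ.apply_symm_apply, hx]; rfl))
      rw [e, map_smul]
      exact congrArg (a • ·) (ih _ (by rw [φ.apply_symm_apply]))
  exact Subtype.ext (key _ (φ x).2 x rfl)

lemma algEquiv_hecke_eq {A : Type*} [Semiring A] [Algebra ℤ[T;T⁻¹] A] {b : S3 → A}
    {φ ψ : A ≃ₐ[ℤ[T;T⁻¹]] Hecke} (hφ : ∀ w, φ (b w) = bKL w) (hψ : ∀ w, ψ (b w) = bKL w) :
    ψ = φ := by
  have : (φ.symm.trans ψ).toLinearMap = LinearMap.id := LinearMap.ext_on_range span_bKL fun w => by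
    rw [AlgEquiv.toLinearMap_apply, AlgEquiv.trans_apply, ← hφ, φ.symm_apply_apply, hψ, hφ]
    rfl
  refine AlgEquiv.ext fun x => ?_
  have := LinearMap.congr_fun this (φ x)
  rwa [AlgEquiv.toLinearMap_apply, AlgEquiv.trans_apply, φ.symm_apply_apply] at this

end SoergelS3

/-! ### The main theorem -/

theorem mainTheorem4 (k : Type u) [Field k] (h2 : (2 : k) ≠ 0) :
    -- the elements `b_w` are the Kazhdan–Lusztig elements, and they form a basis of `H`
    (∀ (w : S3) (b : Hecke), IsKazhdanLusztig w b ↔ b = bKL w) ∧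
    LinearIndependent ℤ[T;T⁻¹] bKL ∧ Submodule.span ℤ[T;T⁻¹] (Set.range bKL) = ⊤ ∧
    -- the six bimodules `B_w` are indecomposable
    (∀ w : S3, (BW k w).Indecomposable) ∧
    -- `(w, m) ↦ B_w(m)` is a bijection from `S_3 × ℤ` onto the indecomposable Soergel bimodules
    -- up to isomorphism
    (∀ (w : S3) (m : ℤ), IsSoergel ((BW k w).shift m) ∧ ((BW k w).shift m).Indecomposable) ∧
    (∀ M : GrBimod k, IsSoergel M → M.Indecomposable →
      ∃! p : S3 × ℤ, M.IsIso ((BW k p.1).shift p.2)) ∧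
    -- Soergel bimodules are stable under direct sums, products and shifts
    (∀ M N : GrBimod k, IsSoergel M → IsSoergel N →
      IsSoergel (M.sum N) ∧ IsSoergel (M.tensor N)) ∧
    (∀ (M : GrBimod k) (n : ℤ), IsSoergel M → IsSoergel (M.shift n)) ∧
    -- the isomorphism classes form an `ℕ[v, v⁻¹]`-algebra, isomorphic to the positive part of `H`
    (∃ (_ : Semiring (IsoClasses k)) (_ : Algebra (LaurentPolynomial ℕ) (IsoClasses k)),
      (∀ M N P : SBim k, P.1.IsIso (M.1.sum N.1) → isoClass P = isoClass M + isoClass N) ∧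
      (∀ M N P : SBim k, P.1.IsIso (M.1.tensor N.1) → isoClass P = isoClass M * isoClass N) ∧
      (∀ M P : SBim k, P.1.IsIso (M.1.shift 1) →
        isoClass P = (LaurentPolynomial.T 1 : LaurentPolynomial ℕ) • isoClass M) ∧
      ∃ Hpos : Subalgebra (LaurentPolynomial ℕ) Hecke,
        Subalgebra.toSubmodule Hpos =
          Submodule.span (LaurentPolynomial ℕ) (Set.range bKL) ∧
        LinearIndependent (LaurentPolynomial ℕ) bKL ∧
        ∃! φ : IsoClasses k ≃ₐ[LaurentPolynomial ℕ] Hpos,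
          ∀ w : S3, (φ (isoClass (SBim.ofW k w)) : Hecke) = bKL w) ∧
    -- the split Grothendieck group is a `ℤ[v, v⁻¹]`-algebra, isomorphic to `H`
    (∃ (ring : Ring (SplitGroth k)) (_ : Algebra ℤ[T;T⁻¹] (SplitGroth k)),
      ring.toAddCommGroup = SplitGroth.instAddCommGroup ∧
      (∀ M N P : SBim k, P.1.IsIso (M.1.tensor N.1) →
        grothClass P = grothClass M * grothClass N) ∧
      (∀ M P : SBim k, P.1.IsIso (M.1.shift 1) →
        grothClass P = (LaurentPolynomial.T 1 : ℤ[T;T⁻¹]) • grothClass M) ∧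
      ∃! φ : SplitGroth k ≃ₐ[ℤ[T;T⁻¹]] Hecke,
        (∀ w : S3, φ (grothClass (SBim.ofW k w)) = bKL w) ∧
        φ (grothClass (SBim.ofWShift k 1 1)) =
          algebraMap ℤ[T;T⁻¹] Hecke (LaurentPolynomial.T 1)) := by
  have hsum (M N P : SBim k) (h : P.1.IsIso (M.1.sum N.1)) : P.char = M.char + N.char :=
    SBim.char_eq h (M.hasChar.sum N.hasChar)
  have hmul (M N P : SBim k) (h : P.1.IsIso (M.1.tensor N.1)) : P.char = M.char * N.char :=
    SBim.char_eq h (M.hasChar.tensor N.hasChar)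
  have hshift (M P : SBim k) (h : P.1.IsIso (M.1.shift 1)) :
      P.char = (LaurentPolynomial.T 1 : ℤ[T;T⁻¹]) • M.char :=
    SBim.char_eq h (M.hasChar.shift 1)
  refine ⟨isKazhdanLusztig_iff, linearIndependent_bKL, span_bKL,
    fun w => (isCyclic_BW w).isBrick.indecomposable,
    fun w m => ⟨isSoergel_BW_shift w m, indecomposable_BW_shift (w, m)⟩,
    fun M => existsUnique_isIso_of_indecomposable, fun M N hM hN => ?_, fun M n hM => ?_, ?_, ?_⟩
  · obtain ⟨m, hm⟩ := isSoergel_iff.1 hM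
    obtain ⟨n, hn⟩ := isSoergel_iff.1 hN
    exact ⟨(hm.sum hn).isSoergel, (hm.tensor hn).isSoergel⟩
  · obtain ⟨m, hm⟩ := isSoergel_iff.1 hM
    exact (hm.shift n).isSoergel
  · obtain ⟨s, a, φ, hφ⟩ := exists_algebra_isoClasses k
    -- Since φ is injective and sends a class to its character, each identity between classes is
    -- checked on characters.
    refine ⟨s, a, fun M N P h => φ.injective (Subtype.ext ?_),
      fun M N P h => φ.injective (Subtype.ext ?_), fun M P h => φ.injective (Subtype.ext ?_),
      positivePart, toSubmodule_positivePart, linearIndependent_nat_bKL,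
      existsUnique_algEquiv_positivePart φ fun w => (hφ _).trans (SBim.char_ofW w)⟩
    · rw [map_add, hφ, hsum M N P h, ← hφ, ← hφ]; rfl
    · rw [map_mul, hφ, hmul M N P h, ← hφ, ← hφ]; rfl
    · rw [map_smul, hφ, hshift M P h, ← natLaurent_T_smul, ← hφ]; rfl
  · obtain ⟨r, a, φ, hr, hφ⟩ := exists_algebra_splitGroth k
    refine ⟨r, a, hr, fun M N P h => φ.injective ?_, fun M P h => φ.injective ?_, φ, ⟨?_, ?_⟩,
      fun ψ hψ => algEquiv_hecke_eq (fun w => (hφ _).trans (SBim.char_ofW w)) hψ.1⟩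
    · rw [map_mul, hφ, hmul M N P h, ← hφ, ← hφ]
    · rw [map_smul, hφ, hshift M P h, ← hφ]
    · exact fun w => (hφ _).trans (SBim.char_ofW w)
    -- The character of R(1) is v b_e, and b_e = 1.
    · rw [hφ, SBim.char_ofWShift, klShift, bKL_one, Algebra.algebraMap_eq_smul_one]
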